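/- **Lemma (Lower symbols and density matrices).** Let $\mathfrak H$ be a complex Hilbert space and $\mathcal F(\mathfrak H)=\bigoplus_{n\ge 0}\bigotimes_s^n\mathfrak H$ its bosonic Fock space, where $\bigotimes_s^n\mathfrak H\subset\bigotimes^n\mathfrak H$ is the subspace of permutation-invariant tensors. Let $\Gamma$ be a state on $\mathcal F(\mathfrak H)$, i.e. a bounded operator with $\Gamma\ge 0$ and $\operatorname{tr}\Gamma=1$ (not necessarily commuting with the number operator $\mathcal N$), with diagonal blocks $G_n$ on $\bigotimes_s^n\mathfrak H$. Its $\ell$-particle density matrix is $$\Gamma^{(\ell)}=\sum_{n\ge \ell}\binom n\ell \operatorname{tr}_{\ell+1\to n}(G_n),$$ and $\operatorname{tr}(\mathcal N^k\Gamma)=\sum_n n^k\operatorname{tr}G_n\in[0,\infty]$. For an operator $A$ on $\bigotimes_s^\ell\mathfrak H$ and $\ell\le k$, put $A\otimes_s 1_{k-\ell}=\binom k\ell^{-1}\sum_{1\le i_1<\dots<i_\ell\le k}A_{i_1\dots i_\ell}$ on $\bigotimes_s^k\mathfrak H$, where $A_{i_1\dots i_\ell}$ acts on the variables $i_1,\dots,i_\ell$.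 Let $V\subset\mathfrak H$ be a finite-dimensional subspace with orthogonal projection $P_V$, let $\Gamma_V=\operatorname{tr}_{\mathcal F(V^\perp)}\Gamma$ be the localized state on $\mathcal F(V)$, defined through the factorization $\mathcal F(\mathfrak H)\simeq\mathcal F(V)\otimes\mathcal F(V^\perp)$, let $\varepsilon>0$, and let $$d\mu^\varepsilon_{V,\Gamma}(u)=(\varepsilon\pi)^{-\dim V}\big\langle \xi(u/\sqrt\varepsilon),\Gamma_V\,\xi(u/\sqrt\varepsilon)\big\rangle\,du,\qquad \xi(u)=e^{-|u|^2/2}\bigoplus_{n\ge0}\frac{u^{\otimes n}}{\sqrt{n!}},$$ where $du$ is the Lebesgue measure of $V\simeq\mathbb C^{\dim V}$. Let $k\ge 0$ be an integer. (a) Suppose that $\operatorname{tr}(\mathcal N^k\Gamma_V)<\infty$. Then for every $\ell\le k$ $$\Gamma_V^{(\ell)}=(P_V)^{\otimes \ell}\,\Gamma^{(\ell)}\,(P_V)^{\otimes \ell}$$ in the sense that the series $\sum_{n\ge \ell}\binom n\ell (P_V)^{\otimes \ell}\operatorname{tr}_{\ell+1\to n}(G_n)(P_V)^{\otimes \ell}$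 converges to $\Gamma_V^{(\ell)}$; the function $u\mapsto |u^{\otimes k}\rangle\langle u^{\otimes k}|$ is $\mu^\varepsilon_{V,\Gamma}$-integrable; and on $\bigotimes_s^kV$ $$\int_V|u^{\otimes k}\rangle\langle u^{\otimes k}|\,d\mu^\varepsilon_{V,\Gamma}(u)=k!\,\varepsilon^k\sum_{\ell=0}^k\binom k\ell\,\Gamma_V^{(\ell)}\otimes_s 1_{k-\ell}.$$ In particular $$k!\,\varepsilon^k\,\Gamma_V^{(k)}\le\int_V|u^{\otimes k}\rangle\langle u^{\otimes k}|\,d\mu^\varepsilon_{V,\Gamma}(u)$$ as operators on $\bigotimes_s^kV$. (b) If $\operatorname{tr}(\mathcal N^k\Gamma)<\infty$, then $\operatorname{tr}(\mathcal N^k\Gamma_V)<\infty$ (so (a) applies), $\Gamma_V^{(\ell)}=(P_V)^{\otimes \ell}\,\Gamma^{(\ell)}\,(P_V)^{\otimes \ell}$ for all $\ell\le k$ with $\Gamma^{(\ell)}$ the operator on $\bigotimes_s^\ell\mathfrak H$ above, and $$k!\,\varepsilon^k\,(P_V)^{\otimes k}\Gamma^{(k)}(P_V)^{\otimes k}\le\int_V|u^{\otimes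 k}\rangle\langle u^{\otimes k}|\,d\mu^\varepsilon_{V,\Gamma}(u)\qquad\text{on }\textstyle\bigotimes_s^kV .$$ -/

import Mathlib

open MeasureTheory
open scoped ComplexConjugate ENNReal TensorProduct ComplexOrder

set_option linter.unusedSectionVars false

noncomputable section
namespace BoseFock

/-- The algebraic tensor power `⨂_{i ∈ ι} H`, to be equipped with the inner product
`⟪⨂ fᵢ, ⨂ gᵢ⟫ = ∏ ⟪fᵢ, gᵢ⟫`. -/
def PreTensor (ι : Type) (H : Type*) [NormedAddCommGroup H] [InnerProductSpace ℂ H] : Type _ :=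
  PiTensorProduct ℂ (fun _ : ι => H)

section Pre
variable {ι : Type} [Fintype ι] {H : Type*} [NormedAddCommGroup H] [InnerProductSpace ℂ H]

instance : AddCommGroup (PreTensor ι H) :=
  inferInstanceAs (AddCommGroup (PiTensorProduct ℂ (fun _ : ι => H)))

instance : Module ℂ (PreTensor ι H) :=
  inferInstanceAs (Module ℂ (PiTensorProduct ℂ (fun _ : ι => H)))

/-- The pure tensor `f₁ ⊗ ⋯ ⊗ fₙ`, as a multilinear map. -/
def tprodPre : MultilinearMap ℂ (fun _ : ι => H) (PreTensor ι H) :=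
  PiTensorProduct.tprod ℂ

/-- The linear functional `⨂ gᵢ ↦ ∏ ⟪fᵢ, gᵢ⟫`. -/
def pairL (f : ι → H) : PreTensor ι H →ₗ[ℂ] ℂ :=
  PiTensorProduct.lift
    ((MultilinearMap.mkPiAlgebra ℂ ι ℂ).compLinearMap fun i => (innerSL ℂ (f i)).toLinearMap)

lemma pairL_pure (f g : ι → H) : pairL f (tprodPre g) = ∏ i, inner ℂ (f i) (g i) := by
  refine (PiTensorProduct.lift.tprod _).trans ?_
  simp

lemma pre_ext {M : Type*} [AddCommGroup M] [Module ℂ M] {a b : PreTensor ι H →ₗ[ℂ] M}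
    (h : ∀ f, a (tprodPre f) = b (tprodPre f)) : a = b :=
  PiTensorProduct.ext (MultilinearMap.ext h)

lemma pre_induction {p : PreTensor ι H → Prop} (x : PreTensor ι H)
    (hp : ∀ (c : ℂ) (f : ι → H), p (c • tprodPre f)) (ha : ∀ x y, p x → p y → p (x + y)) : p x :=
  PiTensorProduct.induction_on x hp ha

/-- For fixed `x`, the linear functional `⨂ fᵢ ↦ conj (pairL f x)`. -/
def innerRight (x : PreTensor ι H) : PreTensor ι H →ₗ[ℂ] ℂ :=
  PiTensorProduct.lift
    { toFun := fun f => conj (pairL f x)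
      map_update_add' := by
        intro _ f i a b
        have : pairL (Function.update f i (a + b))
            = pairL (Function.update f i a) + pairL (Function.update f i b) := by
          refine pre_ext fun g => ?_
          simp only [LinearMap.add_apply, pairL_pure]
          have key : ∀ c : H, ∏ j, inner ℂ (Function.update f i c j) (g j)
              = inner ℂ c (g i) * ∏ j ∈ Finset.univ.erase i, inner ℂ (f j) (g j) := by
            intro c
            rw [← Finset.mul_prod_erase _ _ (Finset.mem_univ i), Function.update_self]
            congr 1
            refine Finset.prod_congr rfl fun j hj => ?_
            rw [Function.update_of_ne (Finset.ne_of_mem_erase hj)]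
          have e : ∀ c : H, (∏ j, inner ℂ (Function.update f i c j) (g j))
              = inner ℂ c (g i) * ∏ j ∈ Finset.univ.erase i, inner ℂ (f j) (g j) := key
          convert_to (∏ j, inner ℂ (Function.update f i (a + b) j) (g j))
            = (∏ j, inner ℂ (Function.update f i a j) (g j))
              + (∏ j, inner ℂ (Function.update f i b j) (g j)) using 2
          simp only [e, inner_add_left, add_mul]
        convert_to conj (pairL (Function.update f i (a + b)) x)
          = conj (pairL (Function.update f i a) x) + conj (pairL (Function.update f i b) x)
        rw [this, LinearMap.add_apply, map_add]
      map_update_smul' := by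
        intro _ f i c a
        have : pairL (Function.update f i (c • a)) = conj c • pairL (Function.update f i a) := by
          refine pre_ext fun g => ?_
          simp only [LinearMap.smul_apply, pairL_pure]
          have key : ∀ c : H, ∏ j, inner ℂ (Function.update f i c j) (g j)
              = inner ℂ c (g i) * ∏ j ∈ Finset.univ.erase i, inner ℂ (f j) (g j) := by
            intro c
            rw [← Finset.mul_prod_erase _ _ (Finset.mem_univ i), Function.update_self]
            congr 1
            refine Finset.prod_congr rfl fun j hj => ?_
            rw [Function.update_of_ne (Finset.ne_of_mem_erase hj)]
          simp only [key, inner_smul_left, smul_eq_mul, mul_assoc]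
        rw [this, LinearMap.smul_apply, smul_eq_mul, map_mul, Complex.conj_conj, smul_eq_mul] }

lemma innerRight_pure (x : PreTensor ι H) (f : ι → H) :
    innerRight x (tprodPre f) = conj (pairL f x) := by
  exact PiTensorProduct.lift.tprod _

lemma innerRight_pure_pure (f g : ι → H) :
    innerRight (tprodPre f) (tprodPre g) = ∏ i, inner ℂ (f i) (g i) := by
  rw [innerRight_pure, pairL_pure, map_prod]
  exact Finset.prod_congr rfl fun i _ => inner_conj_symm _ _

lemma innerRight_add (x y : PreTensor ι H) : innerRight (x + y) = innerRight x + innerRight y :=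
  pre_ext fun f => by simp [innerRight_pure]

lemma innerRight_smul (c : ℂ) (x : PreTensor ι H) : innerRight (c • x) = conj c • innerRight x :=
  pre_ext fun f => by simp [innerRight_pure]

lemma innerRight_conj (x y : PreTensor ι H) : conj (innerRight y x) = innerRight x y := by
  induction x using pre_induction with
  | ha x x' hx hx' => simp [innerRight_add, hx, hx']
  | hp c f =>
    induction y using pre_induction with
    | ha y y' hy hy' =>
      simp only [innerRight_add, LinearMap.add_apply, map_add] at *
      rw [hy, hy']
    | hp d g =>
      simp [innerRight_smul, innerRight_pure_pure]
      ring

lemma posSemidef_prod_gram {κ : Type*} [Finite κ] (F : κ → ι → H) (s : Finset ι) :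
    (Matrix.of fun a b : κ => ∏ i ∈ s, inner ℂ (F a i) (F b i)).PosSemidef := by
  classical
  induction s using Finset.induction_on with
  | empty =>
    have e : (Matrix.of fun a b : κ => ∏ i ∈ (∅ : Finset ι), inner ℂ (F a i) (F b i))
        = Matrix.gram ℂ (fun _ : κ => (1 : ℂ)) := by
      ext a b
      simp
    rw [e]
    exact Matrix.posSemidef_gram (𝕜 := ℂ) _
  | insert i s hi ih =>
    have e : (Matrix.of fun a b : κ => ∏ j ∈ insert i s, inner ℂ (F a j) (F b j))
        = (Matrix.gram ℂ (fun a => F a i)).hadamard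
          (Matrix.of fun a b : κ => ∏ j ∈ s, inner ℂ (F a j) (F b j)) := by
      ext a b
      simp [Finset.prod_insert hi]
    rw [e]
    exact (Matrix.posSemidef_gram (𝕜 := ℂ) (fun a => F a i)).hadamard ih

lemma innerRight_self_nonneg (x : PreTensor ι H) : 0 ≤ (innerRight x x).re := by
  have hx : x ∈ Submodule.span ℂ (Set.range (tprodPre (ι := ι) (H := H))) := by
    have h : Submodule.span ℂ (Set.range (tprodPre (ι := ι) (H := H))) = ⊤ :=
      PiTensorProduct.span_tprod_eq_top
    rw [h]; trivial
  obtain ⟨c, rfl⟩ := (Finsupp.mem_span_range_iff_exists_finsupp).1 hx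
  have h := (posSemidef_prod_gram (fun f : c.support => (f : ι → H))
    Finset.univ).dotProduct_mulVec_nonneg (fun f => c f)
  have hs : ∀ (s : Finset (ι → H)) (y : PreTensor ι H),
      innerRight (∑ f ∈ s, c f • tprodPre f) y
        = ∑ f ∈ s, conj (c f) * innerRight (tprodPre f) y := by
    classical
    intro s y
    induction s using Finset.induction_on with
    | empty =>
      have : innerRight (0 : PreTensor ι H) = 0 := by
        simpa using innerRight_smul (0 : ℂ) (0 : PreTensor ι H)
      simp [this]
    | insert f s hf ih =>
      rw [Finset.sum_insert hf, Finset.sum_insert hf, innerRight_add, innerRight_smul]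
      simp [ih]
  have e : innerRight (c.sum fun f a => a • tprodPre f) (c.sum fun f a => a • tprodPre f)
      = star (fun f : c.support => c f) ⬝ᵥ
        (Matrix.of fun a b : c.support => ∏ i, inner ℂ (a.1 i) (b.1 i)).mulVec
          (fun f => c f) := by
    simp only [Finsupp.sum]
    rw [hs, ← Finset.sum_coe_sort c.support]
    simp only [dotProduct, Matrix.mulVec, Pi.star_apply, Matrix.of_apply]
    refine Finset.sum_congr rfl fun f _ => ?_
    rw [map_sum, ← Finset.sum_coe_sort c.support]
    congr 1
    refine Finset.sum_congr rfl fun g _ => ?_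
    rw [map_smul, innerRight_pure_pure, smul_eq_mul, mul_comm]
  rw [e]
  exact (Complex.le_def.1 h).1

instance preCore : PreInnerProductSpace.Core ℂ (PreTensor ι H) where
  inner x y := innerRight x y
  conj_inner_symm x y := innerRight_conj x y
  re_inner_nonneg x := innerRight_self_nonneg x
  add_left x y z := by rw [innerRight_add]; rfl
  smul_left x y c := by rw [innerRight_smul]; rfl

instance : SeminormedAddCommGroup (PreTensor ι H) :=
  InnerProductSpace.Core.toSeminormedAddCommGroup (𝕜 := ℂ)

instance : InnerProductSpace ℂ (PreTensor ι H) :=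
  InnerProductSpace.ofCore preCore

lemma inner_pure (f g : ι → H) :
    inner ℂ (tprodPre f : PreTensor ι H) (tprodPre g) = ∏ i, inner ℂ (f i) (g i) :=
  innerRight_pure_pure f g

end Pre

/-- The Hilbert-space tensor power `⨂_{i ∈ ι} H`: the completion of the algebraic one. -/
abbrev HTensor (ι : Type) [Fintype ι] (H : Type*) [NormedAddCommGroup H] [InnerProductSpace ℂ H] :
    Type _ :=
  UniformSpace.Completion (PreTensor ι H)


section Shortcuts
variable (ι : Type) [Fintype ι] (H : Type*) [NormedAddCommGroup H] [InnerProductSpace ℂ H]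

instance : NormedAddCommGroup (HTensor ι H) := inferInstance
instance : InnerProductSpace ℂ (HTensor ι H) := inferInstance
instance : NormedSpace ℂ (HTensor ι H) := InnerProductSpace.toNormedSpace
instance : SeminormedAddCommGroup (HTensor ι H) := NormedAddCommGroup.toSeminormedAddCommGroup
instance : AddCommGroup (HTensor ι H) := NormedAddCommGroup.toAddCommGroup
instance : AddCommMonoid (HTensor ι H) := AddCommGroup.toAddCommMonoid
instance : Module ℂ (HTensor ι H) := NormedSpace.toModule

end Shortcuts

section Tensor
variable {ι κ : Type} [Fintype ι] [Fintype κ]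
variable {H K : Type*} [NormedAddCommGroup H] [InnerProductSpace ℂ H]
  [NormedAddCommGroup K] [InnerProductSpace ℂ K]

/-- The inclusion of the algebraic tensor power. -/
def toHT : PreTensor ι H →L[ℂ] HTensor ι H := UniformSpace.Completion.toComplL

/-- The pure tensor `⨂ fᵢ` in the Hilbert-space tensor power. -/
def tprodH (f : ι → H) : HTensor ι H := toHT (tprodPre f)

lemma dense_toHT : DenseRange (toHT (ι := ι) (H := H)) :=
  UniformSpace.Completion.denseRange_coe

lemma inner_toHT (x y : PreTensor ι H) : inner ℂ (toHT x) (toHT y) = inner ℂ x y :=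
  UniformSpace.Completion.inner_coe x y

lemma norm_toHT (x : PreTensor ι H) : ‖toHT x‖ = ‖x‖ :=
  UniformSpace.Completion.norm_coe x

lemma uniformInducing_toHT : IsUniformInducing (toHT (ι := ι) (H := H)) :=
  UniformSpace.Completion.isUniformInducing_coe _

lemma inner_tprodH (f g : ι → H) :
    inner ℂ (tprodH f) (tprodH g) = ∏ i, inner ℂ (f i) (g i) := by
  rw [tprodH, tprodH, inner_toHT, inner_pure]

/-- A linear map between algebraic tensor powers which preserves inner products of pure tensors
preserves all inner products. -/
lemma inner_map_of_pure {E : Type*} [SeminormedAddCommGroup E] [InnerProductSpace ℂ E]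
    {T T' : PreTensor ι H →ₗ[ℂ] E} {c : ℂ}
    (h : ∀ f g, inner ℂ (T (tprodPre f)) (T' (tprodPre g))
      = c * inner ℂ (tprodPre f : PreTensor ι H) (tprodPre g))
    (x y : PreTensor ι H) : inner ℂ (T x) (T' y) = c * inner ℂ x y := by
  induction x using pre_induction with
  | ha x x' hx hx' => simp only [map_add, inner_add_left, hx, hx', mul_add]
  | hp a f =>
    induction y using pre_induction with
    | ha y y' hy hy' => simp only [map_add, inner_add_right, hy, hy', mul_add]
    | hp b g =>
      simp only [map_smul, inner_smul_left, inner_smul_right, h]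
      ring

/-- `⨂ fᵢ ↦ ⨂ J f_{e⁻¹ j}` on algebraic tensor powers. -/
def preMap (J : H →ₗᵢ[ℂ] K) (e : ι ≃ κ) : PreTensor ι H →ₗ[ℂ] PreTensor κ K :=
  PiTensorProduct.lift
    (((tprodPre (ι := κ) (H := K)).compLinearMap fun _ => J.toLinearMap).domDomCongr e.symm)

lemma preMap_pure (J : H →ₗᵢ[ℂ] K) (e : ι ≃ κ) (f : ι → H) :
    preMap J e (tprodPre f) = tprodPre fun k => J (f (e.symm k)) :=
  PiTensorProduct.lift.tprod _

lemma inner_preMap (J : H →ₗᵢ[ℂ] K) (e : ι ≃ κ) (x y : PreTensor ι H) :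
    inner ℂ (preMap J e x) (preMap J e y) = inner ℂ x y := by
  rw [inner_map_of_pure (c := 1) _ x y, one_mul]
  intro f g
  rw [preMap_pure, preMap_pure, inner_pure, inner_pure, one_mul]
  simp only [LinearIsometry.inner_map_map]
  exact Equiv.prod_comp e.symm fun i => inner ℂ (f i) (g i)

/-- The isometry `⨂ fᵢ ↦ ⨂ J f_{e⁻¹ j}` of Hilbert-space tensor powers induced by an isometry `J`
of the one-particle spaces and a relabelling `e` of the factors. -/
def tensorMap (J : H →ₗᵢ[ℂ] K) (e : ι ≃ κ) : HTensor ι H →ₗᵢ[ℂ] HTensor κ K where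
  toLinearMap := ((toHT.toLinearMap ∘ₗ preMap J e).extendOfNorm toHT.toLinearMap).toLinearMap
  norm_map' := by
    have hb : ∀ x : PreTensor ι H, ‖(toHT.toLinearMap ∘ₗ preMap J e) x‖ = ‖toHT x‖ := by
      intro x
      have h1 : ‖(toHT.toLinearMap ∘ₗ preMap J e) x‖ = ‖preMap J e x‖ := norm_toHT _
      rw [h1, norm_toHT, @norm_eq_sqrt_re_inner ℂ, inner_preMap, ← @norm_eq_sqrt_re_inner ℂ]
    intro x
    refine dense_toHT.induction_on (p := fun x =>
      ‖((toHT.toLinearMap ∘ₗ preMap J e).extendOfNorm toHT.toLinearMap) x‖ = ‖x‖) x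
      (isClosed_eq (by fun_prop) (by fun_prop)) fun y => ?_
    have := LinearMap.extendOfNorm_eq (f := toHT.toLinearMap ∘ₗ preMap J e)
      (e := (toHT (ι := ι) (H := H)).toLinearMap) dense_toHT
      ⟨1, fun x => by rw [hb, one_mul]; rfl⟩ y
    exact (congrArg norm this).trans (hb y)

lemma tensorMap_toHT (J : H →ₗᵢ[ℂ] K) (e : ι ≃ κ) (x : PreTensor ι H) :
    tensorMap J e (toHT x) = toHT (preMap J e x) := by
  refine LinearMap.extendOfNorm_eq (f := toHT.toLinearMap ∘ₗ preMap J e)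
      (e := (toHT (ι := ι) (H := H)).toLinearMap) dense_toHT ⟨1, fun x => ?_⟩ x
  have h1 : ‖(toHT.toLinearMap ∘ₗ preMap J e) x‖ = ‖preMap J e x‖ := norm_toHT _
  have h2 : ‖toHT.toLinearMap x‖ = ‖x‖ := norm_toHT x
  rw [h1, h2, @norm_eq_sqrt_re_inner ℂ, inner_preMap, ← @norm_eq_sqrt_re_inner ℂ, one_mul]

lemma tensorMap_tprodH (J : H →ₗᵢ[ℂ] K) (e : ι ≃ κ) (f : ι → H) :
    tensorMap J e (tprodH f) = tprodH fun k => J (f (e.symm k)) := by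
  rw [tprodH, tensorMap_toHT, preMap_pure, tprodH]

/-- The isomorphism `(⨂_ι H) ⊗ (⨂_κ H) ≃ ⨂_{ι ⊕ κ} H` of algebraic tensor powers. -/
def preEquiv : PreTensor ι H ⊗[ℂ] PreTensor κ H ≃ₗ[ℂ] PreTensor (ι ⊕ κ) H :=
  PiTensorProduct.tmulEquiv (ι := ι) (ι₂ := κ) ℂ H

/-- `(⨂ fᵢ, ⨂ gⱼ) ↦ (⨂ fᵢ) ⊗ (⨂ gⱼ)` on algebraic tensor powers. -/
def preMul : PreTensor ι H →ₗ[ℂ] PreTensor κ H →ₗ[ℂ] PreTensor (ι ⊕ κ) H :=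
  TensorProduct.curry preEquiv.toLinearMap

lemma preMul_pure (f : ι → H) (g : κ → H) :
    preMul (tprodPre f) (tprodPre g) = tprodPre (Sum.elim f g) :=
  PiTensorProduct.tmulEquiv_apply ℂ H f g

lemma inner_preMul (x x' : PreTensor ι H) (y y' : PreTensor κ H) :
    inner ℂ (preMul x y) (preMul x' y') = inner ℂ x x' * inner ℂ y y' := by
  rw [mul_comm]
  refine inner_map_of_pure (T := preMul.flip y) (T' := preMul.flip y')
    (c := inner ℂ y y') (fun f g => ?_) x x'
  rw [mul_comm]
  refine inner_map_of_pure (T := preMul (tprodPre f)) (T' := preMul (tprodPre g))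
    (c := inner ℂ (tprodPre f : PreTensor ι H) (tprodPre g)) (fun f' g' => ?_) y y'
  rw [preMul_pure, preMul_pure, inner_pure, inner_pure, inner_pure, Fintype.prod_sum_type]
  simp

lemma norm_preMul (x : PreTensor ι H) (y : PreTensor κ H) : ‖preMul x y‖ = ‖x‖ * ‖y‖ := by
  have h : ‖preMul x y‖ ^ 2 = (‖x‖ * ‖y‖) ^ 2 := by
    have h1 := inner_preMul x x y y
    simp only [inner_self_eq_norm_sq_to_K] at h1
    rw [mul_pow]
    exact_mod_cast h1
  exact (sq_eq_sq₀ (norm_nonneg _) (by positivity)).1 h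

/-- The tensor product `(x, y) ↦ x ⊗ y` of Hilbert-space tensor powers. -/
def tmulH : HTensor ι H →L[ℂ] HTensor κ H →L[ℂ] HTensor (ι ⊕ κ) H :=
  let b : PreTensor ι H →L[ℂ] PreTensor κ H →L[ℂ] HTensor (ι ⊕ κ) H :=
    (preMul.compr₂ toHT.toLinearMap).mkContinuous₂ 1 fun x y => by
      rw [one_mul]
      exact ((norm_toHT _).trans (norm_preMul x y)).le
  ((b.extend toHT).flip.extend toHT).flip

lemma tmulH_toHT (x : PreTensor ι H) (y : PreTensor κ H) :
    tmulH (toHT x) (toHT y) = toHT (preMul x y) := by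
  simp only [tmulH, ContinuousLinearMap.flip_apply]
  rw [ContinuousLinearMap.extend_eq _ dense_toHT uniformInducing_toHT,
    ContinuousLinearMap.flip_apply,
    ContinuousLinearMap.extend_eq _ dense_toHT uniformInducing_toHT]
  rfl

lemma tmulH_tprodH (f : ι → H) (g : κ → H) :
    tmulH (tprodH f) (tprodH g) = tprodH (Sum.elim f g) := by
  rw [tprodH, tprodH, tmulH_toHT, preMul_pure, tprodH]

lemma inner_tmulH (x x' : HTensor ι H) (y y' : HTensor κ H) :
    inner ℂ (tmulH x y) (tmulH x' y') = inner ℂ x x' * inner ℂ y y' := by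
  refine dense_toHT.induction_on₂ (p := fun x x' => inner ℂ (tmulH x y) (tmulH x' y')
    = inner ℂ x x' * inner ℂ y y') (isClosed_eq (by fun_prop) (by fun_prop)) (fun a a' => ?_) x x'
  refine dense_toHT.induction_on₂ (p := fun y y' => inner ℂ (tmulH (toHT a) y) (tmulH (toHT a') y')
    = inner ℂ (toHT a) (toHT a') * inner ℂ y y')
    (isClosed_eq (by fun_prop) (by fun_prop)) (fun b b' => ?_) y y'
  rw [tmulH_toHT, tmulH_toHT, inner_toHT, inner_preMul, inner_toHT, inner_toHT]

/-- `(⨂ fᵢ) ⊗ (⨂ gⱼ) ↦ A (⨂ fᵢ) ⊗ (⨂ gⱼ)` on the algebraic tensor power. -/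
def preAmp (A : HTensor ι H →L[ℂ] HTensor ι H) :
    PreTensor (ι ⊕ κ) H →ₗ[ℂ] HTensor (ι ⊕ κ) H :=
  TensorProduct.lift ((tmulH (ι := ι) (κ := κ) (H := H)).toLinearMap₁₂.compl₁₂
    (A ∘L toHT).toLinearMap toHT.toLinearMap) ∘ₗ preEquiv.symm.toLinearMap

lemma preAmp_preMul (A : HTensor ι H →L[ℂ] HTensor ι H) (x : PreTensor ι H)
    (y : PreTensor κ H) : preAmp A (preMul x y) = tmulH (A (toHT x)) (toHT y) := by
  have h : preEquiv.symm (preMul x y) = x ⊗ₜ[ℂ] y := preEquiv.symm_apply_apply (x ⊗ₜ[ℂ] y)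
  rw [preAmp, LinearMap.comp_apply, LinearEquiv.coe_coe, h]
  rfl

lemma exists_sum_preMul (z : PreTensor (ι ⊕ κ) H) :
    ∃ S : Finset (PreTensor ι H × PreTensor κ H), z = ∑ p ∈ S, preMul p.1 p.2 := by
  obtain ⟨S, hS⟩ := TensorProduct.exists_finset (preEquiv.symm z)
  refine ⟨S, ?_⟩
  have h := congrArg preEquiv hS
  rw [LinearEquiv.apply_symm_apply, map_sum] at h
  exact h

lemma norm_preAmp_le (A : HTensor ι H →L[ℂ] HTensor ι H) (z : PreTensor (ι ⊕ κ) H) :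
    ‖preAmp A z‖ ≤ ‖A‖ * ‖z‖ := by
  obtain ⟨S, rfl⟩ := exists_sum_preMul z
  have hM : ((((‖A‖ ^ 2 : ℝ) : ℂ) • Matrix.gram ℂ fun p : S => toHT p.1.1)
      - Matrix.gram ℂ fun p : S => A (toHT p.1.1)).PosSemidef := by
    refine Matrix.PosSemidef.of_dotProduct_mulVec_nonneg ?_ fun c => ?_
    · refine Matrix.IsHermitian.sub ?_ (Matrix.isHermitian_gram _ _)
      rw [Matrix.IsHermitian, Matrix.conjTranspose_smul, Matrix.isHermitian_gram]
      simp
    · rw [Matrix.sub_mulVec, Matrix.smul_mulVec, dotProduct_sub, dotProduct_smul,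
        Matrix.star_dotProduct_gram_mulVec, Matrix.star_dotProduct_gram_mulVec]
      have h1 : ∑ p : S, c p • A (toHT p.1.1) = A (∑ p : S, c p • toHT p.1.1) := by simp
      rw [h1, inner_self_eq_norm_sq_to_K, inner_self_eq_norm_sq_to_K]
      have h2 := A.le_opNorm (∑ p : S, c p • toHT p.1.1)
      have h3 : ‖A (∑ p : S, c p • toHT p.1.1)‖ ^ 2 ≤ ‖A‖ ^ 2 * ‖∑ p : S, c p • toHT p.1.1‖ ^ 2 := by
        rw [← mul_pow]
        exact pow_le_pow_left₀ (norm_nonneg _) h2 2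
      have h4 : ((0 : ℝ) : ℂ) ≤ ((‖A‖ ^ 2 * ‖∑ p : S, c p • toHT p.1.1‖ ^ 2
          - ‖A (∑ p : S, c p • toHT p.1.1)‖ ^ 2 : ℝ) : ℂ) :=
        Complex.real_le_real.2 (sub_nonneg.2 h3)
      rw [smul_eq_mul]
      push_cast at h4 ⊢
      exact h4
  have hN := (hM.hadamard
    (Matrix.posSemidef_gram (𝕜 := ℂ) fun p : S => p.1.2)).dotProduct_mulVec_nonneg 1
  have e1 : inner ℂ (∑ p ∈ S, preMul p.1 p.2) (∑ p ∈ S, preMul p.1 p.2)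
      = ∑ p : S, ∑ q : S, inner ℂ p.1.1 q.1.1 * inner ℂ p.1.2 q.1.2 := by
    rw [← Finset.sum_coe_sort S, sum_inner]
    simp only [inner_sum, inner_preMul]
  have e2 : inner ℂ (preAmp A (∑ p ∈ S, preMul p.1 p.2)) (preAmp A (∑ p ∈ S, preMul p.1 p.2))
      = ∑ p : S, ∑ q : S, inner ℂ (A (toHT p.1.1)) (A (toHT q.1.1)) * inner ℂ p.1.2 q.1.2 := by
    rw [← Finset.sum_coe_sort S, map_sum, sum_inner]
    simp only [inner_sum, preAmp_preMul, inner_tmulH, inner_toHT]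
  have e3 : (0 : ℂ) ≤ ((‖A‖ ^ 2 : ℝ) : ℂ)
        * inner ℂ (∑ p ∈ S, preMul p.1 p.2) (∑ p ∈ S, preMul p.1 p.2)
      - inner ℂ (preAmp A (∑ p ∈ S, preMul p.1 p.2)) (preAmp A (∑ p ∈ S, preMul p.1 p.2)) := by
    rw [e1, e2]
    convert hN using 1
    simp only [dotProduct, Matrix.mulVec, Matrix.hadamard_apply, Matrix.sub_apply,
      Matrix.smul_apply, Matrix.gram_apply, Pi.star_apply, Pi.one_apply, star_one, one_mul,
      mul_one, inner_toHT, smul_eq_mul, Finset.mul_sum, ← Finset.sum_sub_distrib]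
    refine Finset.sum_congr rfl fun p _ => Finset.sum_congr rfl fun q _ => ?_
    ring
  rw [inner_self_eq_norm_sq_to_K, inner_self_eq_norm_sq_to_K] at e3
  have e4 : (0 : ℝ) ≤ ‖A‖ ^ 2 * ‖∑ p ∈ S, preMul p.1 p.2‖ ^ 2
      - ‖preAmp A (∑ p ∈ S, preMul p.1 p.2)‖ ^ 2 := by
    refine Complex.real_le_real.1 ?_
    push_cast at e3 ⊢
    exact e3
  have e5 : ‖preAmp A (∑ p ∈ S, preMul p.1 p.2)‖ ^ 2
      ≤ (‖A‖ * ‖∑ p ∈ S, preMul p.1 p.2‖) ^ 2 := by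
    rw [mul_pow]; linarith
  exact (sq_le_sq₀ (norm_nonneg _) (by positivity)).1 e5

/-- The operator `A ⊗ 1` on `⨂_{ι ⊕ κ} H = (⨂_ι H) ⊗ (⨂_κ H)`. -/
def ampH (A : HTensor ι H →L[ℂ] HTensor ι H) : HTensor (ι ⊕ κ) H →L[ℂ] HTensor (ι ⊕ κ) H :=
  (preAmp A).extendOfNorm toHT.toLinearMap

lemma ampH_toHT (A : HTensor ι H →L[ℂ] HTensor ι H) (z : PreTensor (ι ⊕ κ) H) :
    ampH A (toHT z) = preAmp A z :=
  LinearMap.extendOfNorm_eq (f := preAmp A) (e := (toHT (ι := ι ⊕ κ) (H := H)).toLinearMap)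
    dense_toHT ⟨‖A‖, fun x => (norm_preAmp_le A x).trans (by rw [← norm_toHT x]; rfl)⟩ z

lemma ampH_tmulH (A : HTensor ι H →L[ℂ] HTensor ι H) (x : HTensor ι H) (y : HTensor κ H) :
    ampH A (tmulH x y) = tmulH (A x) y := by
  refine dense_toHT.induction_on (p := fun x => ampH A (tmulH x y) = tmulH (A x) y) x
    (isClosed_eq (by fun_prop) (by fun_prop)) fun a => ?_
  refine dense_toHT.induction_on
    (p := fun y => ampH A (tmulH (toHT a) y) = tmulH (A (toHT a)) y) y
    (isClosed_eq (by fun_prop) (by fun_prop)) fun b => ?_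
  rw [tmulH_toHT, ampH_toHT, preAmp_preMul]

end Tensor

section Sym
variable {H : Type*} [NormedAddCommGroup H] [InnerProductSpace ℂ H]

/-- Relabelling of the tensor factors along a bijection. -/
def relabel {ι κ : Type} [Fintype ι] [Fintype κ] (e : ι ≃ κ) : HTensor ι H →ₗᵢ[ℂ] HTensor κ H :=
  tensorMap LinearIsometry.id e

variable (H) in
/-- The bosonic `n`-particle space `⨂ₛⁿ H`: the tensors in `⨂ⁿ H` which are invariant under all
permutations of the factors. -/
def SymTensor (n : ℕ) : Submodule ℂ (HTensor (Fin n) H) where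
  carrier := {x | ∀ σ : Equiv.Perm (Fin n), relabel σ x = x}
  zero_mem' := fun σ => map_zero _
  add_mem' := fun hx hy σ => by rw [map_add, hx σ, hy σ]
  smul_mem' := fun c x hx σ => by rw [map_smul, hx σ]

lemma isClosed_symTensor (n : ℕ) : IsClosed (SymTensor H n : Set (HTensor (Fin n) H)) := by
  have h : (SymTensor H n : Set (HTensor (Fin n) H))
      = ⋂ σ : Equiv.Perm (Fin n), {x | relabel σ x = x} := by
    ext x; simp [SymTensor]
  rw [h]
  exact isClosed_iInter fun σ => isClosed_eq (relabel σ).continuous continuous_id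

instance (n : ℕ) : CompleteSpace (SymTensor H n) :=
  (isClosed_symTensor n).completeSpace_coe

/-- The orthogonal projection of `⨂ⁿ H` onto `⨂ₛⁿ H`. -/
def symProj (n : ℕ) : HTensor (Fin n) H →L[ℂ] SymTensor H n :=
  (SymTensor H n).orthogonalProjectionOnto

/-- The vector `u^{⊗n} ∈ ⨂ₛⁿ H`. -/
def power (n : ℕ) (u : H) : SymTensor H n :=
  ⟨tprodH fun _ => u, fun σ => by rw [relabel, tensorMap_tprodH]; rfl⟩

lemma norm_power (n : ℕ) (u : H) : ‖power n u‖ = ‖u‖ ^ n := by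
  have h : ‖power n u‖ ^ 2 = (‖u‖ ^ n) ^ 2 := by
    have h1 : inner ℂ (tprodH fun _ : Fin n => u) (tprodH fun _ : Fin n => u)
        = ∏ _i : Fin n, inner ℂ u u := inner_tprodH _ _
    simp only [inner_self_eq_norm_sq_to_K, Finset.prod_const, Finset.card_univ,
      Fintype.card_fin] at h1
    rw [← pow_mul, mul_comm n 2, pow_mul]
    have h2 : ‖tprodH fun _ : Fin n => u‖ ^ 2 = (‖u‖ ^ 2) ^ n := by exact_mod_cast h1
    exact h2
  exact (sq_eq_sq₀ (norm_nonneg _) (by positivity)).1 h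

variable (H) in
/-- The bosonic Fock space `F(H) = ⨁ₙ ⨂ₛⁿ H` (Hilbert-space direct sum). -/
abbrev Fock : Type _ := lp (fun n : ℕ => SymTensor H n) 2

instance : NormedAddCommGroup (Fock H) := inferInstance
instance : InnerProductSpace ℂ (Fock H) := inferInstance
instance : NormedSpace ℂ (Fock H) := InnerProductSpace.toNormedSpace
instance : SeminormedAddCommGroup (Fock H) := NormedAddCommGroup.toSeminormedAddCommGroup
instance : AddCommGroup (Fock H) := NormedAddCommGroup.toAddCommGroup
instance : AddCommMonoid (Fock H) := AddCommGroup.toAddCommMonoid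
instance : Module ℂ (Fock H) := NormedSpace.toModule
instance : CompleteSpace (Fock H) := inferInstance

/-- The diagonal block `Gₙ : ⨂ₛⁿ H → ⨂ₛⁿ H` of an operator on Fock space. -/
def block (G : Fock H →L[ℂ] Fock H) (n : ℕ) : SymTensor H n →L[ℂ] SymTensor H n :=
  lp.evalCLM ℂ (fun n : ℕ => SymTensor H n) 2 n ∘L G ∘L
    lp.singleContinuousLinearMap ℂ (fun n : ℕ => SymTensor H n) 2 n

/-- The coherent state `ξ(u) = e^{-|u|²/2} ⨁ₙ u^{⊗n} / √n!`. -/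
def coherent (u : H) : Fock H :=
  ⟨fun n => ((Real.exp (-‖u‖ ^ 2 / 2) / √(n.factorial) : ℝ) : ℂ) • power n u, by
    refine memℓp_gen ?_
    have h : ∀ n : ℕ, ‖((Real.exp (-‖u‖ ^ 2 / 2) / √(n.factorial) : ℝ) : ℂ) • power n u‖
        ^ (2 : ℝ≥0∞).toReal = Real.exp (-‖u‖ ^ 2 / 2) ^ 2 * ((‖u‖ ^ 2) ^ n / n.factorial) := by
      intro n
      rw [norm_smul, norm_power, Complex.norm_real, Real.norm_of_nonneg (by positivity),
        ENNReal.toReal_ofNat, Real.rpow_two, mul_pow, div_pow, Real.sq_sqrt (by positivity)]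
      ring
    simp_rw [h]
    exact (Real.summable_pow_div_factorial _).mul_left _⟩

end Sym

section Traces
variable (E : Type*) [NormedAddCommGroup E] [InnerProductSpace ℂ E] [CompleteSpace E]

/-- The index set of a chosen Hilbert basis. -/
def basisIndex : Set E := (exists_hilbertBasis ℂ E).choose

/-- A chosen Hilbert basis (traces below do not depend on the choice). -/
def hBasis : HilbertBasis (basisIndex E) ℂ E := (exists_hilbertBasis ℂ E).choose_spec.choose

variable {E}
variable {F K : Type*} [NormedAddCommGroup F] [InnerProductSpace ℂ F] [CompleteSpace F]
  [NormedAddCommGroup K] [InnerProductSpace ℂ K] [CompleteSpace K]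

/-- The trace `∑ⱼ ⟪eⱼ, A eⱼ⟫ ∈ [0, ∞]` of a positive operator. -/
def posTrace (A : E →L[ℂ] E) : ℝ≥0∞ :=
  ∑' j, ENNReal.ofReal (inner ℂ (hBasis E j) (A (hBasis E j))).re

/-- Partial trace over `F` of a trace-class operator `G` on `K`, where `m : E × F → K` is the
tensor multiplication map: `⟪x, (tr_F G) y⟫ = ∑ⱼ ⟪m(x, eⱼ), G m(y, eⱼ)⟫`. The series converges in
operator norm. -/
def partialTrace (m : E →L[ℂ] F →L[ℂ] K) (G : K →L[ℂ] K) : E →L[ℂ] E :=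
  ∑' j, (m.flip (hBasis F j)).adjoint ∘L G ∘L m.flip (hBasis F j)

end Traces

section Factorization
variable {H : Type*} [NormedAddCommGroup H] [InnerProductSpace ℂ H] (V : Submodule ℂ H)

/-- For `S ⊆ {1, …, N}`: the tensor in `⨂^N H` obtained by putting `x` in the variables in `S`
and `y` in the remaining variables, in increasing order. -/
def place {N : ℕ} (S : Finset (Fin N)) (x : HTensor (Fin S.card) V)
    (y : HTensor (Fin Sᶜ.card) Vᗮ) : HTensor (Fin N) H :=
  relabel (finSumEquivOfFinset (s := S) rfl rfl)
    (tmulH (tensorMap V.subtypeₗᵢ (Equiv.refl _) x) (tensorMap Vᗮ.subtypeₗᵢ (Equiv.refl _) y))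

variable {V}

lemma place_add_left {N : ℕ} (S : Finset (Fin N)) (x x' : HTensor (Fin S.card) V)
    (y : HTensor (Fin Sᶜ.card) Vᗮ) : place V S (x + x') y = place V S x y + place V S x' y := by
  simp [place]

lemma place_add_right {N : ℕ} (S : Finset (Fin N)) (x : HTensor (Fin S.card) V)
    (y y' : HTensor (Fin Sᶜ.card) Vᗮ) : place V S x (y + y') = place V S x y + place V S x y' := by
  simp [place]

lemma place_smul_left {N : ℕ} (S : Finset (Fin N)) (c : ℂ) (x : HTensor (Fin S.card) V)
    (y : HTensor (Fin Sᶜ.card) Vᗮ) : place V S (c • x) y = c • place V S x y := by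
  simp [place]

lemma place_smul_right {N : ℕ} (S : Finset (Fin N)) (c : ℂ) (x : HTensor (Fin S.card) V)
    (y : HTensor (Fin Sᶜ.card) Vᗮ) : place V S x (c • y) = c • place V S x y := by
  simp [place]

@[fun_prop]
lemma continuous_place {N : ℕ} (S : Finset (Fin N)) :
    Continuous fun p : HTensor (Fin S.card) V × HTensor (Fin Sᶜ.card) Vᗮ =>
      place V S p.1 p.2 := by
  unfold place
  exact (relabel _).continuous.comp (by fun_prop)

lemma norm_place {N : ℕ} (S : Finset (Fin N)) (x : HTensor (Fin S.card) V)
    (y : HTensor (Fin Sᶜ.card) Vᗮ) : ‖place V S x y‖ = ‖x‖ * ‖y‖ := by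
  rw [place, LinearIsometry.norm_map]
  have h : ∀ (a : HTensor (Fin S.card) H) (b : HTensor (Fin Sᶜ.card) H),
      ‖tmulH a b‖ = ‖a‖ * ‖b‖ := by
    intro a b
    have h : ‖tmulH a b‖ ^ 2 = (‖a‖ * ‖b‖) ^ 2 := by
      have h1 := inner_tmulH a a b b
      simp only [inner_self_eq_norm_sq_to_K] at h1
      rw [mul_pow]
      exact_mod_cast h1
    exact (sq_eq_sq₀ (norm_nonneg _) (by positivity)).1 h
  rw [h, LinearIsometry.norm_map, LinearIsometry.norm_map]

/-- The vector of `H` in the `k`-th variable of `place V S (⨂ f) (⨂ g)`. -/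
lemma place_pure {N : ℕ} (S : Finset (Fin N)) (f : Fin S.card → V) (g : Fin Sᶜ.card → Vᗮ) :
    place V S (tprodH f) (tprodH g) = tprodH fun k =>
      Sum.elim (fun i => (f i : H)) (fun j => (g j : H))
        ((finSumEquivOfFinset (s := S) rfl rfl).symm k) := by
  rw [place, tensorMap_tprodH, tensorMap_tprodH, tmulH_tprodH, relabel, tensorMap_tprodH]
  rfl

lemma symm_mem {N : ℕ} {S : Finset (Fin N)} {k : Fin N} (hk : k ∈ S) :
    ∃ i, (finSumEquivOfFinset (s := S) rfl rfl).symm k = Sum.inl i := by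
  rcases h : (finSumEquivOfFinset (s := S) rfl rfl).symm k with i | j
  · exact ⟨i, rfl⟩
  · exfalso
    rw [Equiv.symm_apply_eq, finSumEquivOfFinset_inr] at h
    have := Sᶜ.orderEmbOfFin_mem rfl j
    rw [← h, Finset.mem_compl] at this
    exact this hk

lemma symm_notMem {N : ℕ} {S : Finset (Fin N)} {k : Fin N} (hk : k ∉ S) :
    ∃ j, (finSumEquivOfFinset (s := S) rfl rfl).symm k = Sum.inr j := by
  rcases h : (finSumEquivOfFinset (s := S) rfl rfl).symm k with i | j
  · exfalso
    rw [Equiv.symm_apply_eq, finSumEquivOfFinset_inl] at h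
    have := S.orderEmbOfFin_mem rfl i
    rw [← h] at this
    exact hk this
  · exact ⟨j, rfl⟩

lemma inner_place_pure {N : ℕ} {S T : Finset (Fin N)} (h : S ≠ T)
    (f : Fin S.card → V) (g : Fin Sᶜ.card → Vᗮ) (f' : Fin T.card → V) (g' : Fin Tᶜ.card → Vᗮ) :
    inner ℂ (place V S (tprodH f) (tprodH g)) (place V T (tprodH f') (tprodH g')) = 0 := by
  rw [place_pure, place_pure, inner_tprodH]
  have hk : ∃ k, (k ∈ S ∧ k ∉ T) ∨ (k ∉ S ∧ k ∈ T) := by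
    by_contra hc
    push Not at hc
    refine h (Finset.ext fun k => ⟨fun hs => ?_, fun ht => ?_⟩)
    · exact (hc k).1 hs
    · by_contra hs
      exact (hc k).2 hs ht
  obtain ⟨k, hk⟩ := hk
  refine Finset.prod_eq_zero (Finset.mem_univ k) ?_
  rcases hk with ⟨h1, h2⟩ | ⟨h1, h2⟩
  · obtain ⟨i, hi⟩ := symm_mem h1
    obtain ⟨j, hj⟩ := symm_notMem h2
    rw [hi, hj]
    exact Submodule.inner_right_of_mem_orthogonal (f i).2 (g' j).2
  · obtain ⟨i, hi⟩ := symm_mem h2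
    obtain ⟨j, hj⟩ := symm_notMem h1
    rw [hi, hj]
    exact Submodule.inner_left_of_mem_orthogonal (f' i).2 (g j).2

/-- Pure tensors are total in the Hilbert-space tensor power. -/
lemma htensor_induction {ι : Type} [Fintype ι] {p : HTensor ι H → Prop}
    (hc : IsClosed {x | p x}) (hp : ∀ f, p (tprodH f)) (hs : ∀ (c : ℂ) x, p x → p (c • x))
    (ha : ∀ x y, p x → p y → p (x + y)) (x : HTensor ι H) : p x := by
  refine dense_toHT.induction_on x hc fun a => ?_
  induction a using pre_induction with
  | hp c f => rw [map_smul]; exact hs c _ (hp f)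
  | ha x y hx hy => rw [map_add]; exact ha _ _ hx hy

lemma inner_place {N : ℕ} {S T : Finset (Fin N)} (h : S ≠ T)
    (x : HTensor (Fin S.card) V) (y : HTensor (Fin Sᶜ.card) Vᗮ)
    (x' : HTensor (Fin T.card) V) (y' : HTensor (Fin Tᶜ.card) Vᗮ) :
    inner ℂ (place V S x y) (place V T x' y') = 0 := by
  refine htensor_induction (p := fun x => inner ℂ (place V S x y) (place V T x' y') = 0)
    (isClosed_eq (by fun_prop) (by fun_prop)) (fun f => ?_)
    (fun c z hz => by rw [place_smul_left, inner_smul_left, hz, mul_zero])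
    (fun a b ha hb => by rw [place_add_left, inner_add_left, ha, hb, add_zero]) x
  refine htensor_induction (p := fun y => inner ℂ (place V S (tprodH f) y) (place V T x' y') = 0)
    (isClosed_eq (by fun_prop) (by fun_prop)) (fun g => ?_)
    (fun c z hz => by rw [place_smul_right, inner_smul_left, hz, mul_zero])
    (fun a b ha hb => by rw [place_add_right, inner_add_left, ha, hb, add_zero]) y
  refine htensor_induction
    (p := fun x' => inner ℂ (place V S (tprodH f) (tprodH g)) (place V T x' y') = 0)
    (isClosed_eq (by fun_prop) (by fun_prop)) (fun f' => ?_)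
    (fun c z hz => by rw [place_smul_left, inner_smul_right, hz, mul_zero])
    (fun a b ha hb => by rw [place_add_left, inner_add_right, ha, hb, add_zero]) x'
  refine htensor_induction
    (p := fun y' => inner ℂ (place V S (tprodH f) (tprodH g)) (place V T (tprodH f') y') = 0)
    (isClosed_eq (by fun_prop) (by fun_prop)) (fun g' => ?_)
    (fun c z hz => by rw [place_smul_right, inner_smul_right, hz, mul_zero])
    (fun a b ha hb => by rw [place_add_right, inner_add_right, ha, hb, add_zero]) y'
  exact inner_place_pure h f g f' g'

/-- The `N`-particle component of the product of `Ψ ∈ F(V)` and `Φ ∈ F(V⊥)`. -/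
def sector (N : ℕ) (Ψ : Fock V) (Φ : Fock Vᗮ) : SymTensor H N :=
  symProj N (∑ S : Finset (Fin N),
    (((√(N.choose S.card))⁻¹ : ℝ) : ℂ) • place V S (Ψ S.card) (Φ Sᶜ.card))

lemma norm_sector_sq_le (N : ℕ) (Ψ : Fock V) (Φ : Fock Vᗮ) :
    ‖sector N Ψ Φ‖ ^ 2 ≤ ∑ n ∈ Finset.range (N + 1), ‖Ψ n‖ ^ 2 * ‖Φ (N - n)‖ ^ 2 := by
  have h1 : ‖sector N Ψ Φ‖ ≤ ‖∑ S : Finset (Fin N),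
      (((√(N.choose S.card))⁻¹ : ℝ) : ℂ) • place V S (Ψ S.card) (Φ Sᶜ.card)‖ :=
    (SymTensor H N).norm_orthogonalProjectionOnto_apply_le _
  have h2 : ‖∑ S : Finset (Fin N),
      (((√(N.choose S.card))⁻¹ : ℝ) : ℂ) • place V S (Ψ S.card) (Φ Sᶜ.card)‖ ^ 2
      = ∑ S : Finset (Fin N), ‖(((√(N.choose S.card))⁻¹ : ℝ) : ℂ)
          • place V S (Ψ S.card) (Φ Sᶜ.card)‖ ^ 2 := by
    rw [@norm_sq_eq_re_inner ℂ, sum_inner, map_sum]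
    refine Finset.sum_congr rfl fun S _ => ?_
    rw [inner_sum, Finset.sum_eq_single S, ← @norm_sq_eq_re_inner ℂ]
    · intro T _ hT
      rw [inner_smul_left, inner_smul_right, inner_place hT.symm, mul_zero, mul_zero]
    · simp
  have h3 : ∀ S : Finset (Fin N), ‖(((√(N.choose S.card))⁻¹ : ℝ) : ℂ)
      • place V S (Ψ S.card) (Φ Sᶜ.card)‖ ^ 2
      = (N.choose S.card : ℝ)⁻¹ * (‖Ψ S.card‖ ^ 2 * ‖Φ (N - S.card)‖ ^ 2) := by
    intro S
    have hc : Sᶜ.card = N - S.card := by rw [Finset.card_compl, Fintype.card_fin]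
    have e : ‖Φ Sᶜ.card‖ = ‖Φ (N - S.card)‖ := by rw [hc]
    rw [norm_smul, norm_place, Complex.norm_real, Real.norm_of_nonneg (by positivity), mul_pow,
      inv_pow, Real.sq_sqrt (by positivity), mul_pow]
    rw [← e]
    rfl
  have h4 : ∀ a b : ℕ → ℝ, ∑ S : Finset (Fin N),
      (N.choose S.card : ℝ)⁻¹ * (a S.card * b (N - S.card))
      = ∑ n ∈ Finset.range (N + 1), a n * b (N - n) := by
    intro a b
    have := Finset.sum_powerset_apply_card (x := (Finset.univ : Finset (Fin N)))
      fun n => (N.choose n : ℝ)⁻¹ * (a n * b (N - n))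
    rw [Finset.powerset_univ, Finset.card_univ, Fintype.card_fin] at this
    rw [this]
    refine Finset.sum_congr rfl fun n hn => ?_
    have : (N.choose n : ℝ) ≠ 0 := by
      exact_mod_cast (Nat.choose_pos (Nat.lt_succ_iff.1 (Finset.mem_range.1 hn))).ne'
    rw [nsmul_eq_mul, ← mul_assoc, mul_inv_cancel₀ this, one_mul]
  calc ‖sector N Ψ Φ‖ ^ 2 ≤ _ := pow_le_pow_left₀ (norm_nonneg _) h1 2
    _ = _ := h2
    _ = _ := Finset.sum_congr rfl fun S _ => h3 S
    _ = _ := h4 (fun n => ‖Ψ n‖ ^ 2) fun n => ‖Φ n‖ ^ 2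

lemma summable_fock (Ψ : Fock H) : Summable fun n => ‖Ψ n‖ ^ 2 := by
  have := (lp.memℓp Ψ).summable (by norm_num)
  simpa using this

lemma norm_fock_sq (Ψ : Fock H) : ‖Ψ‖ ^ 2 = ∑' n, ‖Ψ n‖ ^ 2 := by
  have := lp.norm_rpow_eq_tsum (p := 2) (by norm_num) Ψ
  simpa using this

lemma summable_conv_aux {a b : ℕ → ℝ} (ha : Summable a) (hb : Summable b) (ha0 : ∀ n, 0 ≤ a n)
    (hb0 : ∀ n, 0 ≤ b n) :
    Summable (fun N => ∑ n ∈ Finset.range (N + 1), a n * b (N - n)) ∧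
      (∑' n, a n) * (∑' n, b n) = ∑' N, ∑ n ∈ Finset.range (N + 1), a n * b (N - n) :=
  ⟨summable_sum_mul_range_of_summable_mul (ha.mul_of_nonneg hb ha0 hb0),
    ha.tsum_mul_tsum_eq_tsum_sum_range hb (ha.mul_of_nonneg hb ha0 hb0)⟩

lemma summable_conv (Ψ : Fock V) (Φ : Fock Vᗮ) :
    Summable (fun N => ∑ n ∈ Finset.range (N + 1), ‖Ψ n‖ ^ 2 * ‖Φ (N - n)‖ ^ 2) ∧
      (∑' n, ‖Ψ n‖ ^ 2) * (∑' n, ‖Φ n‖ ^ 2)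
        = ∑' N, ∑ n ∈ Finset.range (N + 1), ‖Ψ n‖ ^ 2 * ‖Φ (N - n)‖ ^ 2 :=
  summable_conv_aux (a := fun n => ‖Ψ n‖ ^ 2) (b := fun n => ‖Φ n‖ ^ 2) (summable_fock Ψ)
    (summable_fock Φ) (fun _ => sq_nonneg _) fun _ => sq_nonneg _

lemma summable_sector (Ψ : Fock V) (Φ : Fock Vᗮ) : Summable fun N => ‖sector N Ψ Φ‖ ^ 2 :=
  (summable_conv Ψ Φ).1.of_nonneg_of_le (fun _ => sq_nonneg _)
    fun N => norm_sector_sq_le N Ψ Φ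

/-- The product of `Ψ ∈ F(V)` and `Φ ∈ F(V⊥)` as a vector of `F(H)`. -/
def fockProd (Ψ : Fock V) (Φ : Fock Vᗮ) : Fock H :=
  ⟨fun N => sector N Ψ Φ, memℓp_gen (by simpa using summable_sector Ψ Φ)⟩

lemma norm_fockProd_le (Ψ : Fock V) (Φ : Fock Vᗮ) : ‖fockProd Ψ Φ‖ ≤ ‖Ψ‖ * ‖Φ‖ := by
  have h : ‖fockProd Ψ Φ‖ ^ 2 ≤ (‖Ψ‖ * ‖Φ‖) ^ 2 := by
    rw [norm_fock_sq, mul_pow, norm_fock_sq Ψ, norm_fock_sq Φ, (summable_conv Ψ Φ).2]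
    exact (summable_sector Ψ Φ).tsum_le_tsum (fun N => norm_sector_sq_le N Ψ Φ)
      (summable_conv Ψ Φ).1
  exact (sq_le_sq₀ (norm_nonneg _) (by positivity)).1 h

lemma sector_add_left (N : ℕ) (Ψ Ψ' : Fock V) (Φ : Fock Vᗮ) :
    sector N (Ψ + Ψ') Φ = sector N Ψ Φ + sector N Ψ' Φ := by
  unfold sector
  rw [← map_add, ← Finset.sum_add_distrib]
  congr 1
  refine Finset.sum_congr rfl fun S _ => ?_
  rw [← smul_add, ← place_add_left]
  rfl

lemma sector_add_right (N : ℕ) (Ψ : Fock V) (Φ Φ' : Fock Vᗮ) :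
    sector N Ψ (Φ + Φ') = sector N Ψ Φ + sector N Ψ Φ' := by
  unfold sector
  rw [← map_add, ← Finset.sum_add_distrib]
  congr 1
  refine Finset.sum_congr rfl fun S _ => ?_
  rw [← smul_add, ← place_add_right]
  rfl

lemma sector_smul_left (N : ℕ) (c : ℂ) (Ψ : Fock V) (Φ : Fock Vᗮ) :
    sector N (c • Ψ) Φ = c • sector N Ψ Φ := by
  unfold sector
  rw [← map_smul, Finset.smul_sum]
  congr 1
  refine Finset.sum_congr rfl fun S _ => ?_
  rw [smul_comm c]
  exact congrArg _ (place_smul_left S c _ _)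

lemma sector_smul_right (N : ℕ) (c : ℂ) (Ψ : Fock V) (Φ : Fock Vᗮ) :
    sector N Ψ (c • Φ) = c • sector N Ψ Φ := by
  unfold sector
  rw [← map_smul, Finset.smul_sum]
  congr 1
  refine Finset.sum_congr rfl fun S _ => ?_
  rw [smul_comm c]
  exact congrArg _ (place_smul_right S c _ _)

variable (V) in
/-- The factorization `F(V) ⊗ F(V⊥) ≃ F(H)` of Fock spaces, written as the bounded bilinear map
`(f₁ ⊗ₛ ⋯ ⊗ₛ fₙ, g₁ ⊗ₛ ⋯ ⊗ₛ gₘ) ↦ f₁ ⊗ₛ ⋯ ⊗ₛ fₙ ⊗ₛ g₁ ⊗ₛ ⋯ ⊗ₛ gₘ`. On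
`Ψ ∈ ⨂ₛⁿ V` and `Φ ∈ ⨂ₛᵐ V⊥` it is `binom(n+m, n)^{-1/2}` times the sum, over all
`S ⊆ {1, …, n+m}` with `|S| = n`, of the tensors with `Ψ` in the variables in `S` and `Φ` in
the remaining ones. -/
def fockMul : Fock V →L[ℂ] Fock Vᗮ →L[ℂ] Fock H :=
  (LinearMap.mk₂ ℂ (fockProd (V := V))
    (fun Ψ Ψ' Φ => lp.ext (funext fun N => sector_add_left N Ψ Ψ' Φ))
    (fun c Ψ Φ => lp.ext (funext fun N => sector_smul_left N c Ψ Φ))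
    (fun Ψ Φ Φ' => lp.ext (funext fun N => sector_add_right N Ψ Φ Φ'))
    (fun c Ψ Φ => lp.ext (funext fun N => sector_smul_right N c Ψ Φ))).mkContinuous₂ 1
    fun Ψ Φ => by rw [one_mul]; exact norm_fockProd_le Ψ Φ

end Factorization

section DensityMatrices
variable {H : Type*} [NormedAddCommGroup H] [InnerProductSpace ℂ H]

/-- A (mixed) state on Fock space: a positive operator of trace one. -/
def IsState (Γ : Fock H →L[ℂ] Fock H) : Prop := Γ.IsPositive ∧ posTrace Γ = 1

/-- The moment `tr(𝒩ᵏ Γ) = ∑ₙ nᵏ tr(Gₙ) ∈ [0, ∞]` of the number operator `𝒩` in a state `Γ` with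
diagonal blocks `Gₙ`. -/
def numberMoment (Γ : Fock H →L[ℂ] Fock H) (k : ℕ) : ℝ≥0∞ :=
  ∑' n : ℕ, (n : ℝ≥0∞) ^ k * posTrace (block Γ n)

variable (H) in
/-- The multiplication `(x, y) ↦ x ⊗ y`, `⨂ₛᵏ H × ⨂ᵐ H → ⨂^{k+m} H`, followed by the projection
onto `⨂ₛ^{k+m} H` (where the operators to be traced live). -/
def symMul (k m : ℕ) : SymTensor H k →L[ℂ] HTensor (Fin m) H →L[ℂ] SymTensor H (k + m) :=
  (ContinuousLinearMap.compL ℂ (HTensor (Fin m) H) (HTensor (Fin k ⊕ Fin m) H)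
      (SymTensor H (k + m))
    (symProj (k + m) ∘L (relabel finSumFinEquiv).toContinuousLinearMap)) ∘L
    (tmulH (ι := Fin k) (κ := Fin m) (H := H)) ∘L (SymTensor H k).subtypeL

/-- The term `binom(n, k) tr_{k+1 → n}(Gₙ)`, `n = k + m`, of the series defining `Γ^(k)`. -/
def densityTerm (Γ : Fock H →L[ℂ] Fock H) (k m : ℕ) : SymTensor H k →L[ℂ] SymTensor H k :=
  ((k + m).choose k : ℂ) • partialTrace (symMul H k m) (block Γ (k + m))

/-- The `k`-particle density matrix `Γ^(k) = ∑_{n ≥ k} binom(n, k) tr_{k+1 → n}(Gₙ)` of `Γ`. -/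
def densityMatrix (Γ : Fock H →L[ℂ] Fock H) (k : ℕ) : SymTensor H k →L[ℂ] SymTensor H k :=
  ∑' m : ℕ, densityTerm Γ k m

/-- The operator `A ⊗ₛ 1_{n-k} = binom(n, k)⁻¹ ∑_{i₁ < ⋯ < iₖ} A_{i₁ ⋯ iₖ}` on `⨂ₛⁿ H`, for an
operator `A` on `⨂ₛᵏ H`; `A_{i₁ ⋯ iₖ}` acts as `A` on the variables `i₁, …, iₖ`, and the sum is over
the `k`-element sets `S = {i₁, …, iₖ}`. -/
def symTensorOne (k n : ℕ) (A : SymTensor H k →L[ℂ] SymTensor H k) :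
    SymTensor H n →L[ℂ] SymTensor H n :=
  ((n.choose k : ℂ)⁻¹) • ∑ S : {S : Finset (Fin n) // S.card = k},
    let e : Fin k ⊕ Fin S.1ᶜ.card ≃ Fin n := finSumEquivOfFinset S.2 rfl
    symProj n ∘L (relabel e).toContinuousLinearMap ∘L
      ampH ((SymTensor H k).subtypeL ∘L A ∘L symProj k) ∘L
      (relabel e.symm).toContinuousLinearMap ∘L (SymTensor H n).subtypeL

variable (V : Submodule ℂ H)

lemma relabel_tensorMap {n : ℕ} (σ : Equiv.Perm (Fin n)) (x : HTensor (Fin n) V) :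
    relabel σ (tensorMap V.subtypeₗᵢ (Equiv.refl _) x)
      = tensorMap V.subtypeₗᵢ (Equiv.refl _) (relabel σ x) := by
  refine htensor_induction (p := fun x => relabel σ (tensorMap V.subtypeₗᵢ (Equiv.refl _) x)
      = tensorMap V.subtypeₗᵢ (Equiv.refl _) (relabel σ x))
    (isClosed_eq ((relabel σ).continuous.comp (tensorMap _ _).continuous)
      ((tensorMap _ _).continuous.comp (relabel σ).continuous)) (fun f => ?_)
    (fun c x hx => by simp only [map_smul, hx]) (fun x y hx hy => by simp only [map_add, hx, hy]) x
  simp only [relabel, tensorMap_tprodH]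
  rfl

/-- The inclusion `⨂ₛⁿ V ⊆ ⨂ₛⁿ H`. -/
def symIncl (n : ℕ) : SymTensor V n →L[ℂ] SymTensor H n :=
  ((tensorMap V.subtypeₗᵢ (Equiv.refl (Fin n))).toContinuousLinearMap ∘L
    (SymTensor V n).subtypeL).codRestrict (SymTensor H n) fun x σ =>
      (relabel_tensorMap V σ x).trans (congrArg _ (x.2 σ))

/-- The operator `P^{⊗n} A P^{⊗n}`, `P` the orthogonal projection onto `V`, as an operator on
`⨂ₛⁿ V`. -/
def compress {n : ℕ} (A : SymTensor H n →L[ℂ] SymTensor H n) :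
    SymTensor V n →L[ℂ] SymTensor V n :=
  (symIncl V n).adjoint ∘L A ∘L symIncl V n

/-- The localized state `Γ_V = tr_{F(V⊥)} Γ` on `F(V)`. -/
def localization (Γ : Fock H →L[ℂ] Fock H) : Fock V →L[ℂ] Fock V :=
  partialTrace (fockMul V) Γ

variable [FiniteDimensional ℂ V]

/-- The lower symbol (Husimi function)
`μ(u) = (επ)^{-dim V} ⟪ξ(u/√ε), Γ_V ξ(u/√ε)⟫`, `u ∈ V`. -/
def husimi (Γ : Fock H →L[ℂ] Fock H) (ε : ℝ) (u : V) : ℝ :=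
  ((ε * Real.pi) ^ Module.finrank ℂ V)⁻¹ *
    (inner ℂ (coherent (((√ε)⁻¹ : ℂ) • u))
      (localization V Γ (coherent (((√ε)⁻¹ : ℂ) • u)))).re

variable [MeasurableSpace H] [BorelSpace H]

/-- The Lebesgue measure `du` of the `2 dim V`-dimensional real Euclidean space underlying `V`:
the image of the Lebesgue measure of `ℂ^d` under an orthonormal basis of `V`. -/
def lebesgue : Measure V :=
  Measure.map (fun z : Fin (Module.finrank ℂ V) → ℂ => ∑ i, z i • stdOrthonormalBasis ℂ V i) volume

/-- The measure `dμ(u) = μ(u) du` on `V`. -/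
def husimiMeasure (Γ : Fock H →L[ℂ] Fock H) (ε : ℝ) : Measure V :=
  (lebesgue V).withDensity fun u => ENNReal.ofReal (husimi V Γ ε u)

end DensityMatrices

end BoseFock

end

/-! Write Γ = S†S. Then tr Γ = 1 says that S is Hilbert–Schmidt, and traces, number moments and
quadratic forms of partial traces all become sums of squares `‖S …‖²` in [0, ∞]. Changes of basis
and interchanges of sums are then unconditional, and finiteness is a separate question. The
localized state is likewise T†T, with `‖T Ψ‖²` equal to the sum of `‖S (Ψ · Φ)‖²` over a basis of
vectors Φ of F(V⊥) (`enorm_sq_localization`).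

Compression. Let a*(x) denote the multiplication y ↦ binom(k+m, k)^{1/2} x ⊗ₛ y (`create`). The
quadratic form at x of the m-th term of the series for the density matrix is the squared
Hilbert–Schmidt norm of S a*(x) on the m-particle sector (`inner_densityTerm`). For x over V this
multiplication commutes with the factorization of Fock space (`fockMul_create`), so evaluation in a
basis of product vectors shows that Γ and Γ_V have the same forms on V. Over the finite-dimensional
V, weak convergence of a series of positive operators gives norm convergence
(`hasSum_of_isPositive`).

Integral. Paired with the exponential vector of z, a*(x) becomes multiplication by ⟪z^{⊗k}, x⟫ / √k!
(`exists_creation`). Coherent states resolve the identity of F(V) (`lintegral_coherent`), so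
integrating |⟪ξ(u/√ε), ψ⟫|² |⟪u^{⊗k}, x⟫|² over u gives (επ)^{dim V} k! ε^k ‖a*(x)ψ‖²
(`lintegral_power_coherent`). Summed over a rank-one decomposition of Γ_V, this is the expectation
of the anti-normally ordered product a(x) a*(x). Wick's formula (`inner_create_power`, carried to
states in `tsum_create_eq`) reorders it into the sum of binom(k, ℓ) Γ_V^(ℓ) ⊗ₛ 1. The term ℓ = k is
Γ_V^(k) and the others are positive, whence the lower bound.

For (b), there are at most as many particles in V as in total, so moments decrease under
localization. The series for Γ^(ℓ) now converges in norm, and compression, being continuous, passes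
through it.

Identities in Fock space are checked throughout by pairing with powers z^{⊗n} or with exponential
vectors: both families are total, and such pairings are multiplicative. -/

noncomputable section
namespace BoseFock

/-! ### Hilbert–Schmidt norms in [0, ∞] and partial traces of S†S. -/

section HilbertSchmidt
variable {E F K L : Type*} [NormedAddCommGroup E] [InnerProductSpace ℂ E] [CompleteSpace E]
  [NormedAddCommGroup F] [InnerProductSpace ℂ F] [CompleteSpace F]
  [NormedAddCommGroup K] [InnerProductSpace ℂ K] [CompleteSpace K]
  [NormedAddCommGroup L] [InnerProductSpace ℂ L] [CompleteSpace L]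

lemma enorm_sq_eq_ofReal {E : Type*} [SeminormedAddCommGroup E] (x : E) :
    ‖x‖ₑ ^ 2 = ENNReal.ofReal (‖x‖ ^ 2) := by
  rw [← ofReal_norm, ENNReal.ofReal_pow (norm_nonneg _)]

/-- Parseval's identity with values in `[0, ∞]`. -/
lemma tsum_enorm_inner_sq {ι : Type*} (b : HilbertBasis ι ℂ E) (x : E) :
    ∑' i, ‖inner ℂ (b i) x‖ₑ ^ 2 = ‖x‖ₑ ^ 2 := by
  have h := b.hasSum_inner_mul_inner x x
  have h' : HasSum (fun i => ‖inner ℂ (b i) x‖ ^ 2) (‖x‖ ^ 2) := by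
    rw [← Complex.hasSum_ofReal]
    convert! h using 1
    · ext i
      rw [← inner_conj_symm x (b i), ← Complex.normSq_eq_conj_mul_self, Complex.normSq_eq_norm_sq]
    · rw [inner_self_eq_norm_sq_to_K]; norm_cast
  simp only [enorm_sq_eq_ofReal]
  rw [← ENNReal.ofReal_tsum_of_nonneg (fun _ => by positivity) h'.summable, h'.tsum_eq]

lemma enorm_inner_symm (x y : E) : ‖inner ℂ x y‖ₑ = ‖inner ℂ y x‖ₑ := by
  rw [← ofReal_norm, ← ofReal_norm, norm_inner_symm]

/-- The square `∑ⱼ ‖T eⱼ‖² ∈ [0, ∞]` of the Hilbert–Schmidt norm. -/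
def hsNormSq (T : E →L[ℂ] F) : ℝ≥0∞ := ∑' j, ‖T (hBasis E j)‖ₑ ^ 2

/-- By Parseval both sides are the double sum of `|⟪c j, T (b i)⟫|²`. Since the left side ignores
`c` and the right side ignores `b`, independence of the basis follows. -/
lemma tsum_enorm_sq_adjoint {ι κ : Type*} (b : HilbertBasis ι ℂ E) (c : HilbertBasis κ ℂ F)
    (T : E →L[ℂ] F) : ∑' i, ‖T (b i)‖ₑ ^ 2 = ∑' j, ‖T.adjoint (c j)‖ₑ ^ 2 := by
  simp_rw [← tsum_enorm_inner_sq c (T _), ← tsum_enorm_inner_sq b (T.adjoint _)]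
  rw [ENNReal.tsum_comm]
  simp_rw [ContinuousLinearMap.adjoint_inner_right]
  simp_rw [enorm_inner_symm (T _)]

/-- The Hilbert–Schmidt norm may be computed in any Hilbert basis. -/
lemma hsNormSq_eq_tsum {ι : Type*} (b : HilbertBasis ι ℂ E) (T : E →L[ℂ] F) :
    hsNormSq T = ∑' i, ‖T (b i)‖ₑ ^ 2 := by
  rw [hsNormSq, tsum_enorm_sq_adjoint b (hBasis F), tsum_enorm_sq_adjoint (hBasis E) (hBasis F)]

lemma hsNormSq_adjoint (T : E →L[ℂ] F) : hsNormSq T.adjoint = hsNormSq T :=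
  (tsum_enorm_sq_adjoint (hBasis E) (hBasis F) T).symm

lemma hsNormSq_isometry_comp (J : F →L[ℂ] K) (hJ : ∀ x, ‖J x‖ = ‖x‖) (T : E →L[ℂ] F) :
    hsNormSq (J ∘L T) = hsNormSq T := by
  simp only [hsNormSq, ContinuousLinearMap.comp_apply, ← ofReal_norm, hJ]

/-- Lets an operator given on a subspace be extended by zero to the whole space, so that its norm
can be evaluated in a basis of the larger space. -/
lemma hsNormSq_comp_coisometry (J : E →L[ℂ] F) (hJ : ∀ x, ‖J x‖ = ‖x‖) (T : E →L[ℂ] K) :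
    hsNormSq (T ∘L J.adjoint) = hsNormSq T := by
  rw [← hsNormSq_adjoint, ContinuousLinearMap.adjoint_comp, ContinuousLinearMap.adjoint_adjoint,
    hsNormSq_isometry_comp J hJ, hsNormSq_adjoint]

lemma hsNormSq_comp_le_left (A : F →L[ℂ] K) (T : E →L[ℂ] F) :
    hsNormSq (A ∘L T) ≤ ‖A‖ₑ ^ 2 * hsNormSq T := by
  rw [hsNormSq, hsNormSq, ← ENNReal.tsum_mul_left]
  refine ENNReal.tsum_le_tsum fun j => ?_
  rw [← mul_pow]
  exact pow_le_pow_left₀ zero_le (A.le_opENorm _) 2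

lemma hsNormSq_comp_le_right (T : F →L[ℂ] K) (A : E →L[ℂ] F) :
    hsNormSq (T ∘L A) ≤ ‖A‖ₑ ^ 2 * hsNormSq T := by
  rw [← hsNormSq_adjoint, ContinuousLinearMap.adjoint_comp, ← hsNormSq_adjoint T]
  refine (hsNormSq_comp_le_left _ _).trans_eq ?_
  rw [← ofReal_norm, ← ofReal_norm, LinearIsometryEquiv.norm_map]

lemma enorm_sq_apply_le_hsNormSq (T : E →L[ℂ] F) (x : E) :
    ‖T x‖ₑ ^ 2 ≤ hsNormSq T * ‖x‖ₑ ^ 2 := by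
  rw [← hsNormSq_adjoint, ← tsum_enorm_inner_sq (hBasis F), hsNormSq, ← ENNReal.tsum_mul_right]
  refine ENNReal.tsum_le_tsum fun j => ?_
  rw [← ContinuousLinearMap.adjoint_inner_left, ← mul_pow]
  refine pow_le_pow_left₀ zero_le ?_ 2
  rw [← ofReal_norm, ← ofReal_norm, ← ofReal_norm, ← ENNReal.ofReal_mul (norm_nonneg _)]
  exact ENNReal.ofReal_le_ofReal (norm_inner_le_norm _ _)

lemma enorm_sq_le_hsNormSq (T : E →L[ℂ] F) : ‖T‖ₑ ^ 2 ≤ hsNormSq T := by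
  rcases eq_or_ne (hsNormSq T) ⊤ with h | h
  · rw [h]; exact le_top
  lift hsNormSq T to NNReal using h with a ha
  have h1 : ‖T‖ ≤ √(a : ℝ) := by
    refine T.opNorm_le_bound (Real.sqrt_nonneg _) fun x => ?_
    have := enorm_sq_apply_le_hsNormSq T x
    rw [← ha, enorm_sq_eq_ofReal, enorm_sq_eq_ofReal, ← ENNReal.ofReal_coe_nnreal,
      ← ENNReal.ofReal_mul a.coe_nonneg, ENNReal.ofReal_le_ofReal_iff (by positivity)] at this
    refine (sq_le_sq₀ (norm_nonneg _) (by positivity)).1 ?_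
    rwa [mul_pow, Real.sq_sqrt a.coe_nonneg]
  rw [enorm_sq_eq_ofReal, ← ENNReal.ofReal_coe_nnreal]
  refine ENNReal.ofReal_le_ofReal ?_
  calc ‖T‖ ^ 2 ≤ √(a : ℝ) ^ 2 := pow_le_pow_left₀ (norm_nonneg _) h1 2
    _ = a := Real.sq_sqrt a.coe_nonneg

/-- A positive operator is of the form `S† S`. -/
lemma exists_adjoint_comp_self {Γ : E →L[ℂ] E} (h : Γ.IsPositive) :
    ∃ S : E →L[ℂ] E, Γ = S.adjoint ∘L S := by
  obtain ⟨S, hS⟩ := (CStarAlgebra.nonneg_iff_eq_star_mul_self (a := Γ)).1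
    ((ContinuousLinearMap.nonneg_iff_isPositive Γ).2 h)
  exact ⟨S, hS⟩

lemma inner_adjoint_comp_self (S : E →L[ℂ] F) (x y : E) :
    inner ℂ x ((S.adjoint ∘L S) y) = inner ℂ (S x) (S y) := by
  rw [ContinuousLinearMap.comp_apply, ContinuousLinearMap.adjoint_inner_right]

lemma inner_adjoint_comp_self_self (S : E →L[ℂ] F) (x : E) :
    inner ℂ x ((S.adjoint ∘L S) x) = ((‖S x‖ ^ 2 : ℝ) : ℂ) := by
  rw [inner_adjoint_comp_self, inner_self_eq_norm_sq_to_K]; norm_cast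

/-- The dictionary between traces of positive operators and Hilbert–Schmidt norms of their factors.
-/
lemma posTrace_adjoint_comp_self (S : E →L[ℂ] F) : posTrace (S.adjoint ∘L S) = hsNormSq S := by
  simp only [posTrace, hsNormSq, inner_adjoint_comp_self_self, Complex.ofReal_re,
    enorm_sq_eq_ofReal]

lemma adjoint_comp_self_comp (S : F →L[ℂ] K) (A : E →L[ℂ] F) :
    A.adjoint ∘L (S.adjoint ∘L S) ∘L A = (S ∘L A).adjoint ∘L (S ∘L A) := by
  rw [ContinuousLinearMap.adjoint_comp]; rfl

lemma norm_adjoint_comp_self (S : E →L[ℂ] F) : ‖S.adjoint ∘L S‖ = ‖S‖ ^ 2 := by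
  rw [sq, ContinuousLinearMap.norm_adjoint_comp_self]

/-- The bilinear map `m` satisfies Bessel's inequality on product bases. -/
def BesselMul (m : E →L[ℂ] F →L[ℂ] K) : Prop :=
  ∀ h : K, ∑' i, ∑' j, ‖inner ℂ (m (hBasis E i) (hBasis F j)) h‖ₑ ^ 2 ≤ ‖h‖ₑ ^ 2

/-- Expanding in a basis of `L`, the claim is Bessel's inequality applied to each `S† ℓᵢ` and summed
over `i`. It says that a partial trace does not increase the trace. -/
lemma BesselMul.tsum_hsNormSq_le {m : E →L[ℂ] F →L[ℂ] K} (hm : BesselMul m) (S : K →L[ℂ] L) :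
    ∑' j, hsNormSq (S ∘L m.flip (hBasis F j)) ≤ hsNormSq S := by
  rw [← hsNormSq_adjoint S]
  simp only [hsNormSq, ContinuousLinearMap.comp_apply, ContinuousLinearMap.flip_apply]
  simp_rw [← tsum_enorm_inner_sq (hBasis L) (S _)]
  rw [ENNReal.tsum_comm]
  have : ∀ b, (∑' a, ∑' i, ‖inner ℂ (hBasis L i) (S (m (hBasis E b) (hBasis F a)))‖ₑ ^ 2)
      = ∑' i, ∑' a, ‖inner ℂ (m (hBasis E b) (hBasis F a)) (S.adjoint (hBasis L i))‖ₑ ^ 2 := by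
    intro b
    rw [ENNReal.tsum_comm]
    simp_rw [ContinuousLinearMap.adjoint_inner_right, enorm_inner_symm (S _)]
  simp_rw [this]
  rw [ENNReal.tsum_comm]
  exact ENNReal.tsum_le_tsum fun i => hm _

lemma summable_norm_sq_of_tsum_ne_top {ι : Type*} {f : ι → ℝ} {g : ι → ℝ≥0∞}
    (hf : ∀ i, 0 ≤ f i) (h : ∀ i, ENNReal.ofReal (f i) ≤ g i) (hg : ∑' i, g i ≠ ⊤) :
    Summable f := by
  have h1 : ∑' i, ENNReal.ofReal (f i) ≠ ⊤ :=
    ne_top_of_le_ne_top hg (ENNReal.tsum_le_tsum h)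
  have := ENNReal.summable_toReal h1
  simpa only [ENNReal.toReal_ofReal (hf _)] using this

variable {m : E →L[ℂ] F →L[ℂ] K} {S : K →L[ℂ] L}

/-- Absolute convergence: each term is A†A, whose norm `‖A‖²` is at most the squared Hilbert–Schmidt
norm of A, and these are summable by Bessel. -/
lemma summable_partialTrace (hm : BesselMul m) (hS : hsNormSq S ≠ ⊤) :
    Summable fun j => (m.flip (hBasis F j)).adjoint ∘L (S.adjoint ∘L S) ∘L m.flip (hBasis F j) := by
  simp_rw [adjoint_comp_self_comp]
  refine Summable.of_norm ?_
  simp_rw [norm_adjoint_comp_self]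
  refine summable_norm_sq_of_tsum_ne_top (fun _ => by positivity) (fun j => ?_)
    (ne_top_of_le_ne_top hS (hm.tsum_hsNormSq_le S))
  rw [← enorm_sq_eq_ofReal]
  exact enorm_sq_le_hsNormSq _

lemma hasSum_inner_partialTrace (hm : BesselMul m) (hS : hsNormSq S ≠ ⊤) (x y : E) :
    HasSum (fun j => inner ℂ (S (m x (hBasis F j))) (S (m y (hBasis F j))))
      (inner ℂ x (partialTrace m (S.adjoint ∘L S) y)) := by
  have h := (summable_partialTrace hm hS).hasSum
  have h2 := (innerSL ℂ x).hasSum (h.mapL (ContinuousLinearMap.apply ℂ E y))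
  convert! h2 using 1
  ext j
  simp [ContinuousLinearMap.adjoint_inner_right]

/-- The form in which partial traces are used from here on: a quadratic form that is a
Hilbert–Schmidt norm, with no operator-valued series left. -/
lemma inner_partialTrace_self (hm : BesselMul m) (hS : hsNormSq S ≠ ⊤) (x : E) :
    hsNormSq (S ∘L m x) ≠ ⊤ ∧ inner ℂ x (partialTrace m (S.adjoint ∘L S) x)
      = ((hsNormSq (S ∘L m x)).toReal : ℂ) := by
  have h := hasSum_inner_partialTrace hm hS x x
  have h' : HasSum (fun j => ‖S (m x (hBasis F j))‖ ^ 2)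
      (inner ℂ x (partialTrace m (S.adjoint ∘L S) x)).re := by
    have := Complex.hasSum_re h
    convert! this using 1
    ext j
    rw [inner_self_eq_norm_sq_to_K]
    norm_cast
  have e : hsNormSq (S ∘L m x)
      = ENNReal.ofReal (inner ℂ x (partialTrace m (S.adjoint ∘L S) x)).re := by
    rw [hsNormSq]
    simp only [enorm_sq_eq_ofReal, ContinuousLinearMap.comp_apply]
    rw [← ENNReal.ofReal_tsum_of_nonneg (fun _ => by positivity) h'.summable, h'.tsum_eq]
  refine ⟨by rw [e]; exact ENNReal.ofReal_ne_top, ?_⟩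
  rw [e, ENNReal.toReal_ofReal (h'.nonneg fun _ => by positivity)]
  refine h.unique ?_
  convert! (Complex.hasSum_ofReal.2 h') using 1
  ext j
  rw [inner_self_eq_norm_sq_to_K]
  norm_cast

/-- An operator with nonnegative real expectation values is positive. -/
lemma isPositive_of_inner_ofReal {A : E →L[ℂ] E} {f : E → ℝ} (hf : ∀ x, 0 ≤ f x)
    (h : ∀ x, inner ℂ x (A x) = (f x : ℂ)) : A.IsPositive := by
  rw [ContinuousLinearMap.isPositive_iff_complex]
  intro x
  have : inner ℂ (A x) x = (f x : ℂ) := by rw [← inner_conj_symm, h, Complex.conj_ofReal]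
  rw [this]
  simp [hf]

lemma isPositive_partialTrace (hm : BesselMul m) (hS : hsNormSq S ≠ ⊤) :
    (partialTrace m (S.adjoint ∘L S)).IsPositive :=
  isPositive_of_inner_ofReal (fun _ => ENNReal.toReal_nonneg)
    fun x => (inner_partialTrace_self hm hS x).2

/-- Two operators with the same expectation values agree. -/
lemma clm_ext_inner {A B : E →L[ℂ] E} (h : ∀ x, inner ℂ x (A x) = inner ℂ x (B x)) : A = B := by
  refine ContinuousLinearMap.coe_injective ((ext_inner_map _ _).1 fun x => ?_)
  have := congrArg conj (h x)
  simp only [inner_conj_symm] at this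
  exact this

/-- The norm of a positive operator is bounded by a bound on its expectation values. -/
lemma norm_le_of_isPositive {A : E →L[ℂ] E} (hA : A.IsPositive) {c : ℝ} (hc : 0 ≤ c)
    (h : ∀ x, (inner ℂ x (A x)).re ≤ c * ‖x‖ ^ 2) : ‖A‖ ≤ c := by
  obtain ⟨S, rfl⟩ := exists_adjoint_comp_self hA
  have h1 : ‖S‖ ≤ √c := by
    refine S.opNorm_le_bound (Real.sqrt_nonneg _) fun x => ?_
    have := h x
    rw [inner_adjoint_comp_self_self, Complex.ofReal_re] at this
    refine (sq_le_sq₀ (norm_nonneg _) (by positivity)).1 ?_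
    rwa [mul_pow, Real.sq_sqrt hc]
  rw [norm_adjoint_comp_self]
  calc ‖S‖ ^ 2 ≤ √c ^ 2 := pow_le_pow_left₀ (norm_nonneg _) h1 2
    _ = c := Real.sq_sqrt hc

end HilbertSchmidt


/-! ### Symmetric tensors and their pairing with powers. -/

section Powers
variable {H : Type*} [NormedAddCommGroup H] [InnerProductSpace ℂ H]

lemma norm_tprodH {ι : Type} [Fintype ι] (f : ι → H) : ‖tprodH f‖ = ∏ i, ‖f i‖ := by
  have h : ‖tprodH f‖ ^ 2 = (∏ i, ‖f i‖) ^ 2 := by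
    have h1 := inner_tprodH f f
    simp only [inner_self_eq_norm_sq_to_K] at h1
    rw [← Finset.prod_pow]
    exact_mod_cast h1
  exact (sq_eq_sq₀ (norm_nonneg _) (Finset.prod_nonneg fun _ _ => norm_nonneg _)).1 h

variable (H) in
/-- The pure tensor as a continuous multilinear map. -/
def tprodCLM (ι : Type) [Fintype ι] :
    ContinuousMultilinearMap ℂ (fun _ : ι => H) (HTensor ι H) :=
  ((toHT (ι := ι) (H := H)).toLinearMap.compMultilinearMap tprodPre).mkContinuous 1
    fun f => by rw [one_mul]; exact (norm_tprodH f).le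

lemma inner_power_power (n : ℕ) (u v : H) :
    inner ℂ (power n u) (power n v) = inner ℂ u v ^ n := by
  have h : inner ℂ (tprodH fun _ : Fin n => u) (tprodH fun _ : Fin n => v)
      = ∏ _i : Fin n, inner ℂ u v := inner_tprodH _ _
  rw [Finset.prod_const, Finset.card_univ, Fintype.card_fin] at h
  exact h

lemma coe_power (n : ℕ) (u : H) : (power n u : HTensor (Fin n) H) = tprodH fun _ => u := rfl

lemma relabel_tprodH {ι κ : Type} [Fintype ι] [Fintype κ] (e : ι ≃ κ) (f : ι → H) :
    relabel e (tprodH f) = tprodH fun k => f (e.symm k) := by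
  rw [relabel, tensorMap_tprodH]; rfl

lemma relabel_symm_relabel {ι κ : Type} [Fintype ι] [Fintype κ] (e : ι ≃ κ) (x : HTensor ι H) :
    relabel e.symm (relabel e x) = x := by
  refine htensor_induction (p := fun x => relabel e.symm (relabel e x) = x)
    (isClosed_eq ((relabel _).continuous.comp (relabel _).continuous) continuous_id) (fun f => ?_)
    (fun c x hx => by simp only [map_smul, hx]) (fun x y hx hy => by simp only [map_add, hx, hy]) x
  simp [relabel_tprodH]

lemma relabel_relabel_symm {ι κ : Type} [Fintype ι] [Fintype κ] (e : ι ≃ κ) (x : HTensor κ H) :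
    relabel e (relabel e.symm x) = x :=
  relabel_symm_relabel e.symm x

lemma inner_relabel_left {ι κ : Type} [Fintype ι] [Fintype κ] (e : ι ≃ κ) (x : HTensor ι H)
    (y : HTensor κ H) : inner ℂ (relabel e x) y = inner ℂ x (relabel e.symm y) := by
  rw [← (relabel e).inner_map_map x, relabel_relabel_symm]

lemma inner_symProj_right {n : ℕ} (x : SymTensor H n) (y : HTensor (Fin n) H) :
    inner ℂ x (symProj n y) = inner ℂ (x : HTensor (Fin n) H) y := by
  rw [symProj, Submodule.inner_orthogonalProjectionOnto_eq_of_mem_left]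

lemma inner_symProj_left {n : ℕ} (x : SymTensor H n) (y : HTensor (Fin n) H) :
    inner ℂ (symProj n y) x = inner ℂ y (x : HTensor (Fin n) H) := by
  rw [← inner_conj_symm, inner_symProj_right, inner_conj_symm]

lemma symProj_coe {n : ℕ} (x : SymTensor H n) : symProj n (x : HTensor (Fin n) H) = x :=
  Submodule.orthogonalProjectionOnto_mem_subspace_eq_self x

/-- A symmetric tensor orthogonal to all `z^{⊗n}` vanishes (polarization). -/
lemma eq_zero_of_inner_power {n : ℕ} (x : SymTensor H n)
    (h : ∀ z, inner ℂ (power n z) x = 0) : x = 0 := by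
  let T : ContinuousMultilinearMap ℂ (fun _ : Fin n => H) ℂ :=
    (innerSL ℂ (x : HTensor (Fin n) H)).compContinuousMultilinearMap (tprodCLM H (Fin n))
  have hT : ∀ f, T f = inner ℂ (x : HTensor (Fin n) H) (tprodH f) := fun f => rfl
  have h0 : (fun z : H => T fun _ => z) = 0 := by
    funext z
    rw [hT, ← coe_power, ← Submodule.coe_inner, ← inner_conj_symm, h, map_zero]; rfl
  have h1 : ∀ v : Fin n → H, T v = 0 := by
    intro v
    -- The n-th derivative at 0 of z ↦ T(z, …, z) is the sum of T over all permutations of `v`. By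
    -- symmetry of `x` this is n! T(v), and it vanishes because T is zero on the diagonal.
    have h2 := T.iteratedFDeriv_comp_diagonal 0 v
    rw [h0] at h2
    have h3 : ∀ σ : Equiv.Perm (Fin n), T (fun i => v (σ i)) = T v := by
      intro σ
      have e : relabel σ.symm (tprodH v) = tprodH fun i => v (σ i) := relabel_tprodH _ _
      rw [hT, hT, ← e, ← inner_relabel_left σ, x.2]
    simp only [h3, Finset.sum_const, Finset.card_univ, Fintype.card_perm, Fintype.card_fin] at h2
    have h4 : iteratedFDeriv ℂ n (0 : H → ℂ) 0 v = 0 := by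
      rw [show (0 : H → ℂ) = fun _ => 0 from rfl, iteratedFDeriv_fun_zero]
      rfl
    rw [h4, nsmul_eq_mul] at h2
    rcases mul_eq_zero.1 h2.symm with h5 | h5
    · exact absurd h5 (by exact_mod_cast n.factorial_ne_zero)
    · exact h5
  have h6 : ∀ y : HTensor (Fin n) H, inner ℂ (x : HTensor (Fin n) H) y = 0 := by
    intro y
    refine htensor_induction (p := fun y => inner ℂ (x : HTensor (Fin n) H) y = 0)
      (isClosed_eq (by fun_prop) (by fun_prop)) h1
      (fun c y hy => by rw [inner_smul_right, hy, mul_zero])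
      (fun y y' hy hy' => by rw [inner_add_right, hy, hy', add_zero]) y
  exact Subtype.ext (inner_self_eq_zero.1 (h6 x))

lemma sym_ext {n : ℕ} {x y : SymTensor H n}
    (h : ∀ z, inner ℂ (power n z) x = inner ℂ (power n z) y) : x = y := by
  rw [← sub_eq_zero]
  exact eq_zero_of_inner_power _ fun z => by rw [inner_sub_right, h, sub_self]

lemma dense_span_power (n : ℕ) :
    (Submodule.span ℂ (Set.range (power (H := H) n))).topologicalClosure = ⊤ := by
  rw [Submodule.topologicalClosure_eq_top_iff, Submodule.eq_bot_iff]
  intro x hx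
  refine eq_zero_of_inner_power x fun z => ?_
  exact hx _ (Submodule.subset_span ⟨z, rfl⟩)

lemma inner_tprodH_tmulH {ι κ : Type} [Fintype ι] [Fintype κ] (z : H) (x : HTensor ι H)
    (y : HTensor κ H) : inner ℂ (tprodH fun _ : ι ⊕ κ => z) (tmulH x y)
      = inner ℂ (tprodH fun _ => z) x * inner ℂ (tprodH fun _ => z) y := by
  rw [← inner_tmulH, tmulH_tprodH]
  congr 2
  funext i
  cases i <;> rfl

/-- The projection onto symmetric tensors disappears because the power on the left is already
symmetric. -/
lemma inner_power_symMul (k m : ℕ) (z : H) (x : SymTensor H k) (y : HTensor (Fin m) H) :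
    inner ℂ (power (k + m) z) (symMul H k m x y)
      = inner ℂ (power k z) x * inner ℂ (tprodH fun _ : Fin m => z) y := by
  have e : symMul H k m x y
      = symProj (k + m) (relabel finSumFinEquiv (tmulH (x : HTensor (Fin k) H) y)) := rfl
  rw [e, inner_symProj_right, coe_power]
  have e2 : (tprodH fun _ : Fin (k + m) => z)
      = relabel finSumFinEquiv (tprodH fun _ : Fin k ⊕ Fin m => z) :=
    (relabel_tprodH finSumFinEquiv (fun _ => z)).symm
  rw [e2, LinearIsometry.inner_map_map, inner_tprodH_tmulH, Submodule.coe_inner, coe_power]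

lemma tsum_enorm_inner_sq_le {E ι : Type*} [NormedAddCommGroup E] [InnerProductSpace ℂ E]
    {v : ι → E} (hv : Orthonormal ℂ v) (x : E) : ∑' i, ‖inner ℂ (v i) x‖ₑ ^ 2 ≤ ‖x‖ₑ ^ 2 := by
  simp only [enorm_sq_eq_ofReal]
  rw [← ENNReal.ofReal_tsum_of_nonneg (fun _ => by positivity) (hv.inner_products_summable x)]
  exact ENNReal.ofReal_le_ofReal (Orthonormal.tsum_inner_products_le x hv)

lemma orthonormal_of_inner_mul {E F G ι κ : Type*} [NormedAddCommGroup E] [InnerProductSpace ℂ E]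
    [NormedAddCommGroup F] [InnerProductSpace ℂ F] [NormedAddCommGroup G] [InnerProductSpace ℂ G]
    {b : ι → E} {c : κ → F} (hb : Orthonormal ℂ b) (hc : Orthonormal ℂ c) {m : E → F → G}
    (hm : ∀ x y x' y', inner ℂ (m x y) (m x' y') = inner ℂ x x' * inner ℂ y y') :
    Orthonormal ℂ fun p : ι × κ => m (b p.1) (c p.2) := by
  classical
  rw [orthonormal_iff_ite] at hb hc ⊢
  rintro ⟨i, j⟩ ⟨i', j'⟩
  simp only [hm, hb, hc, Prod.mk.injEq]
  split_ifs <;> simp_all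

/-- Moving the symmetrization onto `h`, which is symmetric, leaves plain tensor products of basis
vectors. These are orthonormal, so Bessel's inequality applies. -/
lemma besselMul_symMul (k m : ℕ) : BesselMul (symMul H k m) := by
  intro h
  have e : ∀ x y, inner ℂ (symMul H k m x y) h = inner ℂ (tmulH (x : HTensor (Fin k) H) y)
      (relabel finSumFinEquiv.symm (h : HTensor (Fin (k + m)) H)) := by
    intro x y
    rw [← inner_relabel_left, ← inner_symProj_left]
    rfl
  simp only [e]
  rw [← ENNReal.tsum_prod (f := fun i j => ‖inner ℂ (tmulH
    (hBasis (SymTensor H k) i : HTensor (Fin k) H) (hBasis (HTensor (Fin m) H) j))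
    (relabel finSumFinEquiv.symm (h : HTensor (Fin (k + m)) H))‖ₑ ^ 2)]
  refine (tsum_enorm_inner_sq_le (orthonormal_of_inner_mul
    (hBasis (SymTensor H k)).orthonormal (hBasis (HTensor (Fin m) H)).orthonormal
    (m := fun x y => tmulH (x : HTensor (Fin k) H) y)
    (fun x y x' y' => by rw [inner_tmulH]; rfl)) _).trans_eq ?_
  rw [← ofReal_norm, LinearIsometry.norm_map, ← ofReal_norm]
  rfl

/-- `⨂ᵐ H` may be replaced by `⨂ₛᵐ H` in a partial trace of symmetric operators. -/
lemma symMul_symProj (k m : ℕ) (x : SymTensor H k) (y : HTensor (Fin m) H) :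
    symMul H k m x (symProj m y : HTensor (Fin m) H) = symMul H k m x y := by
  refine sym_ext fun z => ?_
  rw [inner_power_symMul, inner_power_symMul, ← coe_power, ← Submodule.coe_inner,
    inner_symProj_right]

end Powers

/-! ### The inclusion of tensors over V. -/

section Inclusion
variable {H : Type*} [NormedAddCommGroup H] [InnerProductSpace ℂ H] (V : Submodule ℂ H)
  [V.HasOrthogonalProjection]

lemma inner_tprodH_tensorMap {ι : Type} [Fintype ι] (z : H) (x : HTensor ι V) :
    inner ℂ (tprodH fun _ => z) (tensorMap V.subtypeₗᵢ (Equiv.refl ι) x)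
      = inner ℂ (tprodH fun _ => V.orthogonalProjectionOnto z) x := by
  refine htensor_induction (p := fun x =>
    inner ℂ (tprodH fun _ => z) (tensorMap V.subtypeₗᵢ (Equiv.refl ι) x)
      = inner ℂ (tprodH fun _ => V.orthogonalProjectionOnto z) x)
    (isClosed_eq (continuous_const.inner (tensorMap _ _).continuous) (by fun_prop)) (fun f => ?_)
    (fun c y hy => by simp only [map_smul, inner_smul_right, hy])
    (fun y y' hy hy' => by simp only [map_add, inner_add_right, hy, hy']) x
  rw [tensorMap_tprodH, inner_tprodH, inner_tprodH]
  refine Finset.prod_congr rfl fun i _ => ?_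
  exact (Submodule.inner_orthogonalProjectionOnto_eq_of_mem_right (f i) z).symm

lemma inner_power_symIncl (n : ℕ) (z : H) (x : SymTensor V n) :
    inner ℂ (power n z) (symIncl V n x)
      = inner ℂ (power n (V.orthogonalProjectionOnto z)) x :=
  inner_tprodH_tensorMap V z (x : HTensor (Fin n) V)

end Inclusion

/-! ### Tensor powers of a finite-dimensional space. -/

section FiniteDimensional
variable {H : Type*} [NormedAddCommGroup H] [InnerProductSpace ℂ H] [FiniteDimensional ℂ H]

instance finiteDimensional_preTensor (ι : Type) [Fintype ι] :
    FiniteDimensional ℂ (PreTensor ι H) :=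
  inferInstanceAs (Module.Finite ℂ (PiTensorProduct ℂ (fun _ : ι => H)))

/-- The algebraic tensor power has finite dimension, so its image is closed as well as dense:
completion adds nothing. -/
instance finiteDimensional_hTensor (ι : Type) [Fintype ι] : FiniteDimensional ℂ (HTensor ι H) := by
  have hc : IsClosed ((toHT (ι := ι) (H := H)).toLinearMap.range : Set (HTensor ι H)) :=
    Submodule.closed_of_finiteDimensional _
  have hr : (toHT (ι := ι) (H := H)).toLinearMap.range = ⊤ := by
    rw [eq_top_iff]
    intro x _
    exact hc.closure_subset_iff.2 le_rfl (dense_toHT x)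
  exact Module.Finite.of_surjective _ (LinearMap.range_eq_top.1 hr)

lemma span_power_eq_top (n : ℕ) : Submodule.span ℂ (Set.range (power (H := H) n)) = ⊤ := by
  rw [← dense_span_power n]
  exact (Submodule.closed_of_finiteDimensional _).submodule_topologicalClosure_eq.symm

/-- Induction principle for symmetric tensors over a finite-dimensional space. -/
lemma sym_induction {n : ℕ} {p : SymTensor H n → Prop} (hp : ∀ u, p (power n u))
    (hs : ∀ (c : ℂ) x, p x → p (c • x)) (ha : ∀ x y, p x → p y → p (x + y))
    (x : SymTensor H n) : p x := by
  have hx : x ∈ Submodule.span ℂ (Set.range (power (H := H) n)) := by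
    rw [span_power_eq_top]; trivial
  refine Submodule.span_induction (p := fun x _ => p x) ?_ ?_ ?_ ?_ hx
  · rintro _ ⟨u, rfl⟩; exact hp u
  · simpa using hs 0 _ (hp 0)
  · exact fun x y _ _ => ha x y
  · exact fun c x _ => hs c x

instance finite_basisIndex (E : Type*) [NormedAddCommGroup E] [InnerProductSpace ℂ E]
    [CompleteSpace E] [FiniteDimensional ℂ E] : Finite (basisIndex E) :=
  (hBasis E).orthonormal.linearIndependent.finite

end FiniteDimensional


/-! ### The algebra of the operators A ⊗ 1. -/

section Amplification
variable {ι κ : Type} [Fintype ι] [Fintype κ]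
variable {H : Type*} [NormedAddCommGroup H] [InnerProductSpace ℂ H]

/-- Every pure tensor over `ι ⊕ κ` splits as a product, and pure tensors are total. -/
lemma clm_ext_tmulH {F : Type*} [NormedAddCommGroup F] [NormedSpace ℂ F]
    {T T' : HTensor (ι ⊕ κ) H →L[ℂ] F} (h : ∀ x y, T (tmulH x y) = T' (tmulH x y)) : T = T' := by
  ext z
  refine htensor_induction (p := fun z => T z = T' z) (isClosed_eq T.continuous T'.continuous)
    (fun f => ?_) (fun c y hy => by simp only [map_smul, hy])
    (fun y y' hy hy' => by simp only [map_add, hy, hy']) z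
  have e : tprodH f = tmulH (tprodH fun i => f (Sum.inl i)) (tprodH fun i => f (Sum.inr i)) := by
    rw [tmulH_tprodH]
    congr 1
    funext i
    cases i <;> rfl
  rw [e, h]

lemma ampH_add (A B : HTensor ι H →L[ℂ] HTensor ι H) :
    (ampH (A + B) : HTensor (ι ⊕ κ) H →L[ℂ] HTensor (ι ⊕ κ) H) = ampH A + ampH B :=
  clm_ext_tmulH fun x y => by simp [ampH_tmulH]

lemma ampH_smul (c : ℂ) (A : HTensor ι H →L[ℂ] HTensor ι H) :
    (ampH (c • A) : HTensor (ι ⊕ κ) H →L[ℂ] HTensor (ι ⊕ κ) H) = c • ampH A :=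
  clm_ext_tmulH fun x y => by simp [ampH_tmulH]

lemma ampH_comp (A B : HTensor ι H →L[ℂ] HTensor ι H) :
    (ampH (A ∘L B) : HTensor (ι ⊕ κ) H →L[ℂ] HTensor (ι ⊕ κ) H) = ampH A ∘L ampH B :=
  clm_ext_tmulH fun x y => by simp [ampH_tmulH]

lemma ampH_adjoint (A : HTensor ι H →L[ℂ] HTensor ι H) :
    (ampH A.adjoint : HTensor (ι ⊕ κ) H →L[ℂ] HTensor (ι ⊕ κ) H) = (ampH A).adjoint := by
  refine clm_ext_tmulH fun x y => ext_inner_right ℂ fun z => ?_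
  rw [ampH_tmulH, ContinuousLinearMap.adjoint_inner_left]
  have h : innerSL ℂ (tmulH (A.adjoint x) y) = innerSL ℂ (tmulH x y) ∘L ampH A :=
    clm_ext_tmulH fun x' y' => by
      simp [ampH_tmulH, inner_tmulH, ContinuousLinearMap.adjoint_inner_left]
  exact DFunLike.congr_fun h z

end Amplification

/-! ### The operators A ⊗ₛ 1: matrix elements and positivity. -/

section SymTensorOne
variable {H : Type*} [NormedAddCommGroup H] [InnerProductSpace ℂ H]

lemma symProj_adjoint (n : ℕ) : (symProj n).adjoint = (SymTensor H n).subtypeL := by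
  refine ContinuousLinearMap.ext fun x => ext_inner_right ℂ fun y => ?_
  rw [ContinuousLinearMap.adjoint_inner_left, inner_symProj_right]; rfl

lemma subtypeL_adjoint (n : ℕ) : (SymTensor H n).subtypeL.adjoint = symProj n := by
  rw [← symProj_adjoint, ContinuousLinearMap.adjoint_adjoint]

/-- The action of `A` on the variables in a `k`-element set `S`. -/
def actOn {k n : ℕ} (S : {S : Finset (Fin n) // S.card = k})
    (A : SymTensor H k →L[ℂ] SymTensor H k) : SymTensor H n →L[ℂ] SymTensor H n :=
  symProj n ∘L (relabel (finSumEquivOfFinset S.2 rfl :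
      Fin k ⊕ Fin S.1ᶜ.card ≃ Fin n)).toContinuousLinearMap ∘L
    ampH ((SymTensor H k).subtypeL ∘L A ∘L symProj k) ∘L
    (relabel (finSumEquivOfFinset S.2 rfl :
      Fin k ⊕ Fin S.1ᶜ.card ≃ Fin n).symm).toContinuousLinearMap ∘L (SymTensor H n).subtypeL

lemma symTensorOne_eq (k n : ℕ) (A : SymTensor H k →L[ℂ] SymTensor H k) :
    symTensorOne k n A
      = ((n.choose k : ℂ)⁻¹) • ∑ S : {S : Finset (Fin n) // S.card = k}, actOn S A := rfl

lemma inner_actOn {k n : ℕ} (S : {S : Finset (Fin n) // S.card = k})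
    (A : SymTensor H k →L[ℂ] SymTensor H k) (x y : SymTensor H n) :
    inner ℂ x (actOn S A y)
      = inner ℂ (relabel (finSumEquivOfFinset S.2 rfl :
          Fin k ⊕ Fin S.1ᶜ.card ≃ Fin n).symm (x : HTensor (Fin n) H))
        (ampH ((SymTensor H k).subtypeL ∘L A ∘L symProj k)
          (relabel (finSumEquivOfFinset S.2 rfl :
            Fin k ⊕ Fin S.1ᶜ.card ≃ Fin n).symm (y : HTensor (Fin n) H))) := by
  simp only [actOn, ContinuousLinearMap.comp_apply]
  rw [inner_symProj_right, inner_relabel_left, Equiv.symm_symm]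
  rfl

lemma actOn_add {k n : ℕ} (S : {S : Finset (Fin n) // S.card = k})
    (A B : SymTensor H k →L[ℂ] SymTensor H k) : actOn S (A + B) = actOn S A + actOn S B := by
  simp only [actOn, ContinuousLinearMap.add_comp, ContinuousLinearMap.comp_add, ampH_add]

lemma actOn_smul {k n : ℕ} (S : {S : Finset (Fin n) // S.card = k}) (c : ℂ)
    (A : SymTensor H k →L[ℂ] SymTensor H k) : actOn S (c • A) = c • actOn S A := by
  simp only [actOn, ContinuousLinearMap.smul_comp, ContinuousLinearMap.comp_smul, ampH_smul]

/-- With A = B†B, the amplification A ⊗ 1 is (B ⊗ 1)†(B ⊗ 1). -/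
lemma isPositive_actOn {k n : ℕ} (S : {S : Finset (Fin n) // S.card = k})
    {A : SymTensor H k →L[ℂ] SymTensor H k} (hA : A.IsPositive) : (actOn S A).IsPositive := by
  obtain ⟨B, rfl⟩ := exists_adjoint_comp_self hA
  have e : (SymTensor H k).subtypeL ∘L (B.adjoint ∘L B) ∘L symProj k
      = ((SymTensor H k).subtypeL ∘L B ∘L symProj k).adjoint
        ∘L ((SymTensor H k).subtypeL ∘L B ∘L symProj k) := by
    rw [ContinuousLinearMap.adjoint_comp, ContinuousLinearMap.adjoint_comp, symProj_adjoint,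
      subtypeL_adjoint]
    ext x
    simp only [ContinuousLinearMap.comp_apply, Submodule.subtypeL_apply, symProj_coe]
  refine isPositive_of_inner_ofReal (f := fun x =>
    ‖ampH ((SymTensor H k).subtypeL ∘L B ∘L symProj k)
    (relabel (finSumEquivOfFinset S.2 rfl :
      Fin k ⊕ Fin S.1ᶜ.card ≃ Fin n).symm (x : HTensor (Fin n) H))‖ ^ 2)
    (fun x => by positivity) fun x => ?_
  rw [inner_actOn, e, ampH_comp, ampH_adjoint, inner_adjoint_comp_self_self]

/-- A power splits as a product along any set of variables, so the result does not depend on which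
k-element set `A` acts on. -/
lemma inner_power_actOn {k n : ℕ} (S : {S : Finset (Fin n) // S.card = k})
    (A : SymTensor H k →L[ℂ] SymTensor H k) (v w : H) :
    inner ℂ (power n v) (actOn S A (power n w))
      = inner ℂ (power k v) (A (power k w)) * inner ℂ v w ^ (n - k) := by
  have e : ∀ u : H, relabel (finSumEquivOfFinset S.2 rfl : Fin k ⊕ Fin S.1ᶜ.card ≃ Fin n).symm
      (power n u : HTensor (Fin n) H) = tmulH (tprodH fun _ => u) (tprodH fun _ => u) := by
    intro u
    rw [coe_power, relabel_tprodH, tmulH_tprodH]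
    congr 1
    funext i
    cases i <;> rfl
  have hc : S.1ᶜ.card = n - k := by rw [Finset.card_compl, Fintype.card_fin, S.2]
  rw [inner_actOn, e, e, ampH_tmulH, inner_tmulH, inner_tprodH (fun _ : Fin S.1ᶜ.card => v),
    Finset.prod_const, Finset.card_univ, Fintype.card_fin, hc]
  congr 1
  simp only [ContinuousLinearMap.comp_apply, ← coe_power, symProj_coe]
  rfl

lemma card_subsets (k n : ℕ) :
    Fintype.card {S : Finset (Fin n) // S.card = k} = n.choose k := by
  rw [Fintype.card_finset_len, Fintype.card_fin]

/-- All binom(n, k) sets contribute equally, which cancels the normalization. As powers are total,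
this formula characterizes A ⊗ₛ 1. -/
lemma inner_power_symTensorOne {k n : ℕ} (hkn : k ≤ n) (A : SymTensor H k →L[ℂ] SymTensor H k)
    (v w : H) : inner ℂ (power n v) (symTensorOne k n A (power n w))
      = inner ℂ (power k v) (A (power k w)) * inner ℂ v w ^ (n - k) := by
  have h0 : (n.choose k : ℂ) ≠ 0 := by exact_mod_cast (Nat.choose_pos hkn).ne'
  simp only [symTensorOne_eq, smul_apply, sum_apply,
    inner_smul_right, inner_sum, inner_power_actOn, Finset.sum_const, Finset.card_univ,
    card_subsets, nsmul_eq_mul]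
  rw [inv_mul_cancel_left₀ h0]

lemma isPositive_symTensorOne (k n : ℕ) {A : SymTensor H k →L[ℂ] SymTensor H k}
    (hA : A.IsPositive) : (symTensorOne k n A).IsPositive := by
  rw [symTensorOne_eq]
  refine ContinuousLinearMap.IsPositive.smul_of_nonneg
    (ContinuousLinearMap.isPositive_sum _ fun S _ => isPositive_actOn S hA) ?_
  rw [← Complex.ofReal_natCast, ← Complex.ofReal_inv]
  exact Complex.zero_le_real.2 (by positivity)

/-- Continuous linear maps out of `⨂ₛⁿ H` are determined by their values on powers. -/
lemma clm_ext_power {n : ℕ} {F : Type*} [NormedAddCommGroup F] [NormedSpace ℂ F]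
    {A B : SymTensor H n →L[ℂ] F} (h : ∀ w, A (power n w) = B (power n w)) : A = B := by
  refine ContinuousLinearMap.ext_on (s := Set.range (power (H := H) n)) ?_ ?_
  · rw [Submodule.dense_iff_topologicalClosure_eq_top]
    exact dense_span_power n
  · rintro _ ⟨w, rfl⟩; exact h w

lemma symTensorOne_self (n : ℕ) (A : SymTensor H n →L[ℂ] SymTensor H n) :
    symTensorOne n n A = A :=
  clm_ext_power fun w => sym_ext fun v => by
    rw [inner_power_symTensorOne le_rfl, Nat.sub_self, pow_zero, mul_one]

variable (H) in
/-- `A ↦ A ⊗ₛ 1` as a linear map. -/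
def symTensorOneL (k n : ℕ) : (SymTensor H k →L[ℂ] SymTensor H k) →ₗ[ℂ]
    (SymTensor H n →L[ℂ] SymTensor H n) where
  toFun := symTensorOne k n
  map_add' A B := by
    simp only [symTensorOne_eq, actOn_add, Finset.sum_add_distrib, smul_add]
  map_smul' c A := by
    simp only [symTensorOne_eq, actOn_smul, ← Finset.smul_sum, RingHom.id_apply]
    rw [smul_comm]

end SymTensorOne


/-! ### Particle sectors of Fock space and a basis adapted to them. -/

section Sectors
variable {H : Type*} [NormedAddCommGroup H] [InnerProductSpace ℂ H]

variable (H) in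
/-- The inclusion of the `n`-particle sector in Fock space. -/
def sec (n : ℕ) : SymTensor H n →L[ℂ] Fock H :=
  lp.singleContinuousLinearMap ℂ (fun n : ℕ => SymTensor H n) 2 n

variable (H) in
/-- The `n`-particle component of a Fock vector. -/
def comp (n : ℕ) : Fock H →L[ℂ] SymTensor H n :=
  lp.evalCLM ℂ (fun n : ℕ => SymTensor H n) 2 n

lemma comp_apply (n : ℕ) (Ψ : Fock H) : comp H n Ψ = Ψ n := rfl

lemma sec_self (n : ℕ) (x : SymTensor H n) : sec H n x n = x :=
  lp.single_apply_self (E := fun n : ℕ => SymTensor H n) 2 n x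

lemma sec_ne {n m : ℕ} (h : m ≠ n) (x : SymTensor H n) : sec H n x m = 0 :=
  lp.single_apply_ne (E := fun n : ℕ => SymTensor H n) 2 n x h

lemma norm_sec (n : ℕ) (x : SymTensor H n) : ‖sec H n x‖ = ‖x‖ :=
  lp.norm_single (E := fun n : ℕ => SymTensor H n) (p := 2) (by norm_num) n x

lemma inner_sec_left (n : ℕ) (x : SymTensor H n) (Ψ : Fock H) :
    inner ℂ (sec H n x) Ψ = inner ℂ x (Ψ n) :=
  lp.inner_single_left (𝕜 := ℂ) (G := fun n : ℕ => SymTensor H n) n x Ψ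

lemma inner_sec_right (n : ℕ) (x : SymTensor H n) (Ψ : Fock H) :
    inner ℂ Ψ (sec H n x) = inner ℂ (Ψ n) x :=
  lp.inner_single_right (𝕜 := ℂ) (G := fun n : ℕ => SymTensor H n) n x Ψ

lemma sec_adjoint (n : ℕ) : (sec H n).adjoint = comp H n :=
  ContinuousLinearMap.ext fun Ψ => ext_inner_left ℂ fun x => by
    rw [ContinuousLinearMap.adjoint_inner_right, inner_sec_left]; rfl

lemma block_eq (G : Fock H →L[ℂ] Fock H) (n : ℕ) : block G n = comp H n ∘L G ∘L sec H n := rfl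

lemma block_adjoint_comp_self {K : Type*} [NormedAddCommGroup K] [InnerProductSpace ℂ K]
    [CompleteSpace K] (S : Fock H →L[ℂ] K) (n : ℕ) :
    block (S.adjoint ∘L S) n = (S ∘L sec H n).adjoint ∘L (S ∘L sec H n) := by
  rw [block_eq, ← sec_adjoint, adjoint_comp_self_comp]

lemma fock_ext {Ψ Φ : Fock H} (h : ∀ n z, inner ℂ (power n z) (Ψ n) = inner ℂ (power n z) (Φ n)) :
    Ψ = Φ :=
  lp.ext (funext fun n => sym_ext (h n))

variable (H) in
/-- The index set of `fockBasis`. -/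
abbrev FockIndex : Type _ := Σ n : ℕ, basisIndex (SymTensor H n)

variable (H) in
/-- The Hilbert basis of Fock space made of bases of the sectors. -/
def fockBasis : HilbertBasis (FockIndex H) ℂ (Fock H) :=
  HilbertBasis.mkOfOrthogonalEqBot (v := fun p => sec H p.1 (hBasis _ p.2)) (by
    classical
    rw [orthonormal_iff_ite]
    rintro ⟨n, i⟩ ⟨m, j⟩
    rw [inner_sec_left]
    by_cases h : n = m
    · subst h
      rw [sec_self, orthonormal_iff_ite.1 (hBasis (SymTensor H n)).orthonormal]
      simp
    · rw [sec_ne h, inner_zero_right, if_neg fun e => h (congrArg Sigma.fst e)]) (by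
    rw [Submodule.eq_bot_iff]
    intro Ψ hΨ
    refine lp.ext (funext fun n => ?_)
    have h : ‖Ψ n‖ₑ ^ 2 = 0 := by
      rw [← tsum_enorm_inner_sq (hBasis (SymTensor H n)), ENNReal.tsum_eq_zero]
      intro i
      rw [← inner_sec_left, hΨ _ (Submodule.subset_span ⟨⟨n, i⟩, rfl⟩)]
      simp
    simpa using h)

lemma fockBasis_apply (p : FockIndex H) :
    fockBasis H p = sec H p.1 (hBasis _ p.2) := by
  rw [fockBasis, HilbertBasis.coe_mkOfOrthogonalEqBot]

/-- The Hilbert–Schmidt norm of an operator on Fock space, sector by sector. -/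
lemma hsNormSq_eq_tsum_sec {K : Type*} [NormedAddCommGroup K] [InnerProductSpace ℂ K]
    [CompleteSpace K] (S : Fock H →L[ℂ] K) : hsNormSq S = ∑' n, hsNormSq (S ∘L sec H n) := by
  rw [hsNormSq_eq_tsum (fockBasis H), ENNReal.tsum_sigma']
  simp only [fockBasis_apply]
  rfl

end Sectors

/-! ### Exponential vectors and Bargmann functions. -/

section Exponential
variable {H : Type*} [NormedAddCommGroup H] [InnerProductSpace ℂ H]

/-- The exponential vector `⨁ₙ u^{⊗n} / √n!`. -/
def expv (u : H) : Fock H := ((Real.exp (‖u‖ ^ 2 / 2) : ℝ) : ℂ) • coherent u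

lemma coherent_eq (u : H) : coherent u = ((Real.exp (-‖u‖ ^ 2 / 2) : ℝ) : ℂ) • expv u := by
  rw [expv, smul_smul, ← Complex.ofReal_mul, ← Real.exp_add]
  simp [neg_div]

lemma expv_apply (u : H) (n : ℕ) :
    expv u n = (((√(n.factorial))⁻¹ : ℝ) : ℂ) • power n u := by
  have h : expv u n = ((Real.exp (‖u‖ ^ 2 / 2) : ℝ) : ℂ) •
    ((Real.exp (-‖u‖ ^ 2 / 2) / √(n.factorial) : ℝ) : ℂ) • power n u := rfl
  rw [h, smul_smul, ← Complex.ofReal_mul, mul_div_assoc', ← Real.exp_add]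
  simp [neg_div]

/-- The `n`-particle part of the (antiholomorphic) Bargmann function of `Ψ`. -/
def symb (n : ℕ) (z : H) (Ψ : Fock H) : ℂ :=
  (((√(n.factorial))⁻¹ : ℝ) : ℂ) * inner ℂ (power n z) (Ψ n)

lemma hasSum_symb (z : H) (Ψ : Fock H) : HasSum (fun n => symb n z Ψ) (inner ℂ (expv z) Ψ) := by
  convert! lp.hasSum_inner (𝕜 := ℂ) (G := fun n : ℕ => SymTensor H n) (expv z) Ψ using 1
  ext n
  rw [expv_apply, inner_smul_left, Complex.conj_ofReal, symb]

lemma inner_expv_expv (u v : H) : inner ℂ (expv u) (expv v) = Complex.exp (inner ℂ u v) := by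
  refine (hasSum_symb u (expv v)).unique ?_
  rw [Complex.exp_eq_exp_ℂ]
  convert! NormedSpace.expSeries_div_hasSum_exp (𝔸 := ℂ) (inner ℂ u v) using 1
  ext n
  rw [symb, expv_apply, inner_smul_right, inner_power_power, ← mul_assoc, ← Complex.ofReal_mul,
    ← mul_inv, Real.mul_self_sqrt (by positivity), div_eq_inv_mul]
  simp

lemma power_smul (n : ℕ) (c : ℂ) (u : H) : power n (c • u) = c ^ n • power n u := by
  refine sym_ext fun z => ?_
  rw [inner_smul_right, inner_power_power, inner_power_power, inner_smul_right, mul_pow]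

/-- Exponential vectors are total in Fock space. -/
lemma eq_zero_of_inner_expv {Ψ : Fock H} (h : ∀ z, inner ℂ (expv z) Ψ = 0) : Ψ = 0 := by
  refine fock_ext fun n z => ?_
  -- The function t ↦ ⟪expv (t̄ z), Ψ⟫ vanishes identically and has the power series ∑ tⁿ `symb n z
  -- Ψ`, so every coefficient is zero. The conjugate offsets the antilinearity in the first slot.
  have h1 : HasFPowerSeriesAt (0 : ℂ → ℂ)
      (FormalMultilinearSeries.ofScalars ℂ fun n => symb n z Ψ) 0 := by
    rw [hasFPowerSeriesAt_iff]
    refine Filter.Eventually.of_forall fun t => ?_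
    have h2 := hasSum_symb (conj t • z) Ψ
    rw [h] at h2
    convert! h2 using 1
    ext m
    rw [FormalMultilinearSeries.coeff_ofScalars, symb, symb, power_smul, inner_smul_left, map_pow,
      Complex.conj_conj, smul_eq_mul]
    ring
  have h3 := congrArg (fun p => FormalMultilinearSeries.coeff p n) h1.eq_zero
  simp only [FormalMultilinearSeries.coeff_ofScalars, symb] at h3
  have h4 : FormalMultilinearSeries.coeff (0 : FormalMultilinearSeries ℂ ℂ ℂ) n = 0 := rfl
  rw [h4] at h3
  rcases mul_eq_zero.1 h3 with h5 | h5
  · exact absurd h5 (by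
      rw [Complex.ofReal_eq_zero]
      positivity)
  · rw [h5]; exact inner_zero_right _ |>.symm

lemma fock_ext_expv {Ψ Φ : Fock H} (h : ∀ z, inner ℂ (expv z) Ψ = inner ℂ (expv z) Φ) : Ψ = Φ := by
  rw [← sub_eq_zero]
  exact eq_zero_of_inner_expv fun z => by rw [inner_sub_right, h, sub_self]

variable (H) in
lemma dense_span_expv : Dense (Submodule.span ℂ (Set.range (expv (H := H))) : Set (Fock H)) := by
  rw [Submodule.dense_iff_topologicalClosure_eq_top, Submodule.topologicalClosure_eq_top_iff,
    Submodule.eq_bot_iff]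
  exact fun Ψ hΨ => eq_zero_of_inner_expv fun z => hΨ _ (Submodule.subset_span ⟨z, rfl⟩)

/-- Continuous linear maps out of Fock space are determined by their values on exponentials. -/
lemma clm_ext_expv {F : Type*} [NormedAddCommGroup F] [NormedSpace ℂ F]
    {A B : Fock H →L[ℂ] F} (h : ∀ w, A (expv w) = B (expv w)) : A = B := by
  refine ContinuousLinearMap.ext_on (s := Set.range (expv (H := H))) (dense_span_expv H) ?_
  rintro _ ⟨w, rfl⟩; exact h w

end Exponential

/-! ### The factorization of Fock space is isometric with dense range. -/

section Product
variable {H : Type*} [NormedAddCommGroup H] [InnerProductSpace ℂ H] {V : Submodule ℂ H}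
  [V.HasOrthogonalProjection]

lemma inner_tprodH_place {N : ℕ} (S : Finset (Fin N)) (z : H) (x : HTensor (Fin S.card) V)
    (y : HTensor (Fin Sᶜ.card) Vᗮ) : inner ℂ (tprodH fun _ => z) (place V S x y)
      = inner ℂ (tprodH fun _ => V.orthogonalProjectionOnto z) x
        * inner ℂ (tprodH fun _ => Vᗮ.orthogonalProjectionOnto z) y := by
  rw [place, ← inner_conj_symm, inner_relabel_left, inner_conj_symm, relabel_tprodH,
    inner_tprodH_tmulH, inner_tprodH_tensorMap, inner_tprodH_tensorMap]

lemma fockMul_apply (Ψ : Fock V) (Φ : Fock Vᗮ) (N : ℕ) : fockMul V Ψ Φ N = sector N Ψ Φ := rfl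

/-- The binom(N, n) subsets of size n contribute equally, each with weight binom(N, n)^{-1/2}, hence
the positive square root. -/
lemma inner_power_fockMul (N : ℕ) (z : H) (Ψ : Fock V) (Φ : Fock Vᗮ) :
    inner ℂ (power N z) (fockMul V Ψ Φ N)
      = ∑ p ∈ Finset.HasAntidiagonal.antidiagonal N, ((√(N.choose p.1) : ℝ) : ℂ)
        * (inner ℂ (power p.1 (V.orthogonalProjectionOnto z)) (Ψ p.1)
          * inner ℂ (power p.2 (Vᗮ.orthogonalProjectionOnto z)) (Φ p.2)) := by
  rw [fockMul_apply, sector, inner_symProj_right, inner_sum, coe_power]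
  simp only [inner_smul_right, inner_tprodH_place]
  have h := Finset.sum_powerset_apply_card (x := (Finset.univ : Finset (Fin N)))
    fun n => (((√(N.choose n))⁻¹ : ℝ) : ℂ)
      * (inner ℂ (power n (V.orthogonalProjectionOnto z)) (Ψ n)
        * inner ℂ (power (N - n) (Vᗮ.orthogonalProjectionOnto z)) (Φ (N - n)))
  rw [Finset.powerset_univ, Finset.card_univ, Fintype.card_fin] at h
  rw [Finset.Nat.sum_antidiagonal_eq_sum_range_succ_mk]
  convert! h using 1
  · refine Finset.sum_congr rfl fun S _ => ?_
    have hc : Sᶜ.card = N - S.card := by rw [Finset.card_compl, Fintype.card_fin]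
    rw [← hc]
    rfl
  · refine Finset.sum_congr rfl fun n hn => ?_
    have h0 : (0 : ℝ) < N.choose n := by
      exact_mod_cast Nat.choose_pos (Nat.lt_succ_iff.1 (Finset.mem_range.1 hn))
    have h1 : ((√(N.choose n : ℝ) : ℝ) : ℂ) = N.choose n * (((√(N.choose n : ℝ))⁻¹ : ℝ) : ℂ) := by
      rw [← Complex.ofReal_natCast, ← Complex.ofReal_mul, ← div_eq_mul_inv, Real.div_sqrt]
    rw [h1, nsmul_eq_mul, mul_assoc]

/-- The factor 1/√n! in `symb` is chosen to absorb the binomial weights: the Bargmann function of a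
product becomes a plain Cauchy product. -/
lemma symb_fockMul (N : ℕ) (z : H) (Ψ : Fock V) (Φ : Fock Vᗮ) :
    symb N z (fockMul V Ψ Φ) = ∑ p ∈ Finset.HasAntidiagonal.antidiagonal N,
      symb p.1 (V.orthogonalProjectionOnto z) Ψ * symb p.2 (Vᗮ.orthogonalProjectionOnto z) Φ := by
  rw [symb, inner_power_fockMul, Finset.mul_sum]
  refine Finset.sum_congr rfl fun p hp => ?_
  have hN : N = p.1 + p.2 := (Finset.HasAntidiagonal.mem_antidiagonal.1 hp).symm
  have h : (√(N.factorial : ℝ))⁻¹ * √(N.choose p.1)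
      = (√(p.1.factorial : ℝ))⁻¹ * (√(p.2.factorial : ℝ))⁻¹ := by
    have h1 : (N.factorial : ℝ) = N.choose p.1 * (p.1.factorial * p.2.factorial) := by
      have h := Nat.choose_mul_factorial_mul_factorial (show p.1 ≤ N by omega)
      rw [show N - p.1 = p.2 by omega, mul_assoc] at h
      exact_mod_cast h.symm
    have h2 : (0 : ℝ) < N.choose p.1 := by
      exact_mod_cast Nat.choose_pos (by omega)
    rw [h1, Real.sqrt_mul h2.le, Real.sqrt_mul (by positivity)]
    have h3 : √(N.choose p.1 : ℝ) ≠ 0 := (Real.sqrt_pos.2 h2).ne'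
    field_simp
  have h' : (((√(N.factorial : ℝ))⁻¹ : ℝ) : ℂ) * ((√(N.choose p.1) : ℝ) : ℂ)
      = (((√(p.1.factorial : ℝ))⁻¹ : ℝ) : ℂ) * (((√(p.2.factorial : ℝ))⁻¹ : ℝ) : ℂ) := by
    exact_mod_cast h
  rw [← mul_assoc, h', symb, symb]
  ring

/-- Summing the Cauchy products over N, with absolute convergence of both series. -/
lemma inner_expv_fockMul (z : H) (Ψ : Fock V) (Φ : Fock Vᗮ) :
    inner ℂ (expv z) (fockMul V Ψ Φ) = inner ℂ (expv (V.orthogonalProjectionOnto z)) Ψ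
      * inner ℂ (expv (Vᗮ.orthogonalProjectionOnto z)) Φ := by
  have h1 := hasSum_symb (V.orthogonalProjectionOnto z) Ψ
  have h2 := hasSum_symb (Vᗮ.orthogonalProjectionOnto z) Φ
  rw [← (hasSum_symb z _).tsum_eq, ← h1.tsum_eq, ← h2.tsum_eq,
    tsum_mul_tsum_eq_tsum_sum_antidiagonal_of_summable_norm h1.summable.norm h2.summable.norm]
  exact tsum_congr fun N => symb_fockMul N z Ψ Φ

lemma fockMul_expv (v : V) (w : Vᗮ) : fockMul V (expv v) (expv w) = expv ((v : H) + w) := by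
  refine fock_ext_expv fun z => ?_
  rw [inner_expv_fockMul, inner_expv_expv, inner_expv_expv, inner_expv_expv, ← Complex.exp_add,
    inner_add_right, Submodule.inner_orthogonalProjectionOnto_eq_of_mem_right,
    Submodule.inner_orthogonalProjectionOnto_eq_of_mem_right]

lemma proj_add (v : V) (w : Vᗮ) : V.orthogonalProjectionOnto ((v : H) + w) = v := by
  rw [map_add, Submodule.orthogonalProjectionOnto_mem_subspace_eq_self,
    Submodule.orthogonalProjectionOnto_eq_zero_iff.2 w.2, add_zero]

lemma proj_orthogonal_add (v : V) (w : Vᗮ) : Vᗮ.orthogonalProjectionOnto ((v : H) + w) = w := by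
  rw [map_add, Submodule.orthogonalProjectionOnto_mem_subspace_eq_self,
    Submodule.orthogonalProjectionOnto_eq_zero_iff.2
      (Submodule.le_orthogonal_orthogonal _ v.2), zero_add]

/-- The factorization of Fock space preserves inner products. -/
lemma inner_fockMul (Ψ Ψ' : Fock V) (Φ Φ' : Fock Vᗮ) :
    inner ℂ (fockMul V Ψ Φ) (fockMul V Ψ' Φ') = inner ℂ Ψ Ψ' * inner ℂ Φ Φ' := by
  have h1 : ∀ (v : V) (w : Vᗮ), inner ℂ (fockMul V Ψ Φ) (fockMul V (expv v) (expv w))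
      = inner ℂ Ψ (expv v) * inner ℂ Φ (expv w) := by
    intro v w
    rw [fockMul_expv, ← inner_conj_symm, inner_expv_fockMul, proj_add, proj_orthogonal_add,
      map_mul, inner_conj_symm, inner_conj_symm]
  -- Exponential vectors being total, the second pair is freed one factor at a time, the one in
  -- F(V⊥) before the one in F(V).
  have h2 : ∀ v : V, innerSL ℂ (fockMul V Ψ Φ) ∘L fockMul V (expv v)
      = inner ℂ Ψ (expv v) • innerSL ℂ Φ := fun v => clm_ext_expv fun w => h1 v w
  have h3 : innerSL ℂ (fockMul V Ψ Φ) ∘L (fockMul V).flip Φ'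
      = inner ℂ Φ Φ' • innerSL ℂ Ψ := clm_ext_expv fun v => by
    refine (DFunLike.congr_fun (h2 v) Φ').trans ?_
    exact mul_comm _ _
  exact (DFunLike.congr_fun h3 Ψ').trans (mul_comm _ _)

lemma besselMul_fockMul : BesselMul (fockMul V) := by
  intro h
  rw [← ENNReal.tsum_prod (f := fun i j => ‖inner ℂ (fockMul V (hBasis _ i) (hBasis _ j)) h‖ₑ ^ 2)]
  exact tsum_enorm_inner_sq_le (orthonormal_of_inner_mul (hBasis (Fock V)).orthonormal
    (hBasis (Fock Vᗮ)).orthonormal (m := fun x y => fockMul V x y)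
    fun x y x' y' => inner_fockMul x x' y y') h

lemma clm_ext_basis_zero {ι F : Type*} [NormedAddCommGroup F] [InnerProductSpace ℂ F]
    (b : HilbertBasis ι ℂ F) {T : F →L[ℂ] ℂ} (hT : ∀ i, T (b i) = 0) : T = 0 := by
  refine ContinuousLinearMap.ext_on (s := Set.range b) ?_ ?_
  · rw [Submodule.dense_iff_topologicalClosure_eq_top]
    exact b.dense_span
  · rintro _ ⟨i, rfl⟩; exact hT i

variable (V) in
/-- The Hilbert basis of `F(H)` made of products of basis vectors of `F(V)` and `F(V⊥)`. -/
def prodBasis : HilbertBasis (FockIndex V × FockIndex Vᗮ) ℂ (Fock H) :=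
  HilbertBasis.mkOfOrthogonalEqBot
    (v := fun p => fockMul V (fockBasis V p.1) (fockBasis Vᗮ p.2))
    (orthonormal_of_inner_mul (fockBasis V).orthonormal (fockBasis Vᗮ).orthonormal
      (m := fun x y => fockMul V x y) fun x y x' y' => inner_fockMul x x' y y') (by
    rw [Submodule.eq_bot_iff]
    intro h hh
    have h1 : ∀ p q, inner ℂ h (fockMul V (fockBasis V p) (fockBasis Vᗮ q)) = 0 := fun p q =>
      (Submodule.mem_orthogonal' _ _).1 hh _ (Submodule.subset_span ⟨(p, q), rfl⟩)
    have h2 : ∀ p Φ, inner ℂ h (fockMul V (fockBasis V p) Φ) = 0 := fun p Φ =>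
      DFunLike.congr_fun (clm_ext_basis_zero (fockBasis Vᗮ)
        (T := innerSL ℂ h ∘L fockMul V (fockBasis V p)) (h1 p)) Φ
    have h3 : ∀ Ψ Φ, inner ℂ h (fockMul V Ψ Φ) = 0 := fun Ψ Φ =>
      DFunLike.congr_fun (clm_ext_basis_zero (fockBasis V) (T := innerSL ℂ h ∘L (fockMul V).flip Φ)
        fun p => h2 p Φ) Ψ
    refine eq_zero_of_inner_expv fun z => ?_
    -- A vector orthogonal to all products is orthogonal to `expv z`, which is the product of the
    -- exponentials of the two projections of `z`.
    have h4 := h3 (expv (V.orthogonalProjectionOnto z)) (expv (Vᗮ.orthogonalProjectionOnto z))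
    rw [fockMul_expv] at h4
    have hz : (V.orthogonalProjectionOnto z : H) + (Vᗮ.orthogonalProjectionOnto z : H) = z :=
      V.starProjection_add_starProjection_orthogonal z
    rw [hz] at h4
    rw [← inner_conj_symm, h4, map_zero])

lemma prodBasis_apply (p : FockIndex V) (q : FockIndex Vᗮ) :
    prodBasis V (p, q) = fockMul V (fockBasis V p) (fockBasis Vᗮ q) := by
  rw [prodBasis, HilbertBasis.coe_mkOfOrthogonalEqBot]

/-- The product of an `n`-particle and an `m`-particle vector is an `n + m`-particle vector. -/
lemma fockMul_sec_ne {n m N : ℕ} (h : N ≠ n + m) (x : SymTensor V n) (y : SymTensor Vᗮ m) :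
    fockMul V (sec V n x) (sec Vᗮ m y) N = 0 := by
  refine sym_ext fun z => ?_
  rw [inner_power_fockMul, inner_zero_right]
  refine Finset.sum_eq_zero fun p hp => ?_
  have hN := Finset.HasAntidiagonal.mem_antidiagonal.1 hp
  by_cases h1 : p.1 = n
  · have h2 : p.2 ≠ m := by omega
    rw [sec_ne h2, inner_zero_right, mul_zero, mul_zero]
  · rw [sec_ne h1, inner_zero_right, zero_mul, mul_zero]

end Product


/-! ### Bosonic multiplication by a symmetric tensor. -/

section Create
variable {H : Type*} [NormedAddCommGroup H] [InnerProductSpace ℂ H]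

/-- The bosonic multiplication `y ↦ binom(k + m, k)^{1/2} x ⊗ₛ y` by `x ∈ ⨂ₛᵏ H`. -/
def create {k : ℕ} (m : ℕ) (x : SymTensor H k) : SymTensor H m →L[ℂ] Fock H :=
  ((√((k + m).choose k) : ℝ) : ℂ) •
    (sec H (k + m) ∘L symMul H k m x ∘L (SymTensor H m).subtypeL)

lemma create_apply {k m : ℕ} (x : SymTensor H k) (y : SymTensor H m) :
    create m x y = ((√((k + m).choose k) : ℝ) : ℂ) • sec H (k + m) (symMul H k m x y) := rfl

lemma symb_sec_self (n : ℕ) (z : H) (x : SymTensor H n) :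
    symb n z (sec H n x) = (((√(n.factorial))⁻¹ : ℝ) : ℂ) * inner ℂ (power n z) x := by
  rw [symb, sec_self]

lemma symb_eq_zero {n : ℕ} (z : H) {Ψ : Fock H} (h : Ψ n = 0) : symb n z Ψ = 0 := by
  rw [symb, h, inner_zero_right, mul_zero]

lemma fock_smul_apply (c : ℂ) (Ψ : Fock H) (n : ℕ) : (c • Ψ) n = c • Ψ n := rfl

lemma create_ne {k m N : ℕ} (h : N ≠ k + m) (x : SymTensor H k) (y : SymTensor H m) :
    create m x y N = 0 := by
  rw [create_apply, fock_smul_apply, sec_ne h, smul_zero]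

/-- The binomial square root in `create` is the weight that makes Bargmann functions multiply. -/
lemma symb_create {k m : ℕ} (z : H) (x : SymTensor H k) (y : SymTensor H m) :
    symb (k + m) z (create m x y) = symb k z (sec H k x) * symb m z (sec H m y) := by
  have e : create m x y (k + m)
      = ((√((k + m).choose k) : ℝ) : ℂ) • symMul H k m x y := by
    rw [create_apply, fock_smul_apply, sec_self]
  rw [symb, e, inner_smul_right, inner_power_symMul, symb_sec_self, symb_sec_self]
  have h : (√((k + m).factorial : ℝ))⁻¹ * √((k + m).choose k)
      = (√(k.factorial : ℝ))⁻¹ * (√(m.factorial : ℝ))⁻¹ := by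
    have h1 : ((k + m).factorial : ℝ) = (k + m).choose k * (k.factorial * m.factorial) := by
      have h := Nat.choose_mul_factorial_mul_factorial (show k ≤ k + m by omega)
      rw [Nat.add_sub_cancel_left, mul_assoc] at h
      exact_mod_cast h.symm
    have h2 : (0 : ℝ) < (k + m).choose k := by
      exact_mod_cast Nat.choose_pos (by omega)
    rw [h1, Real.sqrt_mul h2.le, Real.sqrt_mul (by positivity)]
    have h3 : √((k + m).choose k : ℝ) ≠ 0 := (Real.sqrt_pos.2 h2).ne'
    field_simp
  have h' : (((√((k + m).factorial : ℝ))⁻¹ : ℝ) : ℂ) * ((√((k + m).choose k) : ℝ) : ℂ)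
      = (((√(k.factorial : ℝ))⁻¹ : ℝ) : ℂ) * (((√(m.factorial : ℝ))⁻¹ : ℝ) : ℂ) := by
    exact_mod_cast h
  rw [← mul_assoc, h', ← coe_power, ← Submodule.coe_inner]
  ring

lemma fock_ext_symb {Ψ Φ : Fock H} (h : ∀ n z, symb n z Ψ = symb n z Φ) : Ψ = Φ := by
  refine fock_ext fun n z => mul_left_cancel₀ ?_ (h n z)
  rw [Ne, Complex.ofReal_eq_zero]
  positivity

lemma create_smul {k m : ℕ} (c : ℂ) (x : SymTensor H k) :
    create m (c • x) = c • create m x := by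
  refine ContinuousLinearMap.ext fun y => ?_
  rw [smul_apply, create_apply, create_apply, map_smul, smul_apply, map_smul, smul_comm]

lemma create_add {k m : ℕ} (x x' : SymTensor H k) :
    create m (x + x') = create m x + create m x' := by
  refine ContinuousLinearMap.ext fun y => ?_
  rw [add_apply, create_apply, create_apply, create_apply, map_add, add_apply, map_add, smul_add]

lemma norm_symMul_le {k m : ℕ} (x : SymTensor H k) (y : HTensor (Fin m) H) :
    ‖symMul H k m x y‖ ≤ ‖x‖ * ‖y‖ := by
  have e : symMul H k m x y
      = symProj (k + m) (relabel finSumFinEquiv (tmulH (x : HTensor (Fin k) H) y)) := rfl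
  have h : ‖tmulH (x : HTensor (Fin k) H) y‖ ^ 2 = (‖x‖ * ‖y‖) ^ 2 := by
    have h1 := inner_tmulH (x : HTensor (Fin k) H) x y y
    simp only [inner_self_eq_norm_sq_to_K] at h1
    rw [mul_pow]
    exact_mod_cast h1
  rw [e, ← (sq_eq_sq₀ (norm_nonneg _) (by positivity)).1 h]
  exact ((SymTensor H (k + m)).norm_orthogonalProjectionOnto_apply_le _).trans_eq
    (LinearIsometry.norm_map _ _)

end Create

/-! ### Density matrices as quadratic forms. -/

section Density
variable {H : Type*} [NormedAddCommGroup H] [InnerProductSpace ℂ H]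
variable {K : Type*} [NormedAddCommGroup K] [InnerProductSpace ℂ K] [CompleteSpace K]

lemma hsNormSq_smul {E F : Type*} [NormedAddCommGroup E] [InnerProductSpace ℂ E] [CompleteSpace E]
    [NormedAddCommGroup F] [InnerProductSpace ℂ F] [CompleteSpace F] (c : ℂ) (T : E →L[ℂ] F) :
    hsNormSq (c • T) = ‖c‖ₑ ^ 2 * hsNormSq T := by
  simp only [hsNormSq, smul_apply, enorm_smul, mul_pow, ENNReal.tsum_mul_left]

/-- The partial trace runs over all of `⨂ᵐ H`, whereas `create` acts on symmetric tensors only. The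
norms agree because `symMul` sees only the symmetric part of its second argument. -/
lemma hsNormSq_create (S : Fock H →L[ℂ] K) {k : ℕ} (m : ℕ) (x : SymTensor H k) :
    hsNormSq (S ∘L create m x)
      = (k + m).choose k * hsNormSq ((S ∘L sec H (k + m)) ∘L symMul H k m x) := by
  have h1 : S ∘L create m x = ((√((k + m).choose k) : ℝ) : ℂ) •
      (((S ∘L sec H (k + m)) ∘L symMul H k m x) ∘L (SymTensor H m).subtypeL) := by
    rw [create, ContinuousLinearMap.comp_smul]
    rfl
  have h2 : (S ∘L sec H (k + m)) ∘L symMul H k m x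
      = (((S ∘L sec H (k + m)) ∘L symMul H k m x) ∘L (SymTensor H m).subtypeL) ∘L
        (SymTensor H m).subtypeL.adjoint := by
    rw [subtypeL_adjoint]
    refine ContinuousLinearMap.ext fun y => ?_
    simp only [ContinuousLinearMap.comp_apply, Submodule.subtypeL_apply, symMul_symProj]
  rw [h1, hsNormSq_smul, h2, hsNormSq_comp_coisometry _ (fun x => rfl)]
  congr 1
  · rw [enorm_sq_eq_ofReal, Complex.norm_real, Real.norm_of_nonneg (Real.sqrt_nonneg _),
      Real.sq_sqrt (by positivity), ENNReal.ofReal_natCast]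
  · rw [← h2]

lemma hsNormSq_comp_sec_le (S : Fock H →L[ℂ] K) (n : ℕ) :
    hsNormSq (S ∘L sec H n) ≤ hsNormSq S := by
  rw [hsNormSq_eq_tsum_sec S]
  exact ENNReal.le_tsum (f := fun n => hsNormSq (S ∘L sec H n)) n

variable {S : Fock H →L[ℂ] K}

/-- The quadratic form of the terms of the density matrix series. -/
lemma inner_densityTerm (hS : hsNormSq S ≠ ⊤) {k : ℕ} (m : ℕ) (x : SymTensor H k) :
    hsNormSq (S ∘L create m x) ≠ ⊤ ∧ inner ℂ x (densityTerm (S.adjoint ∘L S) k m x)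
      = ((hsNormSq (S ∘L create m x)).toReal : ℂ) := by
  have hS' := ne_top_of_le_ne_top hS (hsNormSq_comp_sec_le S (k + m))
  obtain ⟨h1, h2⟩ := inner_partialTrace_self (besselMul_symMul k m) hS' x
  rw [hsNormSq_create]
  refine ⟨ENNReal.mul_ne_top (ENNReal.natCast_ne_top _) h1, ?_⟩
  rw [densityTerm, block_adjoint_comp_self, smul_apply, inner_smul_right, h2, ENNReal.toReal_mul,
    ENNReal.toReal_natCast]
  push_cast
  rfl

lemma isPositive_densityTerm (hS : hsNormSq S ≠ ⊤) (k m : ℕ) :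
    (densityTerm (S.adjoint ∘L S) k m).IsPositive :=
  isPositive_of_inner_ofReal (fun _ => ENNReal.toReal_nonneg)
    fun x => (inner_densityTerm hS m x).2

/-- The operator norm of `symMul H k m x` is at most `‖x‖`, so the trace of the block controls the
term. -/
lemma inner_densityTerm_le (hS : hsNormSq S ≠ ⊤) {k : ℕ} (m : ℕ) (x : SymTensor H k) :
    (inner ℂ x (densityTerm (S.adjoint ∘L S) k m x)).re
      ≤ ((k + m).choose k * hsNormSq (S ∘L sec H (k + m))).toReal * ‖x‖ ^ 2 := by
  have hS' := ne_top_of_le_ne_top hS (hsNormSq_comp_sec_le S (k + m))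
  rw [(inner_densityTerm hS m x).2, Complex.ofReal_re, hsNormSq_create, ENNReal.toReal_mul,
    ENNReal.toReal_mul, mul_assoc]
  refine mul_le_mul_of_nonneg_left ?_ ENNReal.toReal_nonneg
  rw [mul_comm, ← ENNReal.toReal_ofReal (sq_nonneg ‖x‖), ← ENNReal.toReal_mul]
  refine ENNReal.toReal_mono (ENNReal.mul_ne_top ENNReal.ofReal_ne_top hS') ?_
  refine (hsNormSq_comp_le_right _ _).trans ?_
  gcongr
  rw [enorm_sq_eq_ofReal]
  refine ENNReal.ofReal_le_ofReal (pow_le_pow_left₀ (norm_nonneg _) ?_ 2)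
  exact ContinuousLinearMap.opNorm_le_bound _ (norm_nonneg _) fun y => norm_symMul_le x y

lemma numberMoment_eq (S : Fock H →L[ℂ] K) (k : ℕ) :
    numberMoment (S.adjoint ∘L S) k = ∑' n : ℕ, (n : ℝ≥0∞) ^ k * hsNormSq (S ∘L sec H n) := by
  simp only [numberMoment, block_adjoint_comp_self, posTrace_adjoint_comp_self]

/-- The added 1 is needed only at n = 0, where `0.choose 0 = 1` while `0 ^ k` may vanish. -/
lemma choose_le_pow_add_one (n : ℕ) {l k : ℕ} (h : l ≤ k) : n.choose l ≤ n ^ k + 1 := by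
  rcases Nat.eq_zero_or_pos n with rfl | hn
  · exact (by cases l <;> simp : (0 : ℕ).choose l ≤ 1).trans (Nat.le_add_left _ _)
  · exact (Nat.choose_le_pow n l).trans ((Nat.pow_le_pow_right hn h).trans (Nat.le_succ _))

lemma summable_of_isPositive {E : Type*} [NormedAddCommGroup E] [InnerProductSpace ℂ E]
    [CompleteSpace E] {A : ℕ → E →L[ℂ] E} {g : ℕ → ℝ} (hA : ∀ m, (A m).IsPositive)
    (h : ∀ m x, (inner ℂ x (A m x)).re ≤ g m * ‖x‖ ^ 2) (hg0 : ∀ m, 0 ≤ g m) (hg : Summable g) :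
    Summable A :=
  Summable.of_norm_bounded hg fun m => norm_le_of_isPositive (hA m) (hg0 m) (h m)

/-- The norm of the term with n = l + m is at most binom(n, l) tr Gₙ ≤ (nᵏ + 1) tr Gₙ, whose sum is
the k-th moment plus the trace. -/
lemma summable_densityTerm (hS : hsNormSq S ≠ ⊤) {k : ℕ}
    (hk : numberMoment (S.adjoint ∘L S) k ≠ ⊤) {l : ℕ} (hl : l ≤ k) :
    Summable fun m => densityTerm (S.adjoint ∘L S) l m := by
  have h1 : ∑' n : ℕ, ((n : ℝ≥0∞) ^ k + 1) * hsNormSq (S ∘L sec H n) ≠ ⊤ := by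
    simp_rw [add_mul, one_mul]
    rw [ENNReal.tsum_add, ← numberMoment_eq, ← hsNormSq_eq_tsum_sec]
    exact ENNReal.add_ne_top.2 ⟨hk, hS⟩
  have h2 : ∑' m : ℕ, ((l + m).choose l : ℝ≥0∞) * hsNormSq (S ∘L sec H (l + m)) ≠ ⊤ := by
    refine ne_top_of_le_ne_top h1 (le_trans (ENNReal.tsum_le_tsum fun m => ?_)
      (ENNReal.tsum_comp_le_tsum_of_injective (add_right_injective l)
        fun n : ℕ => ((n : ℝ≥0∞) ^ k + 1) * hsNormSq (S ∘L sec H n)))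
    refine mul_le_mul_left ?_ _
    exact_mod_cast choose_le_pow_add_one (l + m) hl
  have h3 := ENNReal.summable_toReal h2
  exact summable_of_isPositive (isPositive_densityTerm hS l) (inner_densityTerm_le hS)
    (fun _ => ENNReal.toReal_nonneg) h3

end Density

/-! ### Series of positive operators in finite dimension. -/

section FiniteDimensionalSums
variable {E : Type*} [NormedAddCommGroup E] [InnerProductSpace ℂ E] [CompleteSpace E]

/-- On a finite-dimensional space, a weakly convergent series of positive operators converges. -/
lemma hasSum_of_isPositive [FiniteDimensional ℂ E] {ι : Type*} {A : ι → E →L[ℂ] E} {B : E →L[ℂ] E}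
    (hA : ∀ i, (A i).IsPositive)
    (h : ∀ x, HasSum (fun i => inner ℂ x (A i x)) (inner ℂ x (B x))) : HasSum A B := by
  have := Fintype.ofFinite (basisIndex E)
  have h1 : Summable A := by
    -- The norm of a positive operator is at most its trace, and the traces are summable, being
    -- finite sums of diagonal elements.
    refine Summable.of_norm_bounded
      (g := fun i => ∑ j, (inner ℂ (hBasis E j) (A i (hBasis E j))).re)
      (summable_sum fun j _ => (Complex.hasSum_re (h (hBasis E j))).summable) fun i => ?_
    obtain ⟨S, hS⟩ := exists_adjoint_comp_self (hA i)
    have h2 := enorm_sq_le_hsNormSq S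
    rw [hsNormSq, tsum_fintype, enorm_sq_eq_ofReal] at h2
    simp only [enorm_sq_eq_ofReal] at h2
    rw [← ENNReal.ofReal_sum_of_nonneg fun _ _ => by positivity,
      ENNReal.ofReal_le_ofReal_iff (Finset.sum_nonneg fun _ _ => by positivity)] at h2
    rw [hS, norm_adjoint_comp_self]
    simpa only [inner_adjoint_comp_self_self, Complex.ofReal_re] using h2
  have h2 : ∑' i, A i = B := clm_ext_inner fun x =>
    (((innerSL ℂ x).hasSum (h1.hasSum.mapL (ContinuousLinearMap.apply ℂ E x))).unique (h x))
  rw [← h2]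
  exact h1.hasSum

end FiniteDimensionalSums

/-! ### Localization: trace, number moments and density matrices. -/

section Localization
variable {H : Type*} [NormedAddCommGroup H] [InnerProductSpace ℂ H] {V : Submodule ℂ H}
  [V.HasOrthogonalProjection]
variable {K L : Type*} [NormedAddCommGroup K] [InnerProductSpace ℂ K] [CompleteSpace K]
  [NormedAddCommGroup L] [InnerProductSpace ℂ L] [CompleteSpace L]

lemma symb_fockMul_of_sector {n m : ℕ} (z : H) {Ψ : Fock V} {Φ : Fock Vᗮ}
    (hΨ : ∀ N, N ≠ n → Ψ N = 0) (hΦ : ∀ N, N ≠ m → Φ N = 0) :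
    symb (n + m) z (fockMul V Ψ Φ) = symb n (V.orthogonalProjectionOnto z) Ψ
      * symb m (Vᗮ.orthogonalProjectionOnto z) Φ := by
  rw [symb_fockMul, Finset.sum_eq_single (n, m)]
  · intro p hp hne
    have hN := Finset.HasAntidiagonal.mem_antidiagonal.1 hp
    by_cases h1 : p.1 = n
    · have h2 : p.2 ≠ m := fun h => hne (Prod.ext h1 h)
      rw [symb_eq_zero _ (hΦ _ h2), mul_zero]
    · rw [symb_eq_zero _ (hΨ _ h1), zero_mul]
  · intro h
    exact absurd (Finset.HasAntidiagonal.mem_antidiagonal.2 (show n + m = n + m from rfl)) h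

lemma fockMul_ne_of_sector {n m N : ℕ} (hN : N ≠ n + m) {Ψ : Fock V} {Φ : Fock Vᗮ}
    (hΨ : ∀ N, N ≠ n → Ψ N = 0) (hΦ : ∀ N, N ≠ m → Φ N = 0) : fockMul V Ψ Φ N = 0 := by
  refine sym_ext fun z => ?_
  rw [inner_power_fockMul, inner_zero_right]
  refine Finset.sum_eq_zero fun p hp => ?_
  have hp := Finset.HasAntidiagonal.mem_antidiagonal.1 hp
  by_cases h1 : p.1 = n
  · have h2 : p.2 ≠ m := by omega
    rw [hΦ _ h2, inner_zero_right, mul_zero, mul_zero]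
  · rw [hΨ _ h1, inner_zero_right, zero_mul, mul_zero]

/-- Multiplication by `x ∈ ⨂ₛᵏ V` commutes with the factorization of Fock space. -/
lemma fockMul_create {k m p : ℕ} (x : SymTensor V k) (y : SymTensor V m) (b : SymTensor Vᗮ p) :
    fockMul V (create m x y) (sec Vᗮ p b) = create (m + p) (symIncl V k x)
      (fockMul V (sec V m y) (sec Vᗮ p b) (m + p)) := by
  have hc : ∀ N, N ≠ k + m → create m x y N = 0 := fun N h => create_ne h x y
  have hb : ∀ N, N ≠ p → sec Vᗮ p b N = 0 := fun N h => sec_ne h b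
  have hy : ∀ N, N ≠ m → sec V m y N = 0 := fun N h => sec_ne h y
  refine fock_ext_symb fun N z => ?_
  by_cases hN : N = k + m + p
  · subst hN
    have e : symb (k + m + p) z (create (m + p) (symIncl V k x)
        (fockMul V (sec V m y) (sec Vᗮ p b) (m + p)))
      = symb (k + (m + p)) z (create (m + p) (symIncl V k x)
        (fockMul V (sec V m y) (sec Vᗮ p b) (m + p))) := by rw [add_assoc]
    rw [e, symb_create, symb_fockMul_of_sector z hc hb, symb_create, mul_assoc]
    have e2 : symb (m + p) z (sec H (m + p) (fockMul V (sec V m y) (sec Vᗮ p b) (m + p)))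
        = symb (m + p) z (fockMul V (sec V m y) (sec Vᗮ p b)) := by
      rw [symb_sec_self, symb]
    rw [e2, symb_fockMul_of_sector z hy hb]
    congr 1
    rw [symb_sec_self, symb_sec_self, inner_power_symIncl]
  · rw [symb_eq_zero _ (fockMul_ne_of_sector hN hc hb),
      symb_eq_zero _ (create_ne (by omega) _ _)]

variable {S : Fock H →L[ℂ] K} {T : Fock V →L[ℂ] L}

lemma isPositive_localization (hS : hsNormSq S ≠ ⊤) :
    (localization V (S.adjoint ∘L S)).IsPositive :=
  isPositive_partialTrace besselMul_fockMul hS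

/-- The link between the factors of Γ and of Γ_V: tracing out V⊥ sums the squares of S over the
products of Ψ with a basis of F(V⊥). -/
lemma enorm_sq_localization (hS : hsNormSq S ≠ ⊤)
    (hT : localization V (S.adjoint ∘L S) = T.adjoint ∘L T) (Ψ : Fock V) :
    ‖T Ψ‖ₑ ^ 2 = hsNormSq (S ∘L fockMul V Ψ) := by
  obtain ⟨h1, h2⟩ := inner_partialTrace_self besselMul_fockMul hS Ψ
  have h3 : inner ℂ Ψ ((T.adjoint ∘L T) Ψ) = ((hsNormSq (S ∘L fockMul V Ψ)).toReal : ℂ) := by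
    rw [← hT]; exact h2
  rw [inner_adjoint_comp_self_self] at h3
  rw [enorm_sq_eq_ofReal, Complex.ofReal_inj.1 h3, ENNReal.ofReal_toReal h1]

/-- Localization preserves the trace because products of basis vectors form a Hilbert basis of F(H).
-/
lemma hsNormSq_localization (hS : hsNormSq S ≠ ⊤)
    (hT : localization V (S.adjoint ∘L S) = T.adjoint ∘L T) : hsNormSq T = hsNormSq S := by
  rw [hsNormSq_eq_tsum (prodBasis V), ENNReal.tsum_prod', hsNormSq_eq_tsum (fockBasis V)]
  refine tsum_congr fun p => ?_
  rw [enorm_sq_localization hS hT, hsNormSq_eq_tsum (fockBasis Vᗮ)]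
  simp only [prodBasis_apply]
  rfl

lemma prodBasis_ne (p : FockIndex V) (q : FockIndex Vᗮ) {N : ℕ} (hN : N ≠ p.1 + q.1) :
    prodBasis V (p, q) N = 0 := by
  rw [prodBasis_apply, fockBasis_apply, fockBasis_apply]
  exact fockMul_sec_ne hN _ _

set_option maxHeartbeats 1000000 in
/-- Invariance of the quadratic forms of density matrices under localization. -/
lemma tsum_hsNormSq_create_localization (hS : hsNormSq S ≠ ⊤)
    (hT : localization V (S.adjoint ∘L S) = T.adjoint ∘L T) {k : ℕ} (x : SymTensor V k) :
    ∑' m, hsNormSq (T ∘L create m x) = ∑' n, hsNormSq (S ∘L create n (symIncl V k x)) := by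
  have h1 : ∀ n, hsNormSq (S ∘L create n (symIncl V k x))
      = ∑' p, ∑' q, ‖S (create n (symIncl V k x) (prodBasis V (p, q) n))‖ₑ ^ 2 := by
    intro n
    -- The operator on one sector is extended by zero to all of F(H), so that the product basis may
    -- be used.
    rw [← hsNormSq_comp_coisometry (sec H n) (norm_sec n), sec_adjoint,
      hsNormSq_eq_tsum (prodBasis V), ENNReal.tsum_prod']
    rfl
  have h2 : ∑' m, hsNormSq (T ∘L create m x) = ∑' p : FockIndex V, ∑' q : FockIndex Vᗮ,
      ‖S (fockMul V (create p.1 x (hBasis _ p.2)) (fockBasis Vᗮ q))‖ₑ ^ 2 := by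
    rw [ENNReal.tsum_sigma']
    refine tsum_congr fun m => ?_
    rw [hsNormSq]
    refine tsum_congr fun i => ?_
    rw [ContinuousLinearMap.comp_apply, enorm_sq_localization hS hT,
      hsNormSq_eq_tsum (fockBasis Vᗮ)]
    rfl
  simp_rw [h1]
  refine h2.trans (Eq.symm ?_)
  rw [ENNReal.tsum_comm]
  refine tsum_congr fun p => ?_
  rw [ENNReal.tsum_comm]
  refine tsum_congr fun q => ?_
  -- The product vector indexed by (p, q) lies in the sector with `p.1 + q.1` particles, so only
  -- this n contributes; there `fockMul_create` identifies the two sides.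
  rw [tsum_eq_single (p.1 + q.1)]
  · rw [fockBasis_apply, fockMul_create, prodBasis_apply, fockBasis_apply, fockBasis_apply]
  · intro n hn
    rw [prodBasis_ne p q hn]
    simp

/-- Product basis vectors have a definite particle number, the sum of the numbers in V and in V⊥. -/
lemma numberMoment_eq_prodBasis (S : Fock H →L[ℂ] K) (k : ℕ) :
    numberMoment (S.adjoint ∘L S) k = ∑' p : FockIndex V, ∑' q : FockIndex Vᗮ,
      ((p.1 + q.1 : ℕ) : ℝ≥0∞) ^ k * ‖S (prodBasis V (p, q))‖ₑ ^ 2 := by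
  have h1 : ∀ n, hsNormSq (S ∘L sec H n)
      = ∑' p, ∑' q, ‖S (sec H n (prodBasis V (p, q) n))‖ₑ ^ 2 := by
    intro n
    rw [← hsNormSq_comp_coisometry (sec H n) (norm_sec n), sec_adjoint,
      hsNormSq_eq_tsum (prodBasis V), ENNReal.tsum_prod']
    rfl
  rw [numberMoment_eq]
  simp_rw [h1, ← ENNReal.tsum_mul_left]
  rw [ENNReal.tsum_comm]
  refine tsum_congr fun p => ?_
  rw [ENNReal.tsum_comm]
  refine tsum_congr fun q => ?_
  have h2 : sec H (p.1 + q.1) (prodBasis V (p, q) (p.1 + q.1)) = prodBasis V (p, q) := by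
    refine lp.ext (funext fun N => ?_)
    by_cases hN : N = p.1 + q.1
    · subst hN; rw [sec_self]
    · rw [sec_ne hN, prodBasis_ne p q hN]
  rw [tsum_eq_single (p.1 + q.1), h2]
  intro n hn
  rw [prodBasis_ne p q hn]
  simp

/-- Localization does not increase the moments of the particle number. -/
lemma numberMoment_localization_le (hS : hsNormSq S ≠ ⊤)
    (hT : localization V (S.adjoint ∘L S) = T.adjoint ∘L T) (k : ℕ) :
    numberMoment (T.adjoint ∘L T) k ≤ numberMoment (S.adjoint ∘L S) k := by
  have h1 : numberMoment (T.adjoint ∘L T) k = ∑' p : FockIndex V, ∑' q : FockIndex Vᗮ,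
      (p.1 : ℝ≥0∞) ^ k * ‖S (prodBasis V (p, q))‖ₑ ^ 2 := by
    rw [numberMoment_eq, ENNReal.tsum_sigma']
    refine tsum_congr fun n => ?_
    rw [hsNormSq, ← ENNReal.tsum_mul_left]
    refine tsum_congr fun i => ?_
    rw [ContinuousLinearMap.comp_apply, enorm_sq_localization hS hT,
      hsNormSq_eq_tsum (fockBasis Vᗮ), ← ENNReal.tsum_mul_left]
    refine tsum_congr fun q => ?_
    rw [prodBasis_apply, fockBasis_apply ⟨n, i⟩]
    rfl
  rw [h1, numberMoment_eq_prodBasis (V := V)]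
  -- Termwise comparison: the number of particles in V is at most the total number.
  refine ENNReal.tsum_le_tsum fun p => ENNReal.tsum_le_tsum fun q => ?_
  gcongr
  omega

lemma inner_compress {n : ℕ} (A : SymTensor H n →L[ℂ] SymTensor H n) (x : SymTensor V n) :
    inner ℂ x (compress V A x) = inner ℂ (symIncl V n x) (A (symIncl V n x)) := by
  rw [compress, ContinuousLinearMap.comp_apply, ContinuousLinearMap.adjoint_inner_right]
  rfl

lemma hasSum_toReal {ι : Type*} {f : ι → ℝ≥0∞} (h : ∑' i, f i ≠ ⊤) :
    HasSum (fun i => (f i).toReal) (∑' i, f i).toReal := by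
  rw [ENNReal.tsum_toReal_eq (ENNReal.ne_top_of_tsum_ne_top h)]
  exact (ENNReal.summable_toReal h).hasSum

/-- The density matrices of the localized state are the compressed ones. -/
lemma hasSum_compress_densityTerm [FiniteDimensional ℂ V] (hS : hsNormSq S ≠ ⊤)
    (hT : localization V (S.adjoint ∘L S) = T.adjoint ∘L T) {k : ℕ}
    (hs : Summable fun m => densityTerm (T.adjoint ∘L T) k m) :
    HasSum (fun m => compress V (densityTerm (S.adjoint ∘L S) k m))
      (densityMatrix (T.adjoint ∘L T) k) := by
  have hT' : hsNormSq T ≠ ⊤ := by rwa [hsNormSq_localization hS hT]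
  refine hasSum_of_isPositive (fun m => ?_) fun x => ?_
  · exact (isPositive_densityTerm hS k m).adjoint_conj _
  · have h1 : HasSum (fun m => ((hsNormSq (T ∘L create m x)).toReal : ℂ))
        (inner ℂ x (densityMatrix (T.adjoint ∘L T) k x)) := by
      have := (innerSL ℂ x).hasSum (hs.hasSum.mapL (ContinuousLinearMap.apply ℂ _ x))
      convert! this using 1
      ext m
      exact (inner_densityTerm hT' m x).2.symm
    -- Finiteness comes from the localized side, where the density matrix series converges by
    -- assumption. The equality of the two sums in [0, ∞] then transfers it to the compressed
    -- series, without any moment bound on Γ itself.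
    have h2 : ∑' m, hsNormSq (T ∘L create m x) ≠ ⊤ := by
      have h3 := (Complex.hasSum_re h1).summable
      simp only [Complex.ofReal_re] at h3
      have h4 := ENNReal.ofReal_tsum_of_nonneg (fun _ => ENNReal.toReal_nonneg) h3
      simp only [ENNReal.ofReal_toReal (inner_densityTerm hT' _ x).1] at h4
      rw [← h4]
      exact ENNReal.ofReal_ne_top
    have h3 : inner ℂ x (densityMatrix (T.adjoint ∘L T) k x)
        = ((∑' m, hsNormSq (T ∘L create m x)).toReal : ℂ) :=
      h1.unique (Complex.hasSum_ofReal.2 (hasSum_toReal h2))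
    rw [h3, tsum_hsNormSq_create_localization hS hT]
    rw [tsum_hsNormSq_create_localization hS hT] at h2
    convert! Complex.hasSum_ofReal.2 (hasSum_toReal h2) using 1
    ext m
    rw [inner_compress, (inner_densityTerm hS m _).2]

end Localization


/-! ### Coefficients of products of powers of linear polynomials. -/

section BinomialPolynomials
open Polynomial

lemma coeff_linear_pow (a b : ℂ) (k i : ℕ) :
    ((C a * X + C b) ^ k).coeff i = a ^ i * b ^ (k - i) * k.choose i := by
  rw [add_pow, finsetSum_coeff]
  have h : ∀ m, ((C a * X) ^ m * C b ^ (k - m) * (k.choose m : ℂ[X])).coeff i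
      = if i = m then a ^ m * b ^ (k - m) * k.choose m else 0 := by
    intro m
    have : (C a * X) ^ m * C b ^ (k - m) * (k.choose m : ℂ[X])
        = C (a ^ m * b ^ (k - m) * k.choose m) * X ^ m := by
      rw [mul_pow]
      simp only [map_mul, map_pow, map_natCast]
      ring
    rw [this, coeff_C_mul_X_pow]
  simp only [h]
  rw [Finset.sum_ite_eq]
  split_ifs with hi
  · rfl
  · rw [Nat.choose_eq_zero_of_lt (by simpa using hi)]; simp

lemma coeff_linear_pow_mul (a b c d : ℂ) (k n : ℕ) :
    ((C a * X + C b) ^ k * (C c * X + C d) ^ n).coeff k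
      = ∑ l ∈ Finset.range (k + 1), (k.choose l : ℂ) * n.choose l
        * (a ^ (k - l) * b ^ l * c ^ l * d ^ (n - l)) := by
  -- After reflection, `l` counts the factors X taken from the second power, and `k - l` those taken
  -- from the first.
  rw [coeff_mul, Finset.Nat.sum_antidiagonal_eq_sum_range_succ_mk, ← Finset.sum_range_reflect]
  refine Finset.sum_congr rfl fun l hl => ?_
  have hl' : l ≤ k := Nat.lt_succ_iff.1 (Finset.mem_range.1 hl)
  have e : k + 1 - 1 - l = k - l := by omega
  simp only [e, coeff_linear_pow]
  rw [Nat.sub_sub_self hl', Nat.choose_symm hl']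
  ring

/-- Two polynomial functions that agree have the same coefficients. -/
lemma coeff_eq_of_forall_sum {N : ℕ} {d : ℕ → ℂ} {Q : ℂ[X]}
    (h : ∀ t : ℂ, ∑ i ∈ Finset.range (N + 1), t ^ i * d i = Q.eval t) {k : ℕ} (hk : k ≤ N) :
    d k = Q.coeff k := by
  have e : ∑ i ∈ Finset.range (N + 1), C (d i) * X ^ i = Q := by
    refine Polynomial.funext fun t => ?_
    rw [← h, eval_finsetSum]
    refine Finset.sum_congr rfl fun i _ => ?_
    rw [eval_mul, eval_C, eval_pow, eval_X, mul_comm]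
  rw [← e, finsetSum_coeff]
  simp only [coeff_C_mul_X_pow]
  rw [Finset.sum_ite_eq, if_pos (Finset.mem_range.2 (by omega))]

end BinomialPolynomials

/-! ### Wick's formula for powers. -/

section PowerProducts
variable {H : Type*} [NormedAddCommGroup H] [InnerProductSpace ℂ H]

lemma inner_power_create {k m N : ℕ} (hN : N = k + m) (z : H) (x : SymTensor H k)
    (y : SymTensor H m) : inner ℂ (power N z) (create m x y N)
      = ((√(N.choose k) : ℝ) : ℂ) * (inner ℂ (power k z) x * inner ℂ (power m z) y) := by
  subst hN
  rw [create_apply, fock_smul_apply, sec_self, inner_smul_right, inner_power_symMul,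
    ← coe_power, ← Submodule.coe_inner]

/-- The binomial formula in the symmetric tensor algebra. -/
lemma sec_power_add (N : ℕ) (s : ℂ) (v a : H) :
    sec H N (power N (s • v + a)) = ∑ i ∈ Finset.range (N + 1),
      (s ^ i * ((√(N.choose i) : ℝ) : ℂ)) • create (N - i) (power i v) (power (N - i) a) := by
  refine fock_ext fun M z => ?_
  have hs : ∀ (c : ℕ → ℂ) (f : ℕ → Fock H) (S : Finset ℕ),
      (∑ i ∈ S, c i • f i) M = ∑ i ∈ S, c i • f i M := by
    intro c f S
    rw [← comp_apply, map_sum]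
    rfl
  rw [hs, inner_sum]
  by_cases hM : M = N
  · subst hM
    rw [sec_self, inner_power_power, inner_add_right, inner_smul_right, add_pow]
    refine Finset.sum_congr rfl fun i hi => ?_
    have hi' : i ≤ M := Nat.lt_succ_iff.1 (Finset.mem_range.1 hi)
    rw [inner_smul_right, inner_power_create (by omega), inner_power_power, inner_power_power]
    have h : ((√(M.choose i) : ℝ) : ℂ) * ((√(M.choose i) : ℝ) : ℂ) = M.choose i := by
      rw [← Complex.ofReal_mul, Real.mul_self_sqrt (by positivity), Complex.ofReal_natCast]
    rw [← h]
    ring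
  · rw [sec_ne hM, inner_zero_right]
    refine (Finset.sum_eq_zero fun i hi => ?_).symm
    have hi' : i ≤ N := Nat.lt_succ_iff.1 (Finset.mem_range.1 hi)
    rw [create_ne (by omega), smul_zero, inner_zero_right]

lemma inner_sec_create {k n : ℕ} (u : H) (x : SymTensor H k) (y : SymTensor H n) :
    inner ℂ (sec H (k + n) (power (k + n) u)) (create n x y)
      = ((√((k + n).choose k) : ℝ) : ℂ) * (inner ℂ (power k u) x * inner ℂ (power n u) y) := by
  rw [inner_sec_left, inner_power_create rfl]

/-- Wick's formula for products of powers. -/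
lemma inner_create_power (k n : ℕ) (v w a b : H) :
    inner ℂ (create n (power k v) (power n a)) (create n (power k w) (power n b))
      = ∑ l ∈ Finset.range (k + 1), (k.choose l : ℂ) * n.choose l
        * (inner ℂ v w ^ (k - l) * inner ℂ a w ^ l * inner ℂ v b ^ l * inner ℂ a b ^ (n - l)) := by
  rw [← coeff_linear_pow_mul]
  have h0 : ((√((k + n).choose k) : ℝ) : ℂ) ≠ 0 := by
    rw [Ne, Complex.ofReal_eq_zero]
    exact (Real.sqrt_pos.2 (by exact_mod_cast Nat.choose_pos (by omega))).ne'
  -- Generating function: (t̄ v + a)^{⊗(k+n)} paired with the product of w^{⊗k} and b^{⊗n} is a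
  -- polynomial in t. The binomial expansion of the power gives the desired inner product, up to
  -- √binom(k+n, k), as the coefficient of tᵏ; the same pairing factors into powers of linear
  -- polynomials.
  have key := coeff_eq_of_forall_sum (N := k + n) (k := k)
    (d := fun i => ((√((k + n).choose i) : ℝ) : ℂ) *
      inner ℂ (create (k + n - i) (power i v) (power (k + n - i) a))
        (create n (power k w) (power n b)))
    (Q := Polynomial.C ((√((k + n).choose k) : ℝ) : ℂ) *
      ((Polynomial.C (inner ℂ v w) * Polynomial.X + Polynomial.C (inner ℂ a w)) ^ k
        * (Polynomial.C (inner ℂ v b) * Polynomial.X + Polynomial.C (inner ℂ a b)) ^ n))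
    (fun t => by
      have h := inner_sec_create (conj t • v + a) (power k w) (power n b)
      rw [sec_power_add, sum_inner] at h
      simp only [inner_smul_left, map_mul, map_pow, Complex.conj_conj, Complex.conj_ofReal,
        inner_power_power, inner_add_left] at h
      simp only [Polynomial.eval_mul, Polynomial.eval_C, Polynomial.eval_pow, Polynomial.eval_add,
        Polynomial.eval_X]
      rw [mul_comm (inner ℂ v w) t, mul_comm (inner ℂ v b) t, ← h]
      exact Finset.sum_congr rfl fun i _ => by ring) (Nat.le_add_right k n)
  rw [Polynomial.coeff_C_mul] at key
  rw [Nat.add_sub_cancel_left] at key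
  exact mul_left_cancel₀ h0 key

end PowerProducts

/-! ### From anti-normal to normal ordering in a general state. -/

section NormalOrdering
variable {H : Type*} [NormedAddCommGroup H] [InnerProductSpace ℂ H]

/-- Only one diagonal block of the operator enters, so coherences between sectors are irrelevant. -/
lemma densityTerm_congr {G G' : Fock H →L[ℂ] Fock H} {k m : ℕ}
    (h : block G (k + m) = block G' (k + m)) : densityTerm G k m = densityTerm G' k m := by
  rw [densityTerm, densityTerm, h]

lemma block_rankOne (Ψ Φ : Fock H) {n N : ℕ} (h : N = n) :
    block (InnerProductSpace.rankOne ℂ Ψ Φ) N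
      = block (InnerProductSpace.rankOne ℂ (sec H n (Ψ n)) (sec H n (Φ n))) N := by
  subst h
  refine ContinuousLinearMap.ext fun x => ?_
  simp only [block_eq, ContinuousLinearMap.comp_apply, InnerProductSpace.rankOne_apply,
    inner_sec_right, sec_self, map_smul, comp_apply]

variable [FiniteDimensional ℂ H]

lemma partialTrace_eq_sum {E F K : Type*} [NormedAddCommGroup E] [InnerProductSpace ℂ E]
    [CompleteSpace E] [NormedAddCommGroup F] [InnerProductSpace ℂ F] [CompleteSpace F]
    [NormedAddCommGroup K] [InnerProductSpace ℂ K] [CompleteSpace K] [Fintype (basisIndex F)]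
    (m : E →L[ℂ] F →L[ℂ] K) (G : K →L[ℂ] K) :
    partialTrace m G = ∑ j, (m.flip (hBasis F j)).adjoint ∘L G ∘L m.flip (hBasis F j) :=
  tsum_fintype _

/-- In finite dimensions the partial trace is a continuous linear map. -/
lemma exists_partialTraceL {E F K : Type*} [NormedAddCommGroup E] [InnerProductSpace ℂ E]
    [CompleteSpace E] [NormedAddCommGroup F] [InnerProductSpace ℂ F] [CompleteSpace F]
    [NormedAddCommGroup K] [InnerProductSpace ℂ K] [CompleteSpace K] [FiniteDimensional ℂ F]
    (m : E →L[ℂ] F →L[ℂ] K) :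
    ∃ L : (K →L[ℂ] K) →L[ℂ] (E →L[ℂ] E), ∀ G, L G = partialTrace m G := by
  have := Fintype.ofFinite (basisIndex F)
  refine ⟨⟨⟨⟨fun G => partialTrace m G, fun G G' => ?_⟩, fun c G => ?_⟩, ?_⟩, fun G => rfl⟩
  · simp only [partialTrace_eq_sum, ContinuousLinearMap.add_comp, ContinuousLinearMap.comp_add,
      Finset.sum_add_distrib]
  · simp only [partialTrace_eq_sum, ContinuousLinearMap.smul_comp, ContinuousLinearMap.comp_smul,
      ← Finset.smul_sum, RingHom.id_apply]
  · simp only [partialTrace_eq_sum]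
    fun_prop

lemma exists_compressL {E F K L : Type*} [NormedAddCommGroup E] [InnerProductSpace ℂ E]
    [NormedAddCommGroup F] [InnerProductSpace ℂ F] [NormedAddCommGroup K] [InnerProductSpace ℂ K]
    [NormedAddCommGroup L] [InnerProductSpace ℂ L] (A : K →L[ℂ] L) (B : E →L[ℂ] F) :
    ∃ T : (F →L[ℂ] K) →L[ℂ] (E →L[ℂ] L), ∀ G, T G = A ∘L G ∘L B :=
  ⟨(ContinuousLinearMap.compL ℂ E K L A) ∘L ((ContinuousLinearMap.compL ℂ E F K).flip B),
    fun _ => rfl⟩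

/-- Continuity and linearity in G, with no positivity required, allow evaluation on operators |Ψ⟩⟨Φ|
and summation of rank-one decompositions. -/
lemma exists_densityTermL (k m : ℕ) : ∃ L : (Fock H →L[ℂ] Fock H) →L[ℂ]
    (SymTensor H k →L[ℂ] SymTensor H k), ∀ G, L G = densityTerm G k m := by
  obtain ⟨L, hL⟩ := exists_partialTraceL (symMul H k m)
  obtain ⟨B, hB⟩ := exists_compressL (comp H (k + m)) (sec H (k + m))
  refine ⟨((k + m).choose k : ℂ) • L ∘L B, fun G => ?_⟩
  rw [densityTerm, ← hL, smul_apply, ContinuousLinearMap.comp_apply, hB]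
  rfl

/-- The expectation of the normal ordered series, restricted to the `n`-particle sector. -/
def wickForm {k : ℕ} (n : ℕ) (x' x : SymTensor H k) (G : Fock H →L[ℂ] Fock H) : ℂ :=
  ∑ l ∈ Finset.range (k + 1), if l ≤ n then
    (k.choose l : ℂ) * inner ℂ x' (symTensorOne l k (densityTerm G l (n - l)) x) else 0

lemma exists_wickFormL {k : ℕ} (n : ℕ) (x' x : SymTensor H k) :
    ∃ L : (Fock H →L[ℂ] Fock H) →L[ℂ] ℂ, ∀ G, L G = wickForm n x' x G := by
  choose L hL using exists_densityTermL (H := H)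
  refine ⟨∑ l ∈ Finset.range (k + 1), if l ≤ n then (k.choose l : ℂ) •
    (innerSL ℂ x' ∘L ContinuousLinearMap.apply ℂ _ x ∘L
      (LinearMap.toContinuousLinearMap (symTensorOneL H l k)) ∘L L l (n - l)) else 0, fun G => ?_⟩
  rw [wickForm, sum_apply]
  refine Finset.sum_congr rfl fun l _ => ?_
  split_ifs
  · rw [← hL]
    rfl
  · rfl

lemma wickForm_congr {k n : ℕ} (x' x : SymTensor H k) {G G' : Fock H →L[ℂ] Fock H}
    (h : block G n = block G' n) : wickForm n x' x G = wickForm n x' x G' := by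
  rw [wickForm, wickForm]
  refine Finset.sum_congr rfl fun l _ => ?_
  split_ifs with hl
  · rw [densityTerm_congr (G := G) (G' := G')]
    rw [Nat.add_sub_cancel' hl, h]
  · rfl

/-- Pairings with powers factor, and the traced variables contribute ⟪a, b⟫ᵐ by Parseval in `⨂ᵐ H`.
-/
lemma inner_densityTerm_rankOne {l m n : ℕ} (hn : n = l + m) (v w a b : H) :
    inner ℂ (power l v) (densityTerm (InnerProductSpace.rankOne ℂ (sec H n (power n b))
      (sec H n (power n a))) l m (power l w))
      = n.choose l * (inner ℂ v b ^ l * inner ℂ a w ^ l * inner ℂ a b ^ m) := by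
  subst hn
  have := Fintype.ofFinite (basisIndex (HTensor (Fin m) H))
  have hbase : ∑ j, inner ℂ (tprodH fun _ => a) (hBasis (HTensor (Fin m) H) j)
      * inner ℂ (hBasis (HTensor (Fin m) H) j) (tprodH fun _ => b) = inner ℂ a b ^ m := by
    have h := ((hBasis (HTensor (Fin m) H)).hasSum_inner_mul_inner (tprodH fun _ => a)
      (tprodH fun _ => b)).tsum_eq
    rw [tsum_fintype] at h
    exact h.trans (inner_power_power m a b)
  rw [densityTerm, smul_apply, inner_smul_right, partialTrace_eq_sum, sum_apply, inner_sum,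
    ← hbase, Finset.mul_sum, Finset.mul_sum, Finset.mul_sum]
  refine Finset.sum_congr rfl fun j _ => ?_
  rw [ContinuousLinearMap.comp_apply, ContinuousLinearMap.adjoint_inner_right]
  simp only [block_eq, ContinuousLinearMap.comp_apply, InnerProductSpace.rankOne_apply,
    inner_sec_left, sec_self, map_smul, comp_apply, inner_smul_right,
    ContinuousLinearMap.flip_apply]
  rw [inner_power_symMul, ← inner_conj_symm (symMul H l m (power l v) _), inner_power_symMul,
    map_mul, inner_conj_symm, inner_conj_symm, inner_power_power, inner_power_power]
  ring

lemma wickForm_power (k n : ℕ) (v w a b : H) :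
    wickForm n (power k v) (power k w)
      (InnerProductSpace.rankOne ℂ (sec H n (power n b)) (sec H n (power n a)))
      = inner ℂ (create n (power k v) (power n a)) (create n (power k w) (power n b)) := by
  rw [inner_create_power, wickForm]
  refine Finset.sum_congr rfl fun l hl => ?_
  have hl' : l ≤ k := Nat.lt_succ_iff.1 (Finset.mem_range.1 hl)
  split_ifs with h
  · rw [inner_power_symTensorOne hl', inner_densityTerm_rankOne (by omega)]
    ring
  · rw [Nat.choose_eq_zero_of_lt (by omega : n < l)]
    simp

/-- Both sides are sesquilinear in the two pairs of vectors. Powers span the symmetric tensors, so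
the case of four powers, `wickForm_power`, suffices. -/
lemma wickForm_sec {k n : ℕ} (x' x : SymTensor H k) (y' y : SymTensor H n) :
    wickForm n x' x (InnerProductSpace.rankOne ℂ (sec H n y) (sec H n y'))
      = inner ℂ (create n x' y') (create n x y) := by
  have hG := fun (x' x : SymTensor H k) => exists_wickFormL n x' x
  induction y using sym_induction with
  | hs c y hy =>
    obtain ⟨L, hL⟩ := hG x' x
    rw [← hL, map_smul, map_smul, smul_apply, map_smul, hL, hy, map_smul, inner_smul_right,
      smul_eq_mul]
  | ha y₁ y₂ h₁ h₂ =>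
    obtain ⟨L, hL⟩ := hG x' x
    rw [← hL, map_add, map_add, add_apply, map_add, hL, hL, h₁, h₂, map_add, inner_add_right]
  | hp b =>
  induction y' using sym_induction with
  | hs c y hy =>
    obtain ⟨L, hL⟩ := hG x' x
    rw [← hL, map_smul, map_smulₛₗ, map_smul, hL, hy, map_smul, inner_smul_left, smul_eq_mul]
  | ha y₁ y₂ h₁ h₂ =>
    obtain ⟨L, hL⟩ := hG x' x
    rw [← hL, map_add, map_add, map_add, hL, hL, h₁, h₂, map_add, inner_add_left]
  | hp a =>
  induction x using sym_induction with
  | hs c y hy =>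
    rw [create_smul, smul_apply, inner_smul_right, ← hy, wickForm, wickForm, Finset.mul_sum]
    refine Finset.sum_congr rfl fun l _ => ?_
    split_ifs
    · rw [map_smul, inner_smul_right]; ring
    · ring
  | ha y₁ y₂ h₁ h₂ =>
    rw [create_add, add_apply, inner_add_right, ← h₁, ← h₂, wickForm, wickForm, wickForm,
      ← Finset.sum_add_distrib]
    refine Finset.sum_congr rfl fun l _ => ?_
    split_ifs
    · rw [map_add, inner_add_right]; ring
    · ring
  | hp w =>
  induction x' using sym_induction with
  | hs c y hy =>
    rw [create_smul, smul_apply, inner_smul_left, ← hy, wickForm, wickForm, Finset.mul_sum]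
    refine Finset.sum_congr rfl fun l _ => ?_
    split_ifs
    · rw [inner_smul_left]; ring
    · ring
  | ha y₁ y₂ h₁ h₂ =>
    rw [create_add, add_apply, inner_add_left, ← h₁, ← h₂, wickForm, wickForm, wickForm,
      ← Finset.sum_add_distrib]
    refine Finset.sum_congr rfl fun l _ => ?_
    split_ifs
    · rw [inner_add_left]; ring
    · ring
  | hp v => exact wickForm_power k n v w a b

/-- Normal ordering of `a(x')ᵏ a*(x)ᵏ` in the pure state `|Ψ⟩⟨Φ|`. -/
lemma wickForm_rankOne {k : ℕ} (n : ℕ) (x' x : SymTensor H k) (Ψ Φ : Fock H) :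
    wickForm n x' x (InnerProductSpace.rankOne ℂ Ψ Φ)
      = inner ℂ (create n x' (Φ n)) (create n x (Ψ n)) := by
  rw [← wickForm_sec]
  exact wickForm_congr _ _ (block_rankOne Ψ Φ rfl)

/-- A trace class operator is a sum of operators of rank one. -/
lemma hasSum_rankOne {E K : Type*} [NormedAddCommGroup E] [InnerProductSpace ℂ E]
    [CompleteSpace E] [NormedAddCommGroup K] [InnerProductSpace ℂ K] [CompleteSpace K]
    {T : E →L[ℂ] K} (hT : hsNormSq T ≠ ⊤) :
    HasSum (fun j => InnerProductSpace.rankOne ℂ (T.adjoint (hBasis K j))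
      (T.adjoint (hBasis K j))) (T.adjoint ∘L T) := by
  have h1 : Summable fun j => InnerProductSpace.rankOne ℂ (T.adjoint (hBasis K j))
      (T.adjoint (hBasis K j)) := by
    refine Summable.of_norm ?_
    simp only [InnerProductSpace.norm_rankOne, ← sq]
    rw [← hsNormSq_adjoint] at hT
    exact summable_norm_sq_of_tsum_ne_top (fun _ => by positivity)
      (fun j => (enorm_sq_eq_ofReal _).ge) hT
  have h2 : ∑' j, InnerProductSpace.rankOne ℂ (T.adjoint (hBasis K j)) (T.adjoint (hBasis K j))
      = T.adjoint ∘L T := clm_ext_inner fun x => by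
    refine ((innerSL ℂ x).hasSum (h1.hasSum.mapL (ContinuousLinearMap.apply ℂ E x))).unique ?_
    rw [inner_adjoint_comp_self]
    convert! (hBasis K).hasSum_inner_mul_inner (T x) (T x) using 1
    ext j
    simp [ContinuousLinearMap.adjoint_inner_left, ContinuousLinearMap.adjoint_inner_right,
      mul_comm]
  rw [← h2]
  exact h1.hasSum

/-- Converts iterated complex sums with nonnegative terms into a sum in [0, ∞], where the order of
summation is free. -/
lemma tsum_tsum_ofReal {ι κ : Type*} {f : ι → κ → ℝ} (hf : ∀ i j, 0 ≤ f i j) {g : ι → ℂ} {G : ℂ}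
    (h : ∀ i, HasSum (fun j => (f i j : ℂ)) (g i)) (hG : HasSum g G) :
    (∑' i, ∑' j, ENNReal.ofReal (f i j) = ENNReal.ofReal G.re) ∧ G = (G.re : ℂ) ∧ 0 ≤ G.re := by
  have h1 : ∀ i, HasSum (f i) (g i).re := fun i => by
    simpa only [Complex.ofReal_re] using Complex.hasSum_re (h i)
  have h2 : ∀ i, 0 ≤ (g i).re := fun i => (h1 i).nonneg (hf i)
  have h3 := Complex.hasSum_re hG
  refine ⟨?_, ?_, h3.nonneg h2⟩
  · rw [← h3.tsum_eq, ENNReal.ofReal_tsum_of_nonneg h2 h3.summable]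
    refine tsum_congr fun i => ?_
    rw [← (h1 i).tsum_eq, ENNReal.ofReal_tsum_of_nonneg (hf i) (h1 i).summable]
  · have h4 : ∀ i, g i = ((g i).re : ℂ) := fun i =>
      (h i).unique (Complex.hasSum_ofReal.2 (h1 i))
    refine hG.unique ?_
    have := Complex.hasSum_ofReal.2 h3
    simpa only [← h4] using this

/-- The normal ordered form of the expectation of `a(x)ᵏ a*(x)ᵏ` in a state. -/
lemma tsum_create_eq {K : Type*} [NormedAddCommGroup K] [InnerProductSpace ℂ K] [CompleteSpace K]
    {T : Fock H →L[ℂ] K} (hT : hsNormSq T ≠ ⊤) {k : ℕ}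
    (hs : ∀ l ≤ k, Summable fun m => densityTerm (T.adjoint ∘L T) l m) (x : SymTensor H k)
    {D : SymTensor H k →L[ℂ] SymTensor H k}
    (hD : D = ∑ l ∈ Finset.range (k + 1), (k.choose l : ℂ) •
      symTensorOne l k (densityMatrix (T.adjoint ∘L T) l)) :
    (∑' j, ∑' n, ‖create n x (T.adjoint (hBasis K j) n)‖ₑ ^ 2
        = ENNReal.ofReal (inner ℂ x (D x)).re) ∧
      inner ℂ x (D x) = ((inner ℂ x (D x)).re : ℂ) ∧ 0 ≤ (inner ℂ x (D x)).re := by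
  have h1 : ∀ n, HasSum (fun j => ((‖create n x (T.adjoint (hBasis K j) n)‖ ^ 2 : ℝ) : ℂ))
      (wickForm n x x (T.adjoint ∘L T)) := by
    intro n
    obtain ⟨L, hL⟩ := exists_wickFormL n x x
    rw [← hL]
    convert! (hasSum_rankOne hT).mapL L using 1
    ext j
    rw [hL, wickForm_rankOne, inner_self_eq_norm_sq_to_K]
    norm_cast
  have h2 : HasSum (fun n => wickForm n x x (T.adjoint ∘L T)) (inner ℂ x (D x)) := by
    rw [hD, sum_apply, inner_sum]
    simp only [wickForm]
    refine hasSum_sum fun l hl => ?_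
    have hl' : l ≤ k := Nat.lt_succ_iff.1 (Finset.mem_range.1 hl)
    rw [smul_apply, inner_smul_right]
    have h3 := (innerSL ℂ x).hasSum ((((hs l hl').hasSum).mapL
      (LinearMap.toContinuousLinearMap (symTensorOneL H l k))).mapL
      (ContinuousLinearMap.apply ℂ _ x))
    have h4 := (h3.mul_left (k.choose l : ℂ))
    -- The density matrix series is indexed by the number m = n - l of traced particles; the sectors
    -- with n < l contribute zero.
    rw [← (add_right_injective l).hasSum_iff]
    · convert! h4 using 1
      ext m
      simp only [Function.comp_apply, Nat.le_add_right, if_true, Nat.add_sub_cancel_left]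
      rfl
    · intro n hn
      rw [if_neg]
      intro hln
      exact hn ⟨n - l, by simp only; omega⟩
  have h3 := tsum_tsum_ofReal (fun _ _ => by positivity) h1 h2
  refine ⟨?_, h3.2⟩
  rw [← h3.1, ENNReal.tsum_comm]
  simp only [enorm_sq_eq_ofReal]

end NormalOrdering


/-! ### Gaussian integrals with complex linear terms. -/

section GaussianIntegrals

lemma gaussian_integrand_eq (c : ℝ) (α β : ℂ) (p : ℝ × ℝ) :
    Complex.exp (-c * (‖Complex.measurableEquivRealProd.symm p‖ ^ 2 : ℝ)
      + α * Complex.measurableEquivRealProd.symm p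
      + β * conj (Complex.measurableEquivRealProd.symm p))
    = Complex.exp (-c * p.1 ^ 2 + (α + β) * p.1 + 0)
      * Complex.exp (-c * p.2 ^ 2 + (Complex.I * (α - β)) * p.2 + 0) := by
  rw [← Complex.exp_add, Complex.sq_norm, Complex.normSq_apply]
  have h1 : (Complex.measurableEquivRealProd.symm p) = p.1 + p.2 * Complex.I :=
    Complex.mk_eq_add_mul_I _ _
  rw [h1]
  simp
  congr 1
  ring

lemma integrable_gaussian {c : ℝ} (hc : 0 < c) (α β : ℂ) :
    Integrable fun z : ℂ => Complex.exp (-c * (‖z‖ ^ 2 : ℝ) + α * z + β * conj z) := by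
  rw [← Complex.volume_preserving_equiv_real_prod.symm.integrable_comp_emb
    Complex.measurableEquivRealProd.symm.measurableEmbedding]
  have hb : (-(c : ℂ)).re < 0 := by simpa using hc
  have := (integrable_cexp_quadratic' hb (α + β) 0).mul_prod
    (integrable_cexp_quadratic' hb (Complex.I * (α - β)) 0)
  refine this.congr (ae_of_all _ fun p => ?_)
  exact (gaussian_integrand_eq c α β p).symm

/-- In real coordinates the integral is a product of two one-dimensional ones with linear
coefficients α + β and i(α - β). The difference (α + β)² - (α - β)² = 4αβ produces the exponent. -/
lemma integral_gaussian {c : ℝ} (hc : 0 < c) (α β : ℂ) :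
    ∫ z : ℂ, Complex.exp (-c * (‖z‖ ^ 2 : ℝ) + α * z + β * conj z)
      = (Real.pi / c : ℝ) * Complex.exp (α * β / c) := by
  rw [← Complex.volume_preserving_equiv_real_prod.symm.integral_comp
    Complex.measurableEquivRealProd.symm.measurableEmbedding]
  simp only [gaussian_integrand_eq]
  have hb : (-(c : ℂ)).re < 0 := by simpa using hc
  have hc' : (c : ℂ) ≠ 0 := by exact_mod_cast hc.ne'
  rw [Measure.volume_eq_prod]
  refine (integral_prod_mul (fun x : ℝ => Complex.exp (-c * x ^ 2 + (α + β) * x + 0))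
    (fun y : ℝ => Complex.exp (-c * y ^ 2 + (Complex.I * (α - β)) * y + 0))).trans ?_
  rw [integral_cexp_quadratic hb, integral_cexp_quadratic hb, mul_mul_mul_comm, ← Complex.exp_add]
  congr 1
  · rw [← sq, one_div, neg_neg, Complex.cpow_ofNat_inv_pow, Complex.ofReal_div]
  · congr 1
    rw [mul_pow, Complex.I_sq]
    field_simp
    ring

lemma gaussian_sum_eq {d : ℕ} (c : ℝ) (α β z : Fin d → ℂ) :
    Complex.exp (-c * ((∑ i, ‖z i‖ ^ 2 : ℝ) : ℂ) + ∑ i, z i * α i + ∑ i, conj (z i) * β i)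
      = ∏ i, Complex.exp (-c * (‖z i‖ ^ 2 : ℝ) + α i * z i + β i * conj (z i)) := by
  rw [← Complex.exp_sum, Finset.sum_add_distrib, Finset.sum_add_distrib, ← Finset.mul_sum,
    Complex.ofReal_sum]
  simp only [mul_comm]

variable {H : Type*} [NormedAddCommGroup H] [InnerProductSpace ℂ H] {V : Submodule ℂ H}
  [FiniteDimensional ℂ V] [MeasurableSpace H] [BorelSpace H]

lemma gaussian_stdOrthonormalBasis (c : ℝ) (v w : V) (z : Fin (Module.finrank ℂ V) → ℂ) :
    Complex.exp (-c * (‖∑ i, z i • stdOrthonormalBasis ℂ V i‖ ^ 2 : ℝ)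
      + inner ℂ v (∑ i, z i • stdOrthonormalBasis ℂ V i)
      + inner ℂ (∑ i, z i • stdOrthonormalBasis ℂ V i) w)
      = ∏ i, Complex.exp (-c * (‖z i‖ ^ 2 : ℝ) + inner ℂ v (stdOrthonormalBasis ℂ V i) * z i
        + inner ℂ (stdOrthonormalBasis ℂ V i) w * conj (z i)) := by
  rw [← gaussian_sum_eq, inner_sum, sum_inner]
  simp only [inner_smul_left, inner_smul_right]
  congr 5
  rw [← (stdOrthonormalBasis ℂ V).sum_sq_norm_inner_right]
  refine Finset.sum_congr rfl fun i _ => ?_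
  congr 2
  exact (stdOrthonormalBasis ℂ V).orthonormal.inner_right_fintype z i

lemma continuous_sum_smul :
    Continuous fun z : Fin (Module.finrank ℂ V) → ℂ => ∑ i, z i • stdOrthonormalBasis ℂ V i := by
  fun_prop

/-- In an orthonormal basis the integrand is a product over the coordinates, and Parseval
reassembles the exponents into ⟪v, w⟫. -/
lemma integral_lebesgue_gaussian {c : ℝ} (hc : 0 < c) (v w : V) :
    Integrable (fun u : V => Complex.exp (-c * (‖u‖ ^ 2 : ℝ) + inner ℂ v u + inner ℂ u w))
      (lebesgue V) ∧
    ∫ u : V, Complex.exp (-c * (‖u‖ ^ 2 : ℝ) + inner ℂ v u + inner ℂ u w) ∂(lebesgue V)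
      = ((Real.pi / c) ^ Module.finrank ℂ V : ℝ) * Complex.exp (inner ℂ v w / c) := by
  have hm : Measurable fun z : Fin (Module.finrank ℂ V) → ℂ =>
      ∑ i, z i • stdOrthonormalBasis ℂ V i := continuous_sum_smul.measurable
  have hF : Continuous fun u : V =>
      Complex.exp (-c * (‖u‖ ^ 2 : ℝ) + inner ℂ v u + inner ℂ u w) := by fun_prop
  constructor
  · rw [lebesgue, integrable_map_measure hF.aestronglyMeasurable hm.aemeasurable]
    have := Integrable.fintype_prod (μ := fun _ => volume)
      (f := fun (i : Fin (Module.finrank ℂ V)) (z : ℂ) =>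
      Complex.exp (-c * (‖z‖ ^ 2 : ℝ) + inner ℂ v (stdOrthonormalBasis ℂ V i) * z
        + inner ℂ (stdOrthonormalBasis ℂ V i) w * conj z)) fun i => integrable_gaussian hc _ _
    refine this.congr (ae_of_all _ fun z => ?_)
    exact (gaussian_stdOrthonormalBasis c v w z).symm
  · rw [lebesgue, integral_map hm.aemeasurable hF.aestronglyMeasurable]
    simp only [gaussian_stdOrthonormalBasis]
    rw [integral_fintype_prod_volume_eq_prod (f := fun (i : Fin (Module.finrank ℂ V)) (z : ℂ) =>
      Complex.exp (-c * (‖z‖ ^ 2 : ℝ) + inner ℂ v (stdOrthonormalBasis ℂ V i) * z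
        + inner ℂ (stdOrthonormalBasis ℂ V i) w * conj z))]
    simp only [integral_gaussian hc]
    rw [Finset.prod_mul_distrib, Finset.prod_const, Finset.card_univ, Fintype.card_fin,
      Complex.ofReal_pow, ← Complex.exp_sum, ← Finset.sum_div,
      (stdOrthonormalBasis ℂ V).sum_inner_mul_inner]

end GaussianIntegrals

/-! ### Continuity from Gram kernels and extension of norm identities from dense sets. -/

section Density

/-- `‖f u - f v‖²` expands into four values of the Gram kernel. For `power` and `expv` these kernels
are explicit. -/
lemma continuous_of_continuous_inner {X E : Type*} [TopologicalSpace X] [NormedAddCommGroup E]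
    [InnerProductSpace ℂ E] {f : X → E}
    (h : Continuous fun p : X × X => inner ℂ (f p.1) (f p.2)) : Continuous f := by
  rw [continuous_iff_continuousAt]
  intro v
  rw [ContinuousAt, tendsto_iff_norm_sub_tendsto_zero]
  have h1 : ∀ u, ‖f u - f v‖ = √(inner ℂ (f u) (f u) - inner ℂ (f u) (f v) - inner ℂ (f v) (f u)
      + inner ℂ (f v) (f v)).re := by
    intro u
    rw [@norm_eq_sqrt_re_inner ℂ, inner_sub_sub_self]
    rfl
  simp only [h1]
  have h2 : Continuous fun u => √(inner ℂ (f u) (f u) - inner ℂ (f u) (f v) - inner ℂ (f v) (f u)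
      + inner ℂ (f v) (f v)).re := by
    have a1 : Continuous fun u => inner ℂ (f u) (f u) := h.comp (continuous_id.prodMk continuous_id)
    have a2 : Continuous fun u => inner ℂ (f u) (f v) :=
      h.comp (continuous_id.prodMk continuous_const)
    have a3 : Continuous fun u => inner ℂ (f v) (f u) :=
      h.comp (continuous_const.prodMk continuous_id)
    exact (Complex.continuous_re.comp (((a1.sub a2).sub a3).add continuous_const)).sqrt
  convert h2.tendsto v using 2
  simp

lemma eLpNorm_two_sq {X : Type*} [MeasurableSpace X] (μ : Measure X) (f : X → ℂ) :
    eLpNorm f 2 μ ^ 2 = ∫⁻ u, ‖f u‖ₑ ^ 2 ∂μ := by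
  have := eLpNorm_nnreal_pow_eq_lintegral (μ := μ) (f := f) (p := 2) two_ne_zero
  simpa using this

/-- A family of vectors which resolves a multiple of the identity on a dense set does so
everywhere. -/
lemma eLpNorm_inner_eq {X E : Type*} [MeasurableSpace X] {μ : Measure X} [NormedAddCommGroup E]
    [InnerProductSpace ℂ E] {ξ : X → E}
    (hξ : ∀ φ, AEStronglyMeasurable (fun u => inner ℂ (ξ u) φ) μ) {c : ℝ≥0∞} (hc : c ≠ ⊤)
    {S : Set E} (hS : Dense S) (h : ∀ φ ∈ S, eLpNorm (fun u => inner ℂ (ξ u) φ) 2 μ = c * ‖φ‖ₑ)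
    (φ : E) : eLpNorm (fun u => inner ℂ (ξ u) φ) 2 μ = c * ‖φ‖ₑ := by
  have hcont : ∀ (f : ℕ → E) (φ : E), Filter.Tendsto f Filter.atTop (nhds φ) →
      Filter.Tendsto (fun n => c * ‖f n‖ₑ) Filter.atTop (nhds (c * ‖φ‖ₑ)) := fun f φ hf =>
    ENNReal.Tendsto.const_mul ((continuous_enorm.tendsto φ).comp hf) (Or.inr hc)
  -- Fatou's lemma along a sequence from `S` gives the upper bound for every vector; this bound then
  -- controls the error in the reverse inequality.
  have hle : ∀ φ, eLpNorm (fun u => inner ℂ (ξ u) φ) 2 μ ≤ c * ‖φ‖ₑ := by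
    intro φ
    obtain ⟨f, hfS, hf⟩ := mem_closure_iff_seq_limit.1 (hS φ)
    refine (Lp.eLpNorm_lim_le_liminf_eLpNorm (f := fun n u => inner ℂ (ξ u) (f n))
      (fun n => hξ _) _ (ae_of_all _ fun u => ?_)).trans ?_
    · exact tendsto_const_nhds.inner hf
    · simp only [h _ (hfS _)]
      exact (hcont f φ hf).liminf_eq.le
  refine le_antisymm (hle φ) ?_
  obtain ⟨f, hfS, hf⟩ := mem_closure_iff_seq_limit.1 (hS φ)
  have h0 := hcont _ _ (tendsto_sub_nhds_zero_iff.2 hf)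
  rw [enorm_zero, mul_zero] at h0
  have h1 := (tendsto_const_nhds (x := eLpNorm (fun u => inner ℂ (ξ u) φ) 2 μ)).add h0
  rw [add_zero] at h1
  refine le_of_tendsto_of_tendsto' (hcont f φ hf) h1 fun n => ?_
  rw [← h _ (hfS n)]
  -- Minkowski's inequality for `f n = φ + (f n - φ)`, whose error term tends to zero by `hle`.
  refine le_trans ?_ (add_le_add_right (hle (f n - φ)) _)
  refine le_trans (le_of_eq ?_) (eLpNorm_add_le (hξ φ) (hξ (f n - φ)) one_le_two)
  congr 1
  ext u
  simp

end Density

/-! ### Coherent states and the resolution of the identity. -/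

section CoherentStates
variable {H : Type*} [NormedAddCommGroup H] [InnerProductSpace ℂ H]

lemma continuous_power (n : ℕ) : Continuous (power n : H → SymTensor H n) :=
  continuous_of_continuous_inner (by simp only [inner_power_power]; fun_prop)

lemma continuous_expv : Continuous (expv : H → Fock H) :=
  continuous_of_continuous_inner (by simp only [inner_expv_expv]; fun_prop)

lemma continuous_coherent : Continuous (coherent : H → Fock H) := by
  have h : (coherent : H → Fock H)
      = fun u => ((Real.exp (-‖u‖ ^ 2 / 2) : ℝ) : ℂ) • expv u := funext coherent_eq
  rw [h]
  have := continuous_expv (H := H)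
  fun_prop

/-- The two normalizing factors of the coherent state combine into the Gaussian weight exp(-‖u‖²/ε),
leaving an integrand covered by `integral_lebesgue_gaussian`. -/
lemma inner_expv_coherent_mul {ε : ℝ} (hε : 0 < ε) (v w u : H) :
    inner ℂ (expv v) (coherent (((√ε)⁻¹ : ℂ) • u))
        * inner ℂ (coherent (((√ε)⁻¹ : ℂ) • u)) (expv w)
      = Complex.exp (-(ε⁻¹ : ℝ) * (‖u‖ ^ 2 : ℝ) + inner ℂ ((((√ε)⁻¹ : ℝ) : ℂ) • v) u
        + inner ℂ u ((((√ε)⁻¹ : ℝ) : ℂ) • w)) := by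
  rw [coherent_eq, inner_smul_left, inner_smul_right, inner_expv_expv, inner_expv_expv,
    Complex.conj_ofReal, mul_mul_mul_comm, ← Complex.ofReal_mul, ← Real.exp_add, ← Complex.exp_add,
    Complex.ofReal_exp, ← Complex.exp_add, ← Complex.ofReal_inv, inner_smul_left, inner_smul_right,
    inner_smul_left, inner_smul_right, Complex.conj_ofReal, norm_smul, Complex.norm_real,
    Real.norm_of_nonneg (by positivity), ← add_assoc]
  congr 3
  rw [← Complex.ofReal_neg, ← Complex.ofReal_mul, mul_pow, inv_pow, Real.sq_sqrt hε.le]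
  congr 1
  ring

variable {V : Submodule ℂ H} [FiniteDimensional ℂ V] [MeasurableSpace H] [BorelSpace H]

lemma integral_expv_coherent {ε : ℝ} (hε : 0 < ε) (v w : V) :
    Integrable (fun u : V => inner ℂ (expv v) (coherent (((√ε)⁻¹ : ℂ) • u))
      * inner ℂ (coherent (((√ε)⁻¹ : ℂ) • u)) (expv w)) (lebesgue V) ∧
    ∫ u : V, inner ℂ (expv v) (coherent (((√ε)⁻¹ : ℂ) • u))
      * inner ℂ (coherent (((√ε)⁻¹ : ℂ) • u)) (expv w) ∂(lebesgue V)
      = ((ε * Real.pi) ^ Module.finrank ℂ V : ℝ) * inner ℂ (expv v) (expv w) := by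
  simp only [inner_expv_coherent_mul hε]
  have h := integral_lebesgue_gaussian (inv_pos.2 hε) ((((√ε)⁻¹ : ℝ) : ℂ) • v)
    ((((√ε)⁻¹ : ℝ) : ℂ) • w)
  refine ⟨h.1, h.2.trans ?_⟩
  rw [inner_expv_expv, inner_smul_left, inner_smul_right, Complex.conj_ofReal, ← mul_assoc,
    ← Complex.ofReal_mul, ← mul_inv, Real.mul_self_sqrt hε.le, div_inv_eq_mul, mul_comm Real.pi,
    mul_div_assoc, mul_div_left_comm, div_self, mul_one]
  exact_mod_cast (inv_pos.2 hε).ne'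

lemma integral_span_coherent {ε : ℝ} (hε : 0 < ε) {φ ψ : Fock V}
    (hφ : φ ∈ Submodule.span ℂ (Set.range (expv (H := V))))
    (hψ : ψ ∈ Submodule.span ℂ (Set.range (expv (H := V)))) :
    Integrable (fun u : V => inner ℂ φ (coherent (((√ε)⁻¹ : ℂ) • u))
      * inner ℂ (coherent (((√ε)⁻¹ : ℂ) • u)) ψ) (lebesgue V) ∧
    ∫ u : V, inner ℂ φ (coherent (((√ε)⁻¹ : ℂ) • u))
      * inner ℂ (coherent (((√ε)⁻¹ : ℂ) • u)) ψ ∂(lebesgue V)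
      = ((ε * Real.pi) ^ Module.finrank ℂ V : ℝ) * inner ℂ φ ψ := by
  induction hφ using Submodule.span_induction with
  | zero => simp
  | add x y _ _ hx hy =>
    simp only [inner_add_left, add_mul, mul_add]
    exact ⟨hx.1.add hy.1, by rw [integral_add hx.1 hy.1, hx.2, hy.2]⟩
  | smul c x _ hx =>
    simp only [inner_smul_left, mul_assoc]
    exact ⟨hx.1.const_mul _, by rw [integral_const_mul, hx.2]; ring⟩
  | mem x hx =>
  obtain ⟨v, rfl⟩ := hx
  induction hψ using Submodule.span_induction with
  | zero => simp
  | add x y _ _ hx hy =>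
    simp only [inner_add_right, mul_add]
    exact ⟨hx.1.add hy.1, by rw [integral_add hx.1 hy.1, hx.2, hy.2]⟩
  | smul c x _ hx =>
    simp only [inner_smul_right, mul_left_comm _ c]
    exact ⟨hx.1.const_mul _, by rw [integral_const_mul, hx.2]⟩
  | mem x hx =>
  obtain ⟨w, rfl⟩ := hx
  exact integral_expv_coherent hε v w

lemma continuous_inner_coherent (s : ℂ) (φ : Fock V) :
    Continuous fun u : V => inner ℂ (coherent (s • u)) φ :=
  (continuous_coherent.comp (continuous_const_smul s)).inner continuous_const

/-- The coherent states resolve the identity of `F(V)`. -/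
lemma lintegral_coherent {ε : ℝ} (hε : 0 < ε) (φ : Fock V) :
    ∫⁻ u : V, ‖inner ℂ (coherent (((√ε)⁻¹ : ℂ) • u)) φ‖ₑ ^ 2 ∂(lebesgue V)
      = ENNReal.ofReal ((ε * Real.pi) ^ Module.finrank ℂ V) * ‖φ‖ₑ ^ 2 := by
  have hC : 0 ≤ (ε * Real.pi) ^ Module.finrank ℂ V := by positivity
  have hC2 : ENNReal.ofReal √((ε * Real.pi) ^ Module.finrank ℂ V) ^ 2
      = ENNReal.ofReal ((ε * Real.pi) ^ Module.finrank ℂ V) := by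
    rw [← ENNReal.ofReal_pow (Real.sqrt_nonneg _), Real.sq_sqrt hC]
  have key := eLpNorm_inner_eq (μ := lebesgue V)
    (ξ := fun u : V => coherent (((√ε)⁻¹ : ℂ) • u))
    (fun φ => (continuous_inner_coherent _ φ).aestronglyMeasurable)
    (c := ENNReal.ofReal √((ε * Real.pi) ^ Module.finrank ℂ V)) ENNReal.ofReal_ne_top
    (dense_span_expv (H := V)) (fun φ hφ => ?_) φ
  · rw [← eLpNorm_two_sq, key, mul_pow, hC2]
  · refine (ENNReal.pow_right_strictMono two_ne_zero).injective ?_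
    have h := integral_span_coherent hε hφ hφ
    have e : ∀ u : V, inner ℂ φ (coherent (((√ε)⁻¹ : ℂ) • u))
        * inner ℂ (coherent (((√ε)⁻¹ : ℂ) • u)) φ
        = ((‖inner ℂ (coherent (((√ε)⁻¹ : ℂ) • u)) φ‖ ^ 2 : ℝ) : ℂ) := by
      intro u
      rw [← inner_conj_symm, Complex.conj_mul', Complex.ofReal_pow]
    simp only [e] at h
    have h1 : Integrable (fun u : V => ‖inner ℂ (coherent (((√ε)⁻¹ : ℂ) • u)) φ‖ ^ 2)
        (lebesgue V) := h.1.re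
    rw [eLpNorm_two_sq, mul_pow, hC2]
    simp only [enorm_sq_eq_ofReal]
    rw [← ofReal_integral_eq_lintegral_ofReal h1 (ae_of_all _ fun _ => by positivity),
      ← ENNReal.ofReal_mul hC]
    congr 1
    have h2 := h.2
    have h3 : inner ℂ φ φ = ((‖φ‖ ^ 2 : ℝ) : ℂ) := by
      rw [inner_self_eq_norm_sq_to_K]
      norm_cast
    rw [integral_complex_ofReal, h3, ← Complex.ofReal_mul] at h2
    exact Complex.ofReal_injective h2

end CoherentStates


/-! ### Moments of the lower symbol. -/

section LowerSymbolMoments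
variable {H : Type*} [NormedAddCommGroup H] [InnerProductSpace ℂ H]

lemma norm_create_apply {k n : ℕ} (x : SymTensor H k) (y : SymTensor H n) :
    ‖create n x y (k + n)‖ = ‖create n x y‖ := by
  rw [create_apply, fock_smul_apply, sec_self, norm_smul, norm_smul, norm_sec]

/-- The action of the creation operators on a vector of the Fock space, when it is defined. -/
lemma exists_creation {k : ℕ} (x : SymTensor H k) (ψ : Fock H)
    (h : ∑' n, ‖create n x (ψ n)‖ₑ ^ 2 ≠ ⊤) :
    ∃ φ : Fock H, ‖φ‖ₑ ^ 2 = ∑' n, ‖create n x (ψ n)‖ₑ ^ 2 ∧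
      ∀ z, inner ℂ (expv z) φ
        = (((√(k.factorial))⁻¹ : ℝ) : ℂ) * inner ℂ (power k z) x * inner ℂ (expv z) ψ := by
  have h1 : Summable fun n => ‖create n x (ψ n)‖ ^ 2 :=
    summable_norm_sq_of_tsum_ne_top (fun _ => by positivity) (fun j => (enorm_sq_eq_ofReal _).ge) h
  have e1 : ∀ n, create (k + n - k) x (ψ (k + n - k)) (k + n) = create n x (ψ n) (k + n) := by
    intro n
    rw [Nat.add_sub_cancel_left]
  have e0 : ∀ N ∉ Set.range (k + ·), create (N - k) x (ψ (N - k)) N = 0 := by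
    intro N hN
    refine create_ne (fun h => hN ⟨N - k, h.symm⟩) _ _
  have h2 : Summable fun N => ‖create (N - k) x (ψ (N - k)) N‖ ^ 2 := by
    rw [← (add_right_injective k).summable_iff]
    · simpa only [Function.comp_def, e1, norm_create_apply] using h1
    · intro N hN
      rw [e0 N hN, norm_zero, zero_pow two_ne_zero]
  -- For N < k the truncated subtraction gives `N - k = 0`, but `create 0 x (ψ 0)` lives in the
  -- sector k, so its component N is zero as it should be.
  let φ : Fock H := ⟨fun N => create (N - k) x (ψ (N - k)) N, memℓp_gen (by simpa using h2)⟩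
  have hφ : ∀ N, φ N = create (N - k) x (ψ (N - k)) N := fun _ => rfl
  refine ⟨φ, ?_, fun z => ?_⟩
  · rw [enorm_sq_eq_ofReal, norm_fock_sq]
    simp only [enorm_sq_eq_ofReal, hφ]
    rw [← ENNReal.ofReal_tsum_of_nonneg (fun _ => by positivity) h1]
    congr 1
    rw [← (add_right_injective k).tsum_eq]
    · simp only [e1, norm_create_apply]
    · intro N hN
      by_contra hc
      exact hN (by simp only [e0 N hc, norm_zero, ne_eq, OfNat.ofNat_ne_zero, not_false_eq_true,
        zero_pow])
  · refine (hasSum_symb z φ).unique ?_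
    rw [← (add_right_injective k).hasSum_iff]
    · convert! (hasSum_symb z ψ).mul_left
        ((((√(k.factorial))⁻¹ : ℝ) : ℂ) * inner ℂ (power k z) x) using 1
      ext n
      have e2 : symb (k + n) z φ = symb (k + n) z (create n x (ψ n)) := by
        rw [symb, symb, hφ, e1]
      rw [Function.comp_apply, e2, symb_create, symb_sec_self, symb_sec_self, symb]
    · intro N hN
      exact symb_eq_zero z (e0 N hN)

variable {V : Submodule ℂ H} [FiniteDimensional ℂ V] [MeasurableSpace H] [BorelSpace H]

/-- With φ = a*(x)ψ, the pairing of φ with ξ(u/√ε) is that of ψ times (k! ε^k)^{-1/2} ⟪u^{⊗k}, x⟫.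
The resolution of the identity for φ gives the result, and this is where k! ε^k comes from. -/
lemma lintegral_power_coherent {ε : ℝ} (hε : 0 < ε) {k : ℕ} (x : SymTensor V k) (ψ : Fock V)
    (h : ∑' n, ‖create n x (ψ n)‖ₑ ^ 2 ≠ ⊤) :
    ∫⁻ u : V, ‖inner ℂ (coherent (((√ε)⁻¹ : ℂ) • u)) ψ‖ₑ ^ 2 * ‖inner ℂ (power k u) x‖ₑ ^ 2
        ∂(lebesgue V)
      = ENNReal.ofReal ((ε * Real.pi) ^ Module.finrank ℂ V) *
        (ENNReal.ofReal (k.factorial * ε ^ k) * ∑' n, ‖create n x (ψ n)‖ₑ ^ 2) := by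
  obtain ⟨φ, hφ, hi⟩ := exists_creation x ψ h
  rw [← hφ, mul_left_comm, ← lintegral_coherent hε,
    ← lintegral_const_mul _ (((continuous_inner_coherent _ φ).measurable.enorm).pow_const 2)]
  refine lintegral_congr fun u => ?_
  have e : ((√ε)⁻¹ : ℂ) = (((√ε)⁻¹ : ℝ) : ℂ) := (Complex.ofReal_inv _).symm
  have hn : ‖inner ℂ (coherent (((√ε)⁻¹ : ℂ) • u)) φ‖ ^ 2 * (k.factorial * ε ^ k)
      = ‖inner ℂ (coherent (((√ε)⁻¹ : ℂ) • u)) ψ‖ ^ 2 * ‖inner ℂ (power k u) x‖ ^ 2 := by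
    rw [coherent_eq, inner_smul_left, inner_smul_left, hi, e, power_smul, inner_smul_left]
    simp only [norm_mul, mul_pow, norm_pow, RCLike.norm_conj, Complex.norm_real, map_pow,
      Real.norm_eq_abs, sq_abs, inv_pow, Real.sq_sqrt (Nat.cast_nonneg (α := ℝ) k.factorial)]
    have h1 : (|(√ε)⁻¹| ^ k) ^ 2 = (ε ^ k)⁻¹ := by
      rw [← pow_mul, mul_comm k 2, pow_mul, sq_abs, inv_pow, Real.sq_sqrt hε.le, inv_pow]
    have h2 : (k.factorial : ℝ) ≠ 0 := by exact_mod_cast k.factorial_ne_zero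
    have h3 : ε ^ k ≠ 0 := by positivity
    rw [h1]
    field_simp
  rw [enorm_sq_eq_ofReal, enorm_sq_eq_ofReal, enorm_sq_eq_ofReal,
    ← ENNReal.ofReal_mul (by positivity), ← ENNReal.ofReal_mul (by positivity), ← hn, mul_comm]

/-- Tonelli needs countably many functions, whereas the Hilbert basis of the auxiliary space may be
uncountable. -/
lemma lintegral_tsum_of_countable {ι X : Type*} [MeasurableSpace X] {μ : Measure X}
    {f : ι → X → ℝ≥0∞} (hf : ∀ i, AEMeasurable (f i) μ) {s : Set ι} (hs : s.Countable)
    (h : ∀ i ∉ s, f i = 0) : ∫⁻ u, ∑' i, f i u ∂μ = ∑' i, ∫⁻ u, f i u ∂μ := by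
  have := hs.to_subtype
  have h1 : ∀ u, ∑' i, f i u = ∑' i : s, f i u := fun u =>
    (tsum_subtype_eq_of_support_subset fun i hi => by
      by_contra hc
      exact hi (congrFun (h i hc) u)).symm
  have h2 : ∑' i, ∫⁻ u, f i u ∂μ = ∑' i : s, ∫⁻ u, f i u ∂μ :=
    (tsum_subtype_eq_of_support_subset (f := fun i => ∫⁻ u, f i u ∂μ) fun i hi => by
      by_contra hc
      exact hi (by simp [h i hc])).symm
  simp only [h1, h2]
  exact lintegral_tsum fun i => hf i

/-- The moments of the lower symbol of a state are given by its density matrices. -/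
lemma lintegral_power_husimiMeasure {K : Type*} [NormedAddCommGroup K] [InnerProductSpace ℂ K]
    [CompleteSpace K] {Γ : Fock H →L[ℂ] Fock H} {T : Fock V →L[ℂ] K}
    (hΓ : localization V Γ = T.adjoint ∘L T) (hT : hsNormSq T ≠ ⊤) {ε : ℝ} (hε : 0 < ε) {k : ℕ}
    (hs : ∀ l ≤ k, Summable fun m => densityTerm (T.adjoint ∘L T) l m) (x : SymTensor V k) :
    ∫⁻ u : V, ‖inner ℂ (power k u) x‖ₑ ^ 2 ∂(husimiMeasure V Γ ε)
      = ENNReal.ofReal (k.factorial * ε ^ k) * ENNReal.ofReal (inner ℂ x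
        ((∑ l ∈ Finset.range (k + 1), (k.choose l : ℂ) •
          symTensorOne l k (densityMatrix (T.adjoint ∘L T) l)) x)).re := by
  have hC : 0 < (ε * Real.pi) ^ Module.finrank ℂ V := by positivity
  have key := (tsum_create_eq hT hs x rfl).1
  -- The normal ordered form is finite, so every `T† eⱼ` lies in the domain of a*(x).
  have hfin : ∀ j, ∑' n, ‖create n x (T.adjoint (hBasis K j) n)‖ₑ ^ 2 ≠ ⊤ := by
    refine ENNReal.ne_top_of_tsum_ne_top ?_
    rw [key]
    exact ENNReal.ofReal_ne_top
  -- The Husimi function is a constant times `‖T ξ‖²`, expanded by Parseval into the Husimi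
  -- functions of the vectors `T† eⱼ`.
  have hden : ∀ u : V, ENNReal.ofReal (husimi V Γ ε u)
      = ENNReal.ofReal ((ε * Real.pi) ^ Module.finrank ℂ V)⁻¹ *
        ∑' j, ‖inner ℂ (coherent (((√ε)⁻¹ : ℂ) • u)) (T.adjoint (hBasis K j))‖ₑ ^ 2 := by
    intro u
    rw [husimi, hΓ, inner_adjoint_comp_self_self, Complex.ofReal_re,
      ENNReal.ofReal_mul (by positivity), ← enorm_sq_eq_ofReal, ← tsum_enorm_inner_sq (hBasis K)]
    congr 1
    refine tsum_congr fun j => ?_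
    rw [ContinuousLinearMap.adjoint_inner_right, enorm_inner_symm]
  have hmeas : ∀ j, Measurable fun u : V =>
      ‖inner ℂ (coherent (((√ε)⁻¹ : ℂ) • u)) (T.adjoint (hBasis K j))‖ₑ ^ 2 := fun j =>
    (continuous_inner_coherent _ _).measurable.enorm.pow_const 2
  -- A convergent sum in [0, ∞] has countable support, so all but countably many `T† eⱼ` vanish.
  have hcount : {j | ‖T.adjoint (hBasis K j)‖ₑ ^ 2 ≠ 0}.Countable := by
    rw [← hsNormSq_adjoint] at hT
    exact Summable.countable_support_ennreal hT
  have hzero : ∀ j ∉ {j | ‖T.adjoint (hBasis K j)‖ₑ ^ 2 ≠ 0}, T.adjoint (hBasis K j) = 0 := by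
    intro j hj
    simpa using hj
  have hcts : Continuous fun u : V => husimi V Γ ε u := by
    unfold husimi
    have := (continuous_coherent (H := V)).comp (continuous_const_smul (((√ε)⁻¹ : ℂ)))
    exact continuous_const.mul (Complex.continuous_re.comp
      (this.inner ((localization V Γ).continuous.comp this)))
  have hpow : Measurable fun u : V => ‖inner ℂ (power k u) x‖ₑ ^ 2 :=
    (((continuous_power k).inner continuous_const).measurable).enorm.pow_const 2
  rw [husimiMeasure, lintegral_withDensity_eq_lintegral_mul _ hcts.measurable.ennreal_ofReal hpow]
  simp only [Pi.mul_apply, hden, mul_assoc, ← ENNReal.tsum_mul_right]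
  rw [lintegral_const_mul' _ _ ENNReal.ofReal_ne_top, lintegral_tsum_of_countable
    (f := fun j (u : V) => ‖inner ℂ (coherent (((√ε)⁻¹ : ℂ) • u)) (T.adjoint (hBasis K j))‖ₑ ^ 2
      * ‖inner ℂ (power k u) x‖ₑ ^ 2)
    (fun j => ((hmeas j).mul hpow).aemeasurable) hcount (fun j hj => ?_)]
  · simp only [lintegral_power_coherent hε x _ (hfin _), ENNReal.tsum_mul_left, key]
    rw [← mul_assoc, ← ENNReal.ofReal_mul (by positivity), inv_mul_cancel₀ hC.ne',
      ENNReal.ofReal_one, one_mul]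
  · ext u
    simp [hzero j hj]

end LowerSymbolMoments

/-! ### Operator-valued integrals of rank-one projections up to scale. -/

section OperatorIntegral

lemma continuous_rankOne_self {X E : Type*} [TopologicalSpace X] [NormedAddCommGroup E]
    [InnerProductSpace ℂ E] {p : X → E} (hp : Continuous p) :
    Continuous fun u => InnerProductSpace.rankOne ℂ (p u) (p u) :=
  ((ContinuousLinearMap.smulRightL ℂ E E).continuous.comp
    ((innerSL ℂ).continuous.comp hp)).clm_apply hp

/-- An integral of operators of rank one is determined by its expectation values. -/
lemma integral_rankOne_eq {X E : Type*} [TopologicalSpace X] [SecondCountableTopology X]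
    [MeasurableSpace X] [OpensMeasurableSpace X] {μ : Measure X} [NormedAddCommGroup E]
    [InnerProductSpace ℂ E] [FiniteDimensional ℂ E] {p : X → E} (hp : Continuous p)
    {A : E →L[ℂ] E} {c : ℝ} (hc : 0 ≤ c) (hA : ∀ x, ∫⁻ u, ‖inner ℂ (p u) x‖ₑ ^ 2 ∂μ
      = ENNReal.ofReal c * ENNReal.ofReal (inner ℂ x (A x)).re)
    (hr : ∀ x, inner ℂ x (A x) = ((inner ℂ x (A x)).re : ℂ) ∧ 0 ≤ (inner ℂ x (A x)).re) :
    Integrable (fun u => InnerProductSpace.rankOne ℂ (p u) (p u)) μ ∧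
      ∫ u, InnerProductSpace.rankOne ℂ (p u) (p u) ∂μ = (c : ℂ) • A := by
  have : CompleteSpace E := FiniteDimensional.complete ℂ E
  have hint : Integrable (fun u => InnerProductSpace.rankOne ℂ (p u) (p u)) μ := by
    refine ⟨(continuous_rankOne_self hp).aestronglyMeasurable, ?_⟩
    rw [hasFiniteIntegral_iff_enorm]
    -- The norm of the rank-one operator is `‖p u‖²`, a finite sum of coordinates, so integrability
    -- follows from finitely many scalar moments.
    have e : ∀ u, ‖InnerProductSpace.rankOne ℂ (p u) (p u)‖ₑ
        = ∑ i, ‖inner ℂ (p u) (stdOrthonormalBasis ℂ E i)‖ₑ ^ 2 := by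
      intro u
      rw [← ofReal_norm, InnerProductSpace.norm_rankOne, ← sq,
        ← (stdOrthonormalBasis ℂ E).sum_sq_norm_inner_left,
        ENNReal.ofReal_sum_of_nonneg fun _ _ => by positivity]
      simp only [enorm_sq_eq_ofReal]
    simp only [e]
    rw [lintegral_finsetSum _ fun i _ => ((hp.inner continuous_const).measurable.enorm.pow_const 2)]
    simp only [hA]
    exact ENNReal.sum_lt_top.2 fun _ _ =>
      ENNReal.mul_lt_top ENNReal.ofReal_lt_top ENNReal.ofReal_lt_top
  refine ⟨hint, clm_ext_inner fun x => ?_⟩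
  have h1 : (∫ u, InnerProductSpace.rankOne ℂ (p u) (p u) ∂μ) x
      = ∫ u, InnerProductSpace.rankOne ℂ (p u) (p u) x ∂μ :=
    ((ContinuousLinearMap.apply ℂ E x).integral_comp_comm hint).symm
  have h2 : Integrable (fun u => InnerProductSpace.rankOne ℂ (p u) (p u) x) μ :=
    (ContinuousLinearMap.apply ℂ E x).integrable_comp hint
  rw [h1, ← integral_inner h2, smul_apply, inner_smul_right, (hr x).1, ← Complex.ofReal_mul]
  have e : ∀ u, inner ℂ x (InnerProductSpace.rankOne ℂ (p u) (p u) x)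
      = ((‖inner ℂ (p u) x‖ ^ 2 : ℝ) : ℂ) := by
    intro u
    rw [InnerProductSpace.rankOne_apply, inner_smul_right, ← inner_conj_symm x (p u),
      Complex.mul_conj', Complex.ofReal_pow]
  simp only [e]
  rw [integral_complex_ofReal,
    integral_eq_lintegral_of_nonneg_ae (ae_of_all _ fun _ => by positivity)
    (show Continuous fun u => ‖inner ℂ (p u) x‖ ^ 2 by fun_prop).aestronglyMeasurable]
  simp only [← enorm_sq_eq_ofReal, hA, ENNReal.toReal_mul, ENNReal.toReal_ofReal (hr x).2,
    ENNReal.toReal_ofReal hc]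

lemma HasSum.isPositive {ι E : Type*} [NormedAddCommGroup E] [InnerProductSpace ℂ E]
    [CompleteSpace E] {A : ι → E →L[ℂ] E} {B : E →L[ℂ] E} (h : HasSum A B)
    (hA : ∀ i, (A i).IsPositive) : B.IsPositive := by
  have h1 : ∀ x, HasSum (fun i => inner ℂ x (A i x)) (inner ℂ x (B x)) := fun x =>
    (innerSL ℂ x).hasSum (h.mapL (ContinuousLinearMap.apply ℂ E x))
  have h2 : ∀ x i, 0 ≤ (inner ℂ x (A i x)).re ∧ 0 = (inner ℂ x (A i x)).im := fun x i =>
    Complex.le_def.1 ((hA i).inner_nonneg_right x)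
  refine isPositive_of_inner_ofReal (f := fun x => (inner ℂ x (B x)).re)
    (fun x => (Complex.hasSum_re (h1 x)).nonneg fun i => (h2 x i).1) fun x => ?_
  refine Complex.ext rfl ?_
  rw [Complex.ofReal_im]
  refine (Complex.hasSum_im (h1 x)).unique ?_
  simp only [← (h2 x _).2]
  exact hasSum_zero

end OperatorIntegral

lemma IsState.exists_adjoint_comp_self {H : Type*} [NormedAddCommGroup H] [InnerProductSpace ℂ H]
    {Γ : Fock H →L[ℂ] Fock H} (hΓ : IsState Γ) :
    ∃ S : Fock H →L[ℂ] Fock H, Γ = S.adjoint ∘L S ∧ hsNormSq S ≠ ⊤ := by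
  obtain ⟨h1, h2⟩ := hΓ
  obtain ⟨S, hS⟩ := BoseFock.exists_adjoint_comp_self h1
  refine ⟨S, hS, ?_⟩
  rw [← posTrace_adjoint_comp_self, ← hS, h2]
  exact ENNReal.one_ne_top

/-! ### The operator identities in terms of the factors S and T. -/

section LowerSymbolIntegral
variable {H : Type*} [NormedAddCommGroup H] [InnerProductSpace ℂ H] [CompleteSpace H] {K L : Type*}
  [NormedAddCommGroup K] [InnerProductSpace ℂ K] [CompleteSpace K]
  [NormedAddCommGroup L] [InnerProductSpace ℂ L] [CompleteSpace L]
  {V : Submodule ℂ H} [FiniteDimensional ℂ V] {S : Fock H →L[ℂ] K} {T : Fock V →L[ℂ] L}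

lemma integral_power_husimiMeasure [MeasurableSpace H] [BorelSpace H] (hS : hsNormSq S ≠ ⊤)
    (hT : localization V (S.adjoint ∘L S) = T.adjoint ∘L T) {ε : ℝ} (hε : 0 < ε) {k : ℕ}
    (hk : numberMoment (T.adjoint ∘L T) k ≠ ⊤) :
    Integrable (fun u : V => InnerProductSpace.rankOne ℂ (power k u) (power k u))
      (husimiMeasure V (S.adjoint ∘L S) ε) ∧
    ∫ u : V, InnerProductSpace.rankOne ℂ (power k u) (power k u)
        ∂(husimiMeasure V (S.adjoint ∘L S) ε)
      = ((k.factorial : ℂ) * (ε : ℂ) ^ k) • ∑ l ∈ Finset.range (k + 1),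
          (k.choose l : ℂ) • symTensorOne l k (densityMatrix (T.adjoint ∘L T) l) := by
  have hT' : hsNormSq T ≠ ⊤ := by rwa [hsNormSq_localization hS hT]
  have hs : ∀ l ≤ k, Summable fun m => densityTerm (T.adjoint ∘L T) l m :=
    fun l hl => summable_densityTerm hT' hk hl
  have : ProperSpace V := FiniteDimensional.proper ℂ V
  have hc : ((k.factorial : ℂ) * (ε : ℂ) ^ k) = ((k.factorial * ε ^ k : ℝ) : ℂ) := by push_cast; rfl
  rw [hc]
  exact integral_rankOne_eq (continuous_power k) (by positivity)
    (lintegral_power_husimiMeasure hT hT' hε hs) fun x => (tsum_create_eq hT' hs x rfl).2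

lemma isPositive_densityMatrix (hT : hsNormSq T ≠ ⊤) {l : ℕ}
    (hs : Summable fun m => densityTerm (T.adjoint ∘L T) l m) :
    (densityMatrix (T.adjoint ∘L T) l).IsPositive :=
  HasSum.isPositive hs.hasSum (isPositive_densityTerm hT l)

/-- The summand l = k is the density matrix itself, since A ⊗ₛ 1 = A there; the remaining summands
are positive. -/
lemma densityMatrix_le (hT : hsNormSq T ≠ ⊤) {k : ℕ}
    (hk : numberMoment (T.adjoint ∘L T) k ≠ ⊤) {c : ℂ} (hc : 0 ≤ c) :
    c • densityMatrix (T.adjoint ∘L T) k ≤ c • ∑ l ∈ Finset.range (k + 1),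
      (k.choose l : ℂ) • symTensorOne l k (densityMatrix (T.adjoint ∘L T) l) := by
  rw [ContinuousLinearMap.le_def, ← smul_sub, Finset.sum_range_succ, symTensorOne_self,
    Nat.choose_self, Nat.cast_one, one_smul, add_sub_cancel_right]
  refine ContinuousLinearMap.IsPositive.smul_of_nonneg
    (ContinuousLinearMap.isPositive_sum _ fun l hl => ?_) hc
  refine ContinuousLinearMap.IsPositive.smul_of_nonneg (isPositive_symTensorOne l k
    (isPositive_densityMatrix hT (summable_densityTerm hT hk ?_))) (by positivity)
  simpa using (Finset.mem_range.1 hl).le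

/-- The series of compressed terms has two limits that must agree: the localized density matrix, and
the compression of the norm-convergent series for Γ^(l). -/
lemma compress_densityMatrix (hS : hsNormSq S ≠ ⊤)
    (hT : localization V (S.adjoint ∘L S) = T.adjoint ∘L T) {k l : ℕ} (hl : l ≤ k)
    (hk : numberMoment (S.adjoint ∘L S) k ≠ ⊤) :
    densityMatrix (T.adjoint ∘L T) l = compress V (densityMatrix (S.adjoint ∘L S) l) := by
  have hT' : hsNormSq T ≠ ⊤ := by rwa [hsNormSq_localization hS hT]
  have hk' : numberMoment (T.adjoint ∘L T) k ≠ ⊤ :=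
    ne_top_of_le_ne_top hk (numberMoment_localization_le hS hT k)
  have h := hasSum_compress_densityTerm hS hT (summable_densityTerm hT' hk' hl)
  obtain ⟨C, hC⟩ := exists_compressL (symIncl V l).adjoint (symIncl V l)
  have h2 := (summable_densityTerm hS hk hl).hasSum.mapL C
  simp only [hC] at h2
  exact h.unique h2

end LowerSymbolIntegral

/-! ### Transfer from factors to states. -/

section States
variable {H : Type*} [NormedAddCommGroup H] [InnerProductSpace ℂ H] [CompleteSpace H]
  {Γ : Fock H →L[ℂ] Fock H} {V : Submodule ℂ H} [FiniteDimensional ℂ V]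

lemma IsState.hasSum_compress_densityTerm (hΓ : IsState Γ) {k l : ℕ} (hl : l ≤ k)
    (hk : numberMoment (localization V Γ) k < ⊤) :
    HasSum (fun m => compress V (densityTerm Γ l m)) (densityMatrix (localization V Γ) l) := by
  obtain ⟨S, rfl, hS⟩ := hΓ.exists_adjoint_comp_self
  obtain ⟨T, hT⟩ := BoseFock.exists_adjoint_comp_self (isPositive_localization (V := V) hS)
  have hT' : hsNormSq T ≠ ⊤ := by rwa [hsNormSq_localization hS hT]
  rw [hT] at hk ⊢
  exact BoseFock.hasSum_compress_densityTerm hS hT (summable_densityTerm hT' hk.ne hl)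

lemma IsState.numberMoment_localization_lt_top (hΓ : IsState Γ) {k : ℕ}
    (hk : numberMoment Γ k < ⊤) : numberMoment (localization V Γ) k < ⊤ := by
  obtain ⟨S, rfl, hS⟩ := hΓ.exists_adjoint_comp_self
  obtain ⟨T, hT⟩ := BoseFock.exists_adjoint_comp_self (isPositive_localization (V := V) hS)
  rw [hT]
  exact (numberMoment_localization_le hS hT k).trans_lt hk

lemma IsState.densityMatrix_localization (hΓ : IsState Γ) {k l : ℕ} (hl : l ≤ k)
    (hk : numberMoment Γ k < ⊤) :
    densityMatrix (localization V Γ) l = compress V (densityMatrix Γ l) := by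
  obtain ⟨S, rfl, hS⟩ := hΓ.exists_adjoint_comp_self
  obtain ⟨T, hT⟩ := BoseFock.exists_adjoint_comp_self (isPositive_localization (V := V) hS)
  rw [hT]
  exact compress_densityMatrix hS hT hl hk.ne

lemma IsState.densityMatrix_localization_le (hΓ : IsState Γ) {k : ℕ}
    (hk : numberMoment (localization V Γ) k < ⊤) {c : ℂ} (hc : 0 ≤ c) :
    c • densityMatrix (localization V Γ) k ≤ c • ∑ l ∈ Finset.range (k + 1),
      (k.choose l : ℂ) • symTensorOne l k (densityMatrix (localization V Γ) l) := by
  obtain ⟨S, rfl, hS⟩ := hΓ.exists_adjoint_comp_self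
  obtain ⟨T, hT⟩ := BoseFock.exists_adjoint_comp_self (isPositive_localization (V := V) hS)
  have hT' : hsNormSq T ≠ ⊤ := by rwa [hsNormSq_localization hS hT]
  rw [hT] at hk ⊢
  exact densityMatrix_le hT' hk.ne hc

lemma IsState.integral_power_husimiMeasure [MeasurableSpace H] [BorelSpace H] (hΓ : IsState Γ)
    {ε : ℝ} (hε : 0 < ε) {k : ℕ} (hk : numberMoment (localization V Γ) k < ⊤) :
    Integrable (fun u : V => InnerProductSpace.rankOne ℂ (power k u) (power k u))
      (husimiMeasure V Γ ε) ∧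
    ∫ u : V, InnerProductSpace.rankOne ℂ (power k u) (power k u) ∂(husimiMeasure V Γ ε)
      = ((k.factorial : ℂ) * (ε : ℂ) ^ k) • ∑ l ∈ Finset.range (k + 1),
          (k.choose l : ℂ) • symTensorOne l k (densityMatrix (localization V Γ) l) := by
  refine hΓ.exists_adjoint_comp_self.elim fun S hS => ?_
  refine (BoseFock.exists_adjoint_comp_self
    (isPositive_localization (V := V) hS.2)).elim fun T hT => ?_
  have hloc : localization V Γ = T.adjoint ∘L T := by rw [hS.1, hT]
  rw [hloc] at hk ⊢
  rw [hS.1]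
  exact BoseFock.integral_power_husimiMeasure hS.2 hT hε hk.ne

end States

end BoseFock
end

theorem lemma6p2 {H : Type*} [NormedAddCommGroup H] [InnerProductSpace ℂ H] [CompleteSpace H]
    [MeasurableSpace H] [BorelSpace H]
    (Γ : BoseFock.Fock H →L[ℂ] BoseFock.Fock H) (hΓ : BoseFock.IsState Γ)
    (V : Submodule ℂ H) [FiniteDimensional ℂ V] (ε : ℝ) (hε : 0 < ε) (k : ℕ) :
    (BoseFock.numberMoment (BoseFock.localization V Γ) k < ⊤ →
      (∀ ℓ ≤ k, HasSum (fun m => BoseFock.compress V (BoseFock.densityTerm Γ ℓ m))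
        (BoseFock.densityMatrix (BoseFock.localization V Γ) ℓ)) ∧
      MeasureTheory.Integrable
        (fun u : V => InnerProductSpace.rankOne ℂ (BoseFock.power k u) (BoseFock.power k u))
        (BoseFock.husimiMeasure V Γ ε) ∧
      ∫ u : V, InnerProductSpace.rankOne ℂ (BoseFock.power k u) (BoseFock.power k u)
          ∂(BoseFock.husimiMeasure V Γ ε)
        = ((k.factorial : ℂ) * (ε : ℂ) ^ k) • ∑ ℓ ∈ Finset.range (k + 1),
            (k.choose ℓ : ℂ) • BoseFock.symTensorOne ℓ k
              (BoseFock.densityMatrix (BoseFock.localization V Γ) ℓ) ∧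
      ((k.factorial : ℂ) * (ε : ℂ) ^ k) • BoseFock.densityMatrix (BoseFock.localization V Γ) k
        ≤ ∫ u : V, InnerProductSpace.rankOne ℂ (BoseFock.power k u) (BoseFock.power k u)
            ∂(BoseFock.husimiMeasure V Γ ε)) ∧
    (BoseFock.numberMoment Γ k < ⊤ →
      BoseFock.numberMoment (BoseFock.localization V Γ) k < ⊤ ∧
      (∀ ℓ ≤ k, BoseFock.densityMatrix (BoseFock.localization V Γ) ℓ
        = BoseFock.compress V (BoseFock.densityMatrix Γ ℓ)) ∧
      ((k.factorial : ℂ) * (ε : ℂ) ^ k) • BoseFock.compress V (BoseFock.densityMatrix Γ k)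
        ≤ ∫ u : V, InnerProductSpace.rankOne ℂ (BoseFock.power k u) (BoseFock.power k u)
            ∂(BoseFock.husimiMeasure V Γ ε)) := by
  have hc : (0 : ℂ) ≤ (k.factorial : ℂ) * (ε : ℂ) ^ k :=
    mul_nonneg (Nat.cast_nonneg _) (pow_nonneg (Complex.zero_le_real.2 hε.le) _)
  have hle : BoseFock.numberMoment (BoseFock.localization V Γ) k < ⊤ →
      ((k.factorial : ℂ) * (ε : ℂ) ^ k) • BoseFock.densityMatrix (BoseFock.localization V Γ) k
        ≤ ∫ u : V, InnerProductSpace.rankOne ℂ (BoseFock.power k u) (BoseFock.power k u)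
            ∂(BoseFock.husimiMeasure V Γ ε) := fun hk => by
    rw [(hΓ.integral_power_husimiMeasure hε hk).2]
    exact hΓ.densityMatrix_localization_le hk hc
  refine ⟨fun hk => ⟨fun ℓ hl => hΓ.hasSum_compress_densityTerm hl hk,
    (hΓ.integral_power_husimiMeasure hε hk).1, (hΓ.integral_power_husimiMeasure hε hk).2, hle hk⟩,
    fun hk => ⟨hΓ.numberMoment_localization_lt_top hk,
      fun ℓ hl => hΓ.densityMatrix_localization hl hk, ?_⟩⟩
  rw [← hΓ.densityMatrix_localization le_rfl hk]
  exact hle (hΓ.numberMoment_localization_lt_top hk)
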